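/- Let $(B,g_B)$ be a $d$-dimensional smooth Riemannian manifold without boundary, $f:B\to(0,\infty)$ a smooth function, and $N\ge 1$ a real number. Let $F$ be an $n$-dimensional smooth manifold without boundary with a Finsler structure $\mathcal F_F:TF\to[0,\infty)$, i.e. $\mathcal F_F$ is $C^\infty$ off the zero section, positively $1$-homogeneous on fibres, and its fundamental tensor $g_v=\frac12\partial_v^2(\mathcal F_F^2)$ is positive definite at every $v\neq0$ (reversibility $\mathcal F_F(-v)=\mathcal F_F(v)$ is not required). Let $m_F$ be a smooth measure on $F$, i.e. one with a smooth positive density with respect to Lebesgue measure in local coordinates. On $C=B\times F$ put $$\mathcal F_C(\xi+v)=\sqrt{g_B(\xi,\xi)+f^2\,\mathcal F_F(v)^2},\qquad m_C=f^N\,\mathrm{vol}_{g_B}\otimes m_F,$$ for $\xi+v\in T_{(p,x)}C=T_pB\oplus T_xF$ (the $N$-warped product). For a Riemannian metric $g$ on a $k$-dimensional manifold, a smooth function $\Psi$ and a real number $N'\geq 1$, let $$\mathrm{Ric}_g^{N',\Psi}(w)=\mathrm{Ric}_g(w,w)+\nabla^2\Psi(w,w)-\tfrac{1}{N'-k}\,(d\Psi(w))^2\quad\text{if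 }N'>k;$$ if $N'=k$, let it be $\mathrm{Ric}_g(w,w)+\nabla^2\Psi(w,w)$ when $d\Psi(w)=0$ and $-\infty$ otherwise; if $N'<k$, let it be $-\infty$ for $w\ne0$ and $0$ for $w=0$. For $(M,\mathcal F,m)=(F,\mathcal F_F,m_F)$ or $(C,\mathcal F_C,m_C)$, and a tangent vector $w\in T_qM$ near which $\mathcal F$ is smooth with positive definite fundamental tensor, choose a smooth vector field $W$ on a neighbourhood $U$ of $q$ with $W_q=w$, with values in such directions, all of whose integral curves are geodesics of $\mathcal F$ (solutions of the Euler–Lagrange equation of $\frac12\mathcal F^2$). Let $g^W$ be the Riemannian metric on $U$ given by the fundamental tensor of $\mathcal F$ along $W$, write $m=e^{-\Psi_W}\mathrm{vol}_{g^W}$ on $U$, and set $\mathrm{Ric}^{N',m}_M(w)=\mathrm{Ric}_{g^W}^{N',\Psi_W}(w)\in[-\infty,\infty)$. Let $p\in B$, $x\in F$, $\xi\in T_pB$ and $v\in T_xF$ with $v\neq0$. Then $\mathrm{Ric}^{N+d,m_C}_C(\xi+v)$ and $\mathrm{Ric}^{N,m_F}_F(v)$ are well defined (geodesic vector fields as above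 exist, and the value does not depend on the choice), and $$\mathrm{Ric}^{N+d,m_C}_{C}(\xi+v)=\mathrm{Ric}_{B}(\xi,\xi)-N\,\frac{\nabla^2f(\xi,\xi)}{f(p)}+\mathrm{Ric}^{N,m_F}_F(v)-\left(\frac{\Delta f(p)}{f(p)}+(N-1)\frac{|\nabla f|_p^2}{f(p)^2}\right)\mathcal F_{C}(v)^2,$$ where $\nabla$, $\nabla^2$ and $\Delta=\mathrm{tr}\,\nabla^2$ are those of $g_B$, and $\mathcal F_C(v)=f(p)\mathcal F_F(v)$. -/

import Mathlib

open Set Filter MeasureTheory Module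
open scoped Topology Manifold ContDiff

set_option maxSynthPendingDepth 3

noncomputable section

namespace WarpedFinsler

/-! ### Riemannian geometry in coordinates

`G : E → E →L[ℝ] E →L[ℝ] ℝ` is the coordinate expression of a metric. -/

section Local

variable {E : Type*} [NormedAddCommGroup E] [NormedSpace ℝ E]

/-- Christoffel symbols of the first kind:
`christoffelFirst G u X Y Z = (1/2) (∂_X G(Y,Z) + ∂_Y G(X,Z) - ∂_Z G(X,Y))`. -/
def christoffelFirst (G : E → E →L[ℝ] E →L[ℝ] ℝ) (u : E) : E →L[ℝ] E →L[ℝ] E →L[ℝ] ℝ :=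
  let T : E →L[ℝ] E →L[ℝ] E →L[ℝ] ℝ := fderiv ℝ G u
  let S : E →L[ℝ] E →L[ℝ] E →L[ℝ] ℝ :=
    (ContinuousLinearMap.flipₗᵢ ℝ E E ℝ).toContinuousLinearEquiv.toContinuousLinearMap.comp T.flip
  (1 / 2 : ℝ) • (T + T.flip - S)

/-- Christoffel symbols of the Levi-Civita connection: `christoffel G u X Y = ∇_X Y` at `u` for
constant fields `X, Y`, that is, `G(∇_X Y, Z) = christoffelFirst G u X Y Z`. -/
def christoffel (G : E → E →L[ℝ] E →L[ℝ] ℝ) (u : E) : E →L[ℝ] E →L[ℝ] E :=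
  (ContinuousLinearMap.compL ℝ E (E →L[ℝ] ℝ) E (G u).inverse).comp (christoffelFirst G u)

/-- The endomorphism `X ↦ R(X,Y)Z`, where `R(X,Y)Z = ∇_X ∇_Y Z - ∇_Y ∇_X Z` for constant fields. -/
def curvatureEndo (G : E → E →L[ℝ] E →L[ℝ] ℝ) (u Y Z : E) : E →L[ℝ] E :=
  ((fderiv ℝ (christoffel G) u).flip Y).flip Z - (fderiv ℝ (christoffel G) u Y).flip Z
    + (christoffel G u).flip (christoffel G u Y Z)
    - (christoffel G u Y).comp ((christoffel G u).flip Z)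

/-- The Ricci tensor `Ric(Y,Z)`, the trace of `X ↦ R(X,Y)Z`. -/
def localRicci (G : E → E →L[ℝ] E →L[ℝ] ℝ) (u Y Z : E) : ℝ :=
  LinearMap.trace ℝ E (curvatureEndo G u Y Z : E →ₗ[ℝ] E)

/-- The Hessian `∇²h(X,Y) = ∂_X ∂_Y h - (∇_X Y) h` for constant fields. -/
def localHessian (G : E → E →L[ℝ] E →L[ℝ] ℝ) (h : E → ℝ) (u : E) : E →L[ℝ] E →L[ℝ] ℝ :=
  fderiv ℝ (fderiv ℝ h) u
    - (ContinuousLinearMap.compL ℝ E E ℝ (fderiv ℝ h u)).comp (christoffel G u)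

/-- The Laplacian, the `G`-trace of the Hessian. -/
def localLaplacian (G : E → E →L[ℝ] E →L[ℝ] ℝ) (h : E → ℝ) (u : E) : ℝ :=
  LinearMap.trace ℝ E ((G u).inverse.comp (localHessian G h u) : E →ₗ[ℝ] E)

/-- `|∇h|² = dh(∇h)`, where the gradient `∇h` is `G⁻¹ dh`. -/
def localGradSq (G : E → E →L[ℝ] E →L[ℝ] ℝ) (h : E → ℝ) (u : E) : ℝ :=
  fderiv ℝ h u ((G u).inverse (fderiv ℝ h u))

/-- `√(det (b (eᵢ, eⱼ)))` for the coordinate basis `eᵢ` of `E`. -/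
def sqrtDet [FiniteDimensional ℝ E] (b : E →L[ℝ] E →L[ℝ] ℝ) : ℝ :=
  Real.sqrt (Matrix.det (Matrix.of fun i j => b (finBasis ℝ E i) (finBasis ℝ E j)))

/-- Lebesgue measure on `E`, normalized by the same coordinate basis. -/
def lebesgue (E : Type*) [NormedAddCommGroup E] [NormedSpace ℝ E] [FiniteDimensional ℝ E]
    [MeasurableSpace E] [BorelSpace E] : Measure E :=
  (finBasis ℝ E).addHaar

end Local

/-! ### Manifolds

The curvature quantities at `p` are computed in the preferred chart at `p`; through this chart
Mathlib identifies `TangentSpace I p` with the model space `E`. -/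

section Manifold

variable {E : Type*} [NormedAddCommGroup E] [NormedSpace ℝ E]
  {H : Type*} [TopologicalSpace H] (I : ModelWithCorners ℝ E H)
  {M : Type*} [TopologicalSpace M] [ChartedSpace H M]

/-- The differential at `u` of the inverse of the chart at `p`; its values are in
`TangentSpace I ((extChartAt I p).symm u)`, which is the vector space `E`. -/
def frame (p : M) (u : E) : E →L[ℝ] E :=
  mfderiv 𝓘(ℝ, E) I (extChartAt I p).symm u

/-- A (not necessarily everywhere smooth) field of bilinear forms, in the chart at `p`. -/
def metricInChart (g : ∀ x : M, TangentSpace I x →L[ℝ] TangentSpace I x →L[ℝ] ℝ) (p : M) (u : E) :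
    E →L[ℝ] E →L[ℝ] ℝ :=
  let b : E →L[ℝ] E →L[ℝ] ℝ := g ((extChartAt I p).symm u)
  b.bilinearComp (frame I p u) (frame I p u)

/-- The Ricci tensor of the metric `g`. -/
def ricci (g : ∀ x : M, TangentSpace I x →L[ℝ] TangentSpace I x →L[ℝ] ℝ) (p : M)
    (v w : TangentSpace I p) : ℝ :=
  localRicci (metricInChart I g p) (extChartAt I p p) v w

/-- The Hessian of `h` with respect to the metric `g`. -/
def hessian (g : ∀ x : M, TangentSpace I x →L[ℝ] TangentSpace I x →L[ℝ] ℝ) (h : M → ℝ) (p : M)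
    (v w : TangentSpace I p) : ℝ :=
  localHessian (metricInChart I g p) (h ∘ (extChartAt I p).symm) (extChartAt I p p) v w

/-- The Laplacian of `h` with respect to the metric `g`. -/
def laplacian (g : ∀ x : M, TangentSpace I x →L[ℝ] TangentSpace I x →L[ℝ] ℝ) (h : M → ℝ)
    (p : M) : ℝ :=
  localLaplacian (metricInChart I g p) (h ∘ (extChartAt I p).symm) (extChartAt I p p)

/-- The squared norm of the gradient of `h` with respect to the metric `g`. -/
def gradSq (g : ∀ x : M, TangentSpace I x →L[ℝ] TangentSpace I x →L[ℝ] ℝ) (h : M → ℝ)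
    (p : M) : ℝ :=
  localGradSq (metricInChart I g p) (h ∘ (extChartAt I p).symm) (extChartAt I p p)

open Classical in
/-- The `N`-Ricci curvature `Ric^{N,Ψ}(v)` of the metric `g` with weight `e^{-Ψ}`. -/
def weightedRicci (g : ∀ x : M, TangentSpace I x →L[ℝ] TangentSpace I x →L[ℝ] ℝ) (Ψ : M → ℝ)
    (N : ℝ) (p : M) (v : TangentSpace I p) : EReal :=
  let n : ℝ := finrank ℝ E
  let dΨ : ℝ := mfderiv I 𝓘(ℝ, ℝ) Ψ p v
  if n < N then
    ((ricci I g p v v + hessian I g Ψ p v v - dΨ ^ 2 / (N - n) : ℝ) : EReal)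
  else if N = n then
    if dΨ = 0 then ((ricci I g p v v + hessian I g Ψ p v v : ℝ) : EReal) else ⊥
  else if v = 0 then 0 else ⊥

/-! ### Finsler structures -/

/-- The fundamental tensor `g_v(w,w') = (1/2) ∂²(𝓕²)/∂w∂w'` at `v`, a second derivative along the
fibre `TangentSpace I x`, which is the vector space `E`. -/
def fundamentalTensor (𝓕 : ∀ x : M, TangentSpace I x → ℝ) (x : M) (v : TangentSpace I x) :
    TangentSpace I x →L[ℝ] TangentSpace I x →L[ℝ] ℝ :=
  (fderiv ℝ (fderiv ℝ fun w : E => 𝓕 x w ^ 2 / 2) (v : E) : E →L[ℝ] E →L[ℝ] ℝ)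

variable (M) in
/-- A smooth Finsler structure (not necessarily reversible). -/
structure FinslerStructure [IsManifold I ∞ M] where
  /-- the Finsler function -/
  toFun : ∀ x : M, TangentSpace I x → ℝ
  nonneg : ∀ x v, 0 ≤ toFun x v
  smooth : ContMDiffOn I.tangent 𝓘(ℝ, ℝ) ∞ (fun z : TangentBundle I M => toFun z.1 z.2)
    {z | z.2 ≠ 0}
  homogeneous : ∀ (x : M) (v : TangentSpace I x) (t : ℝ), 0 < t → toFun x (t • v) = t * toFun x v
  convex : ∀ (x : M) (v w : TangentSpace I x), v ≠ 0 → w ≠ 0 →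
    0 < fundamentalTensor I toFun x v w w

/-- The energy Lagrangian `𝓕² / 2` in the chart at `p`. -/
def energyInChart (𝓕 : ∀ x : M, TangentSpace I x → ℝ) (p : M) (u w : E) : ℝ :=
  𝓕 ((extChartAt I p).symm u) (frame I p u w) ^ 2 / 2

/-- The geodesic equation at time `t`, the Euler-Lagrange equation
`d/dt (∂L/∂w)(c, c') = (∂L/∂u)(c, c')` of `L = 𝓕² / 2` in the chart at `γ t`. -/
def IsGeodesicAt (𝓕 : ∀ x : M, TangentSpace I x → ℝ) (γ : ℝ → M) (t : ℝ) : Prop :=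
  let L : E → E → ℝ := energyInChart I 𝓕 (γ t)
  let c : ℝ → E := fun s => extChartAt I (γ t) (γ s)
  HasDerivAt (fun s => fderiv ℝ (L (c s)) (deriv c s))
    (fderiv ℝ (fun u => L u (deriv c t)) (c t)) t

/-- `V` is a smooth vector field on the open set `U`, with values in the directions in which `𝓕` is
smooth with positive definite fundamental tensor, and all its integral curves are geodesics. -/
structure IsGeodesicField [IsManifold I ∞ M] (𝓕 : ∀ x : M, TangentSpace I x → ℝ) (U : Set M)
    (V : ∀ x : M, TangentSpace I x) : Prop where
  isOpen : IsOpen U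
  smooth : ContMDiffOn I I.tangent ∞ (fun x => (⟨x, V x⟩ : TangentBundle I M)) U
  regular : ∀ x ∈ U,
    ContMDiffAt I.tangent 𝓘(ℝ, ℝ) ∞ (fun z : TangentBundle I M => 𝓕 z.1 z.2) ⟨x, V x⟩
  convex : ∀ x ∈ U, ∀ w : TangentSpace I x, w ≠ 0 → 0 < fundamentalTensor I 𝓕 x (V x) w w
  geodesic : ∀ (γ : ℝ → M) (t : ℝ), γ t ∈ U → IsMIntegralCurveAt γ V t → IsGeodesicAt I 𝓕 γ t

/-! ### Measures -/

section Measure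

variable [FiniteDimensional ℝ E] [MeasurableSpace E] [BorelSpace E] [MeasurableSpace M]

/-- The measure on the domain of the chart at `p` with density `ρ` with respect to Lebesgue measure
in the coordinates of this chart, as a measure on `M`. -/
def chartMeasure (p : M) (ρ : E → ℝ) : Measure M :=
  (((lebesgue E).restrict (extChartAt I p).target).withDensity fun u => ENNReal.ofReal (ρ u)).map
    (extChartAt I p).symm

/-- `m` has a smooth positive density with respect to Lebesgue measure in local coordinates. -/
def IsSmoothMeasure (m : Measure M) : Prop :=
  ∀ p : M, ∃ ρ : E → ℝ, ContDiffOn ℝ ∞ ρ (extChartAt I p).target ∧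
    (∀ u ∈ (extChartAt I p).target, 0 < ρ u) ∧
    m.restrict (extChartAt I p).source = chartMeasure I p ρ

/-- The Riemannian volume measure, `√(det g_{ij}) dx` in every chart. The measures on the single
chart domains agree on overlaps, so their supremum is the measure that they glue to. -/
def riemannianVolume (g : ∀ x : M, TangentSpace I x →L[ℝ] TangentSpace I x →L[ℝ] ℝ) : Measure M :=
  ⨆ p : M, chartMeasure I p fun u => sqrtDet (metricInChart I g p u)

/-- `r` is the value of the `N`-Ricci curvature `Ric^{N,m}(v)` computed by means of some geodesic
vector field `V` with `V p = v` on a neighbourhood `U` of `p`: it is `Ric^{N,Ψ}(v)` for the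
Riemannian metric `g^V` on `U`, where `m = e^{-Ψ} vol_{g^V}` on `U`. -/
def HasNRicci [IsManifold I ∞ M] (𝓕 : ∀ x : M, TangentSpace I x → ℝ) (m : Measure M) (N : ℝ)
    (p : M) (v : TangentSpace I p) (r : EReal) : Prop :=
  ∃ (U : Set M) (V : ∀ x : M, TangentSpace I x) (Ψ : M → ℝ),
    p ∈ U ∧ IsGeodesicField I 𝓕 U V ∧ V p = v ∧ ContMDiffOn I 𝓘(ℝ, ℝ) ∞ Ψ U ∧
    m.restrict U = ((riemannianVolume I fun x => fundamentalTensor I 𝓕 x (V x)).restrict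
      U).withDensity (fun x => ENNReal.ofReal (Real.exp (-Ψ x))) ∧
    r = weightedRicci I (fun x => fundamentalTensor I 𝓕 x (V x)) Ψ N p v

open Classical in
/-- The `N`-Ricci curvature `Ric^{N,m}(v)` (it is `0` by convention where it is not defined). -/
def nRicci [IsManifold I ∞ M] (𝓕 : ∀ x : M, TangentSpace I x → ℝ) (m : Measure M) (N : ℝ)
    (p : M) (v : TangentSpace I p) : EReal :=
  if h : ∃ r, HasNRicci I 𝓕 m N p v r then h.choose else 0

end Measure

end Manifold

/-! ### Warped products -/

section Warped

variable {EB : Type*} [NormedAddCommGroup EB] [NormedSpace ℝ EB]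
  {HB : Type*} [TopologicalSpace HB] (IB : ModelWithCorners ℝ EB HB)
  {B : Type*} [TopologicalSpace B] [ChartedSpace HB B]
  {EF : Type*} [NormedAddCommGroup EF] [NormedSpace ℝ EF]
  {HF : Type*} [TopologicalSpace HF] (IF : ModelWithCorners ℝ EF HF)
  {F : Type*} [TopologicalSpace F] [ChartedSpace HF F]

/-- The tangent vector `ξ + v` of `B × F`. -/
def tangentSum (p : B) (x : F) (ξ : TangentSpace IB p) (v : TangentSpace IF x) :
    TangentSpace (IB.prod IF) (p, x) :=
  ((ξ, v) : EB × EF)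

/-- The warped product structure `√(g_B(ξ,ξ) + f² 𝓕(v)²)` on `B × F`. -/
def warpedFinsler (g : ∀ p : B, TangentSpace IB p →L[ℝ] TangentSpace IB p →L[ℝ] ℝ) (f : B → ℝ)
    (𝓕 : ∀ x : F, TangentSpace IF x → ℝ) (z : B × F) (w : TangentSpace (IB.prod IF) z) : ℝ :=
  Real.sqrt (g z.1 (w : EB × EF).1 (w : EB × EF).1 + f z.1 ^ 2 * 𝓕 z.2 (w : EB × EF).2 ^ 2)

/-- The measure `f^N vol_B ⊗ m_F` of the `N`-warped product. -/
def warpedMeasure [FiniteDimensional ℝ EB] [MeasurableSpace EB] [BorelSpace EB]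
    [MeasurableSpace B] [MeasurableSpace F]
    (g : ∀ p : B, TangentSpace IB p →L[ℝ] TangentSpace IB p →L[ℝ] ℝ) (f : B → ℝ)
    (m : Measure F) (N : ℝ) : Measure (B × F) :=
  ((riemannianVolume IB g).withDensity fun p => ENNReal.ofReal (f p ^ N)).prod m

end Warped

end WarpedFinsler

end

set_option linter.unusedSectionVars false

noncomputable section

namespace WarpedFinsler

universe u

/-! The `N`-Ricci curvature is defined through an auxiliary geodesic field `V`; the proof rewrites
it as an expression in the vector alone and then computes that expression for the warped product.

Write `Λ = 𝓕² / 2` in a chart and let `S = spray Λ` be the acceleration of geodesics, `c'' = S (c,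
c')`. The fundamental tensor is homogeneous of degree zero, so by Euler's identity its fibre
derivative vanishes when contracted with the reference vector. Hence, for a geodesic field, the
Christoffel symbols of `g^V` satisfy `Γ(V, X) = -½ ∂_y S (X)` (`christoffel_geodesicField`).
Differentiating this and Euler's identity `∂_y S (V) = 2 S` gives `R(·, V)V = -∂_x S + ½ S(∂_y S) -
¼ (∂_y S)²`, where `S(·)` is differentiation along the spray (`curvatureEndo_geodesicField`). If `m`
has density `ρ`, then `Ψ_V(y) = τ(y, V y)` with `τ = log √det g - log ρ` (`distortion`). Since `∇_V
V = 0`, the first derivative and the Hessian of `Ψ_V` in the direction `V` are `Sτ` and `SSτ`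
(`localHessian_geodesicField`). So for `N > n = dim` the curvature is `tr R_S + SSτ - (Sτ)² / (N -
n)` at the given vector, whatever `V` is, and the other cases are similar (`sprayNRicci`,
`IsRegularAt.weightedRicci_eq`). Geodesic fields exist: solutions are started on a hyperplane
transversal to `w` with constant velocity `w` (`exists_smooth_velocity_field`). This rests on smooth
flows (`exists_smooth_flow`), obtained from the inverse function theorem in a Banach space of
curves.

For the warped product `Λ_C = ½ g_B(ξ, ξ) + f² Λ_F(v)`, and the spray is `(S_B + 2 f Λ_F ∇f, S_F - 2
(df(ξ)/f) v)` (`WarpedRegular.spray_warpedEnergy`). The trace sees only the diagonal blocks of its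
curvature: `R_B - 2 f Λ_F ∇²f` on the base, and `R_F - (∇²f(ξ,ξ)/f + 2 Λ_F |∇f|²) id + |∇f|² dΛ_F ⊗
v` on the fibre. This gives the asserted formula with `n = dim F` in place of `N` and no weight
(`WarpedRegular.sprayRicci_warpedSpray`).

The weight turns `n` into `N`. The distortion is `τ_C = τ_F + (n - N) log f + const`. With `a = S_F
τ_F` and `μ = df(ξ)/f`, its first derivative along the spray is `a + (n - N) μ`. Its second
derivative is `S_F a - 2 μ a + (n - N)(∇²f(ξ,ξ)/f - μ² + 2 Λ_F |∇f|²)`; the term `-2 μ a` arises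
because `a` has degree one. The denominators `(N + d) - (d + n)` and `N - n` agree, so on
subtracting the square the terms in `μ a` and `μ²` cancel, and the rest replaces `n` by `N`
(`WarpedRegular.sprayNRicci_warpedSpray`). -/

/-! ### Smooth dependence of solutions of ordinary differential equations -/

section Flow

/-- The inverse function theorem, with smoothness of the inverse on a neighbourhood. -/
lemma exists_smooth_local_inverse {X Y : Type*} [NormedAddCommGroup X] [NormedSpace ℝ X]
    [CompleteSpace X] [NormedAddCommGroup Y] [NormedSpace ℝ Y]
    {Φ : X → Y} {a₀ : X} (hΦ : ∀ᶠ a in 𝓝 a₀, ContDiffAt ℝ ∞ Φ a) (e : X ≃L[ℝ] Y)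
    (he : HasFDerivAt Φ (e : X →L[ℝ] Y) a₀) :
    ∃ T : OpenPartialHomeomorph X Y, a₀ ∈ T.source ∧ (T : X → Y) = Φ ∧
      ∀ᶠ b in 𝓝 (Φ a₀), ContDiffAt ℝ ∞ T.symm b := by
  have h0 : ContDiffAt ℝ ∞ Φ a₀ := hΦ.self_of_nhds
  let T := h0.toOpenPartialHomeomorph Φ he (by simp)
  have hT : (T : X → Y) = Φ := rfl
  have hs : a₀ ∈ T.source := h0.mem_toOpenPartialHomeomorph_source he (by simp)
  refine ⟨T, hs, hT, ?_⟩
  have hcont : ContinuousAt (fderiv ℝ Φ) a₀ := (h0.fderiv_right (m := 0) (by simp)).continuousAt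
  -- Invertible operators form an open set, so the derivative stays invertible at nearby points.
  -- This upgrades smoothness of the inverse from one point to a neighbourhood.
  have hinv : ∀ᶠ a in 𝓝 a₀, ∃ e' : X ≃L[ℝ] Y, (e' : X →L[ℝ] Y) = fderiv ℝ Φ a :=
    hcont (by rw [he.fderiv]; exact ContinuousLinearEquiv.nhds e)
  have hsymm : Tendsto T.symm (𝓝 (Φ a₀)) (𝓝 a₀) := by
    have := T.symm.continuousAt (x := T a₀) (T.map_source hs)
    rwa [ContinuousAt, T.left_inv hs] at this
  have htgt : ∀ᶠ b in 𝓝 (Φ a₀), b ∈ T.target := T.open_target.mem_nhds (T.map_source hs)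
  filter_upwards [htgt, hsymm.eventually hΦ, hsymm.eventually hinv] with b hb h1 ⟨e', he'⟩
  refine T.contDiffAt_symm hb (f₀' := e') ?_ h1
  rw [he']
  exact (h1.differentiableAt (by simp)).hasFDerivAt

variable {K : Type*} [TopologicalSpace K] [CompactSpace K]

/-- Pointwise application of a continuous family of linear maps to a continuous family of
vectors. -/
def pointwiseApply (K : Type*) [TopologicalSpace K] [CompactSpace K]
    (E F : Type*) [NormedAddCommGroup E] [NormedSpace ℝ E] [NormedAddCommGroup F]
    [NormedSpace ℝ F] : C(K, E →L[ℝ] F) →L[ℝ] C(K, E) →L[ℝ] C(K, F) :=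
  LinearMap.mkContinuous₂
    (LinearMap.mk₂ ℝ (fun (A : C(K, E →L[ℝ] F)) (h : C(K, E)) =>
      (⟨fun t => A t (h t), A.continuous.clm_apply h.continuous⟩ : C(K, F)))
      (fun _ _ _ => by ext; simp) (fun _ _ _ => by ext; simp)
      (fun _ _ _ => by ext; simp) (fun _ _ _ => by ext; simp)) 1
    (fun A h => by
      rw [one_mul, ContinuousMap.norm_le _ (by positivity)]
      intro t
      exact (ContinuousLinearMap.le_opNorm _ _).trans
        (mul_le_mul (A.norm_coe_le_norm t) (h.norm_coe_le_norm t) (norm_nonneg _) (norm_nonneg _)))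

/-- The mean value inequality on a ball around each `γ t` bounds the remainder. One radius serves
all `t`, because `fderiv ℝ f` is uniformly continuous along the compact range of `γ`. -/
lemma hasFDerivAt_postcomp {E F : Type*} [NormedAddCommGroup E] [NormedSpace ℝ E]
    [NormedAddCommGroup F] [NormedSpace ℝ F] {f : E → F} (hf : ContDiff ℝ 1 f) (γ : C(K, E)) :
    HasFDerivAt (fun γ : C(K, E) => (⟨f, hf.continuous⟩ : C(E, F)).comp γ)
      (pointwiseApply K E F
        ((⟨fderiv ℝ f, hf.continuous_fderiv (by simp)⟩ : C(E, E →L[ℝ] F)).comp γ)) γ := by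
  have hd : Differentiable ℝ f := hf.differentiable (by simp)
  have hc : Continuous (fderiv ℝ f) := hf.continuous_fderiv (by simp)
  rw [hasFDerivAt_iff_isLittleO_nhds_zero, Asymptotics.isLittleO_iff]
  intro ε hε
  have hK : IsCompact (range γ) := isCompact_range γ.continuous
  have hu := hK.uniformContinuousAt_of_continuousAt (fderiv ℝ f)
    (fun a _ => hc.continuousAt) (Metric.dist_mem_uniformity hε)
  obtain ⟨δ, hδ, hδ'⟩ := Metric.mem_uniformity_dist.1 hu
  filter_upwards [Metric.ball_mem_nhds (0 : C(K, E)) hδ] with h hh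
  rw [ContinuousMap.norm_le _ (by positivity)]
  intro t
  have hht : ‖h t‖ < δ := (h.norm_coe_le_norm t).trans_lt (by simpa using hh)
  have key := (convex_ball (γ t) δ).norm_image_sub_le_of_norm_hasFDerivWithin_le'
    (f := f) (f' := fderiv ℝ f) (φ := fderiv ℝ f (γ t)) (C := ε) (x := γ t) (y := γ t + h t)
    (fun y _ => (hd y).hasFDerivAt.hasFDerivWithinAt)
    (fun y hy => by
      have := hδ' (a := γ t) (b := y) (by rw [dist_comm]; exact hy) (mem_range_self t)
      rw [← dist_eq_norm, dist_comm]
      exact le_of_lt this)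
    (Metric.mem_ball_self hδ) (by simpa using hht)
  rw [add_sub_cancel_left] at key
  exact key.trans (mul_le_mul_of_nonneg_left (h.norm_coe_le_norm t) hε.le)

/-- The derivative is the bounded operator `pointwiseApply` after postcomposition with `fderiv ℝ f`,
a map of the same kind with another target. Hence `F` is quantified inside the induction, and it
shares the universe of `E` so that `E →L[ℝ] F` is again an admissible target. -/
lemma contDiff_postcomp_nat {E : Type u} [NormedAddCommGroup E] [NormedSpace ℝ E] (n : ℕ) :
    ∀ {F : Type u} [NormedAddCommGroup F] [NormedSpace ℝ F] {f : E → F} (hf : ContDiff ℝ ∞ f),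
      ContDiff ℝ n (fun γ : C(K, E) => (⟨f, hf.continuous⟩ : C(E, F)).comp γ) := by
  induction n with
  | zero =>
    intro F _ _ f hf
    exact contDiff_zero.2 (ContinuousMap.continuous_postcomp _)
  | succ n ih =>
    intro F _ _ f hf
    have hf1 : ContDiff ℝ 1 f := hf.of_le (by simp)
    have hf' : ContDiff ℝ ∞ (fderiv ℝ f) := hf.fderiv_right (by simp)
    have h := fun γ : C(K, E) => hasFDerivAt_postcomp hf1 γ
    push_cast
    rw [contDiff_succ_iff_fderiv]
    refine ⟨fun γ => (h γ).differentiableAt, by simp, ?_⟩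
    have : fderiv ℝ (fun γ : C(K, E) => (⟨f, hf.continuous⟩ : C(E, F)).comp γ) =
        fun γ => pointwiseApply K E F ((⟨fderiv ℝ f, hf'.continuous⟩ : C(E, E →L[ℝ] F)).comp γ) :=
      funext fun γ => (h γ).fderiv
    rw [this]
    exact (pointwiseApply K E F).contDiff.comp (ih hf')

lemma contDiff_postcomp {E F : Type u} [NormedAddCommGroup E] [NormedSpace ℝ E]
    [NormedAddCommGroup F] [NormedSpace ℝ F] {f : E → F} (hf : ContDiff ℝ ∞ f) :
    ContDiff ℝ ∞ (fun γ : C(K, E) => (⟨f, hf.continuous⟩ : C(E, F)).comp γ) :=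
  contDiff_infty.2 fun n => contDiff_postcomp_nat n hf

variable {E : Type u} [NormedAddCommGroup E] [NormedSpace ℝ E]

/-- The extension of a curve on `[-1,1]` to the real line by constants. -/
def curveExtend (h : C(Icc (-1 : ℝ) 1, E)) (t : ℝ) : E := h (projIcc (-1) 1 (by norm_num) t)

lemma curveExtend_continuous (h : C(Icc (-1 : ℝ) 1, E)) : Continuous (curveExtend h) :=
  h.continuous.comp continuous_projIcc

lemma curveExtend_of_mem (h : C(Icc (-1 : ℝ) 1, E)) {t : ℝ} (ht : t ∈ Icc (-1 : ℝ) 1) :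
    curveExtend h t = h ⟨t, ht⟩ := by
  rw [curveExtend, projIcc_of_mem _ ht]

/-- The primitive vanishing at `0`, as an operator on continuous curves. -/
def curvePrimitive (E : Type u) [NormedAddCommGroup E] [NormedSpace ℝ E] :
    C(Icc (-1 : ℝ) 1, E) →L[ℝ] C(Icc (-1 : ℝ) 1, E) :=
  LinearMap.mkContinuous
    { toFun := fun h => ⟨fun t => ∫ s in (0 : ℝ)..t, curveExtend h s,
        (intervalIntegral.continuous_primitive
          (fun a b => (curveExtend_continuous h).intervalIntegrable a b) 0).comp
          continuous_subtype_val⟩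
      map_add' := fun h k => by
        ext t
        exact intervalIntegral.integral_add ((curveExtend_continuous h).intervalIntegrable _ _)
          ((curveExtend_continuous k).intervalIntegrable _ _)
      map_smul' := fun c h => by
        ext t
        exact intervalIntegral.integral_smul _ _ } 1
    (fun h => by
      rw [one_mul, ContinuousMap.norm_le _ (norm_nonneg _)]
      rintro ⟨t, ht⟩
      refine (intervalIntegral.norm_integral_le_of_norm_le_const (C := ‖h‖)
        (fun s _ => h.norm_coe_le_norm _)).trans ?_
      have : |t - 0| ≤ 1 := by rw [sub_zero]; exact abs_le.2 ht
      exact mul_le_of_le_one_right (norm_nonneg _) this)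

/-- The curve `t ↦ a (s t)`. -/
def curveScale (s : Icc (-1 : ℝ) 1) : C(Icc (-1 : ℝ) 1, Icc (-1 : ℝ) 1) :=
  ⟨fun t => ⟨s * t, by
    have hs := abs_le.2 s.2
    have ht := abs_le.2 t.2
    refine abs_le.1 ?_
    rw [abs_mul]
    exact mul_le_one₀ hs (abs_nonneg _) ht⟩, by fun_prop⟩

/-- Substitution `r ↦ s r` in the integral. It shows that slowing a solution of `a' = t f(a)` down
by the factor `s` solves `a' = s t f(a)`. -/
lemma curvePrimitive_scale (s : Icc (-1 : ℝ) 1) (h : C(Icc (-1 : ℝ) 1, E)) :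
    (curvePrimitive E h).comp (curveScale s) =
      (s : ℝ) • curvePrimitive E (h.comp (curveScale s)) := by
  ext t
  change ∫ r in (0 : ℝ)..(s * t : ℝ), curveExtend h r = (s : ℝ) • ∫ r in (0 : ℝ)..t,
    curveExtend (h.comp (curveScale s)) r
  have h1 : ∀ r ∈ uIcc (0 : ℝ) t, curveExtend (h.comp (curveScale s)) r
      = curveExtend h (s * r) := by
    intro r hr
    have hr' : r ∈ Icc (-1 : ℝ) 1 := by
      refine (ordConnected_Icc.uIcc_subset ?_ t.2) hr
      norm_num
    rw [curveExtend_of_mem _ hr']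
    exact (curveExtend_of_mem h (curveScale s ⟨r, hr'⟩).2).symm
  rw [intervalIntegral.integral_congr h1, intervalIntegral.smul_integral_comp_mul_left, mul_zero]

variable [CompleteSpace E]

/-- The map whose zeros (in the second component) are the solutions of `a' = ε f(a)`, `a 0 = z`. -/
def flowMap {f : E → E} (hf : ContDiff ℝ ∞ f) (q : (ℝ × E) × C(Icc (-1 : ℝ) 1, E)) :
    (ℝ × E) × C(Icc (-1 : ℝ) 1, E) :=
  (q.1, q.2 - ContinuousMap.const _ q.1.2
    - q.1.1 • curvePrimitive E ((⟨f, hf.continuous⟩ : C(E, E)).comp q.2))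

/-- Constant curves. -/
def constCurve (E : Type u) [NormedAddCommGroup E] [NormedSpace ℝ E] :
    E →L[ℝ] C(Icc (-1 : ℝ) 1, E) :=
  LinearMap.mkContinuous
    { toFun := fun z => ContinuousMap.const _ z
      map_add' := fun _ _ => rfl
      map_smul' := fun _ _ => rfl } 1
    (fun z => by
      rw [one_mul, ContinuousMap.norm_le _ (norm_nonneg _)]
      exact fun _ => le_rfl)

lemma flowMap_contDiff {f : E → E} (hf : ContDiff ℝ ∞ f) : ContDiff ℝ ∞ (flowMap hf) := by
  have h1 : ContDiff ℝ ∞ fun q : (ℝ × E) × C(Icc (-1 : ℝ) 1, E) =>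
      curvePrimitive E ((⟨f, hf.continuous⟩ : C(E, E)).comp q.2) :=
    (curvePrimitive E).contDiff.comp ((contDiff_postcomp hf).comp contDiff_snd)
  have h2 : ContDiff ℝ ∞ fun q : (ℝ × E) × C(Icc (-1 : ℝ) 1, E) => constCurve E q.1.2 :=
    (constCurve E).contDiff.comp (contDiff_snd.comp contDiff_fst)
  exact contDiff_fst.prodMk
    ((contDiff_snd.sub h2).sub ((contDiff_fst.comp contDiff_fst).smul h1))

/-- At time parameter `0` the field contributes only through the derivative of the factor in front
of it. The differential is therefore block triangular with identities on the diagonal, and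
invertible whatever `f` is. -/
lemma flowMap_hasFDerivAt {f : E → E} (hf : ContDiff ℝ ∞ f) (z₀ : E) :
    ∃ e : ((ℝ × E) × C(Icc (-1 : ℝ) 1, E)) ≃L[ℝ] ((ℝ × E) × C(Icc (-1 : ℝ) 1, E)),
      HasFDerivAt (flowMap hf) (e : _ →L[ℝ] _) ((0, z₀), ContinuousMap.const _ z₀) := by
  let c₀ : C(Icc (-1 : ℝ) 1, E) := ContinuousMap.const _ z₀
  let k : C(Icc (-1 : ℝ) 1, E) :=
    curvePrimitive E ((⟨f, hf.continuous⟩ : C(E, E)).comp c₀)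
  let A : (ℝ × E) →L[ℝ] C(Icc (-1 : ℝ) 1, E) :=
    -((constCurve E).comp (ContinuousLinearMap.snd ℝ ℝ E))
      - (ContinuousLinearMap.fst ℝ ℝ E).smulRight k
  refine ⟨(ContinuousLinearEquiv.refl ℝ (ℝ × E)).skewProd
    (ContinuousLinearEquiv.refl ℝ C(Icc (-1 : ℝ) 1, E)) A, ?_⟩
  have h1 : HasFDerivAt (fun q : (ℝ × E) × C(Icc (-1 : ℝ) 1, E) => q.1)
    (ContinuousLinearMap.fst ℝ (ℝ × E) C(Icc (-1 : ℝ) 1, E)) ((0, z₀), c₀) := hasFDerivAt_fst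
  have h2 : HasFDerivAt (fun q : (ℝ × E) × C(Icc (-1 : ℝ) 1, E) => q.2)
    (ContinuousLinearMap.snd ℝ (ℝ × E) C(Icc (-1 : ℝ) 1, E)) ((0, z₀), c₀) := hasFDerivAt_snd
  have h3 : HasFDerivAt (fun q : (ℝ × E) × C(Icc (-1 : ℝ) 1, E) => constCurve E q.1.2)
    ((constCurve E).comp ((ContinuousLinearMap.snd ℝ ℝ E).comp
      (ContinuousLinearMap.fst ℝ (ℝ × E) C(Icc (-1 : ℝ) 1, E)))) ((0, z₀), c₀) :=
    ((constCurve E).comp ((ContinuousLinearMap.snd ℝ ℝ E).comp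
      (ContinuousLinearMap.fst ℝ (ℝ × E) C(Icc (-1 : ℝ) 1, E)))).hasFDerivAt
  have h4 : HasFDerivAt (fun q : (ℝ × E) × C(Icc (-1 : ℝ) 1, E) => q.1.1)
    ((ContinuousLinearMap.fst ℝ ℝ E).comp
      (ContinuousLinearMap.fst ℝ (ℝ × E) C(Icc (-1 : ℝ) 1, E))) ((0, z₀), c₀) :=
    ((ContinuousLinearMap.fst ℝ ℝ E).comp
      (ContinuousLinearMap.fst ℝ (ℝ × E) C(Icc (-1 : ℝ) 1, E))).hasFDerivAt
  have h5 : DifferentiableAt ℝ (fun q : (ℝ × E) × C(Icc (-1 : ℝ) 1, E) =>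
      curvePrimitive E ((⟨f, hf.continuous⟩ : C(E, E)).comp q.2)) ((0, z₀), c₀) :=
    (((curvePrimitive E).contDiff.comp ((contDiff_postcomp hf).comp contDiff_snd)).differentiable
      (by simp)) _
  have h6 := h1.prodMk ((h2.sub h3).sub (h4.smul h5.hasFDerivAt))
  refine h6.congr_fderiv ?_
  ext : 1
  · ext <;> simp [A, k]
  · ext <;> simp [A]

/-- A smooth vector field has a smooth local flow. -/
theorem exists_smooth_flow {f : E → E} (hf : ContDiff ℝ ∞ f) (z₀ : E) :
    ∃ X : ℝ × E → E, (∀ᶠ q in 𝓝 ((0 : ℝ), z₀), ContDiffAt ℝ ∞ X q) ∧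
      (∀ᶠ z in 𝓝 z₀, X (0, z) = z) ∧
      ∀ᶠ q in 𝓝 ((0 : ℝ), z₀), HasDerivAt (fun t => X (t, q.2)) (f (X q)) q.1 := by
  let c₀ : C(Icc (-1 : ℝ) 1, E) := ContinuousMap.const _ z₀
  obtain ⟨e, he⟩ := flowMap_hasFDerivAt hf z₀
  obtain ⟨T, hT0, hT, hTs⟩ := exists_smooth_local_inverse
    (Eventually.of_forall fun _ => (flowMap_contDiff hf).contDiffAt) e he
  have hΦ0 : flowMap hf ((0, z₀), c₀) = ((0, z₀), 0) := by
    simp [flowMap, c₀]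
  rw [hΦ0] at hTs
  have htgt : ((0, z₀), (0 : C(Icc (-1 : ℝ) 1, E))) ∈ T.target := by
    rw [← hΦ0, ← hT]; exact T.map_source hT0
  -- For `q = (t, z)` the curve `γ q` on `[-1,1]` solves `a' = t f(a)`, `a 0 = z`. The flow will be
  -- its value at `1`, so that smoothness in time becomes smoothness in a parameter.
  let γ : ℝ × E → C(Icc (-1 : ℝ) 1, E) := fun q => (T.symm (q, 0)).2
  have hj : ContDiff ℝ ∞ fun q : ℝ × E => (q, (0 : C(Icc (-1 : ℝ) 1, E))) :=
    contDiff_id.prodMk contDiff_const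
  have hγ : ∀ᶠ q in 𝓝 ((0 : ℝ), z₀), ContDiffAt ℝ ∞ γ q := by
    have := (hj.continuous.tendsto ((0 : ℝ), z₀)).eventually hTs
    filter_upwards [this] with q hq
    exact contDiffAt_snd.comp q (hq.comp q hj.contDiffAt)
  have hγ0 : γ (0, z₀) = c₀ := by
    have : T.symm ((0, z₀), 0) = ((0, z₀), c₀) := by
      rw [← hΦ0, ← hT]; exact T.left_inv hT0
    simp [γ, this]
  have htgt' : ∀ᶠ q in 𝓝 ((0 : ℝ), z₀), (q, (0 : C(Icc (-1 : ℝ) 1, E))) ∈ T.target :=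
    (hj.continuous.tendsto ((0 : ℝ), z₀)).eventually (T.open_target.mem_nhds htgt)
  -- a uniform neighbourhood in the source
  obtain ⟨δ, hδ, hδs⟩ := Metric.mem_nhds_iff.1 (T.open_source.mem_nhds hT0)
  have hγδ : ∀ᶠ q in 𝓝 ((0 : ℝ), z₀), dist (γ q) c₀ < δ := by
    have := hγ.self_of_nhds.continuousAt
    rw [ContinuousAt, hγ0] at this
    exact this (Metric.ball_mem_nhds _ hδ)
  obtain ⟨r, hr, hrs⟩ := Metric.mem_nhds_iff.1
    ((hγ.and (htgt'.and hγδ)).and (Metric.ball_mem_nhds _ hδ))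
  have hball : ∀ {t : ℝ} {z : E}, |t| < r → dist z z₀ < r → (t, z) ∈ Metric.ball ((0 : ℝ), z₀) r :=
    fun ht hz => by rw [Metric.mem_ball, Prod.dist_eq]; exact max_lt (by simpa using ht) hz
  -- the equation for `γ`
  have hsol : ∀ {t : ℝ} {z : E}, |t| < r → dist z z₀ < r →
      γ (t, z) = ContinuousMap.const _ z
        + t • curvePrimitive E ((⟨f, hf.continuous⟩ : C(E, E)).comp (γ (t, z))) := by
    intro t z ht hz
    have h1 := T.right_inv (hrs (hball ht hz)).1.2.1
    rw [hT] at h1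
    have h2 : (T.symm ((t, z), 0)).1 = (t, z) := congrArg Prod.fst h1
    have h3 := congrArg Prod.snd h1
    simp only [flowMap, h2] at h3
    rw [sub_eq_zero, sub_eq_iff_eq_add'] at h3
    exact h3
  -- Uniqueness comes from injectivity of the local inverse on its source, hence only among curves
  -- within `δ` of the constant curve.
  have huniq : ∀ {t : ℝ} {z : E} {b : C(Icc (-1 : ℝ) 1, E)}, |t| < r → dist z z₀ < r →
      dist b c₀ < δ → b = ContinuousMap.const _ z
        + t • curvePrimitive E ((⟨f, hf.continuous⟩ : C(E, E)).comp b) → b = γ (t, z) := by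
    intro t z b ht hz hb hbe
    have hmem : ((t, z), b) ∈ T.source := by
      refine hδs ?_
      rw [Metric.mem_ball, Prod.dist_eq]
      exact max_lt (hrs (hball ht hz)).2 hb
    have h1 : T ((t, z), b) = ((t, z), 0) := by
      rw [hT]
      refine Prod.ext rfl ?_
      change b - ContinuousMap.const _ z
        - t • curvePrimitive E ((⟨f, hf.continuous⟩ : C(E, E)).comp b) = 0
      rw [sub_eq_zero, sub_eq_iff_eq_add']
      exact hbe
    have h2 := T.left_inv hmem
    rw [h1] at h2
    simp [γ, h2]
  -- The reparametrised curve solves the equation for the parameter `s t`, so by uniqueness it is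
  -- that solution: time `s` on the curve of `t` is time `1` on the curve of `s t`.
  have hscale : ∀ {t : ℝ} {z : E} (s : Icc (-1 : ℝ) 1), |t| < r → dist z z₀ < r →
      γ (s * t, z) ⟨1, by norm_num⟩ = γ (t, z) s := by
    intro t z s ht hz
    have hst : |(s : ℝ) * t| < r := by
      rw [abs_mul]
      exact (mul_le_of_le_one_left (abs_nonneg _) (abs_le.2 s.2)).trans_lt ht
    have := huniq (b := (γ (t, z)).comp (curveScale s)) hst hz ?_ ?_
    · rw [← this]
      change γ (t, z) (curveScale s _) = _
      congr 1
      exact Subtype.ext (mul_one _)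
    · refine lt_of_le_of_lt ?_ (hrs (hball ht hz)).1.2.2
      rw [ContinuousMap.dist_le dist_nonneg]
      exact fun a => ContinuousMap.dist_apply_le_dist (f := γ (t, z)) (g := c₀) (curveScale s a)
    · conv_lhs => rw [hsol ht hz]
      have := curvePrimitive_scale s ((⟨f, hf.continuous⟩ : C(E, E)).comp (γ (t, z)))
      rw [mul_comm, mul_smul]
      ext a
      have ha := DFunLike.congr_fun this a
      simp only [ContinuousMap.comp_apply, ContinuousMap.add_apply, ContinuousMap.smul_apply,
        ContinuousMap.const_apply] at ha ⊢
      rw [ha]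
      rfl
  refine ⟨fun q => γ q ⟨1, by norm_num⟩, ?_, ?_, ?_⟩
  · filter_upwards [hγ] with q hq
    exact (ContinuousMap.evalCLM ℝ (⟨1, by norm_num⟩ : Icc (-1 : ℝ) 1)).contDiff.contDiffAt.comp q hq
  · filter_upwards [Metric.ball_mem_nhds z₀ hr] with z hz
    have := hsol (t := 0) (by simpa using hr) hz
    rw [this]
    simp
  · have hr2 : |r / 2| < r := by rw [abs_of_pos (by positivity)]; linarith
    filter_upwards [Metric.ball_mem_nhds ((0 : ℝ), z₀) (half_pos hr)] with ⟨t, z⟩ hq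
    rw [Metric.mem_ball, Prod.dist_eq, max_lt_iff] at hq
    have hz : dist z z₀ < r := hq.2.trans (by linarith)
    have ht : |t| < r / 2 := by simpa using hq.1
    -- All small times are read on the single curve with parameter `r / 2`; then the fundamental
    -- theorem of calculus applies to a fixed integrand.
    have heq : ∀ t : ℝ, |t| < r / 2 → γ (t, z) ⟨1, by norm_num⟩ = z
        + (r / 2) • ∫ s in (0 : ℝ)..(t / (r / 2)),
          f (curveExtend (γ (r / 2, z)) s) := by
      intro t ht
      have hmem : t / (r / 2) ∈ Icc (-1 : ℝ) 1 := by
        rw [mem_Icc, ← abs_le, abs_div, abs_of_pos (half_pos hr), div_le_one (half_pos hr)]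
        exact ht.le
      have h1 := hscale ⟨t / (r / 2), hmem⟩ hr2 hz
      rw [div_mul_cancel₀ _ (half_pos hr).ne'] at h1
      rw [h1]
      conv_lhs => rw [hsol hr2 hz]
      rfl
    have hval : f (γ (t, z) ⟨1, by norm_num⟩) = f (curveExtend (γ (r / 2, z)) (t / (r / 2))) := by
      have hmem : t / (r / 2) ∈ Icc (-1 : ℝ) 1 := by
        rw [mem_Icc, ← abs_le, abs_div, abs_of_pos (half_pos hr), div_le_one (half_pos hr)]
        exact ht.le
      have h1 := hscale ⟨t / (r / 2), hmem⟩ hr2 hz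
      rw [div_mul_cancel₀ _ (half_pos hr).ne'] at h1
      rw [h1, curveExtend_of_mem _ hmem]
    have hcont : Continuous fun s => f (curveExtend (γ (r / 2, z)) s) :=
      hf.continuous.comp (curveExtend_continuous _)
    have hd : HasDerivAt (fun t : ℝ => z + (r / 2) • ∫ s in (0 : ℝ)..(t / (r / 2)),
          f (curveExtend (γ (r / 2, z)) s)) (f (curveExtend (γ (r / 2, z)) (t / (r / 2)))) t := by
      have h1 : HasDerivAt (fun u => ∫ s in (0 : ℝ)..u, f (curveExtend (γ (r / 2, z)) s))
          (f (curveExtend (γ (r / 2, z)) (t / (r / 2)))) (t / (r / 2)) :=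
        hcont.integral_hasStrictDerivAt _ _ |>.hasDerivAt
      have h2 : HasDerivAt (fun t : ℝ => t / (r / 2)) (1 / (r / 2)) t :=
        (hasDerivAt_id t).div_const _
      have h3 := ((h1.scomp t h2).const_smul (r / 2)).const_add z
      rw [smul_smul, mul_one_div_cancel (half_pos hr).ne', one_smul] at h3
      exact h3
    rw [show f (γ (t, z) ⟨1, by norm_num⟩) = _ from hval]
    refine hd.congr_of_eventuallyEq ?_
    filter_upwards [(continuous_abs.tendsto t).eventually (gt_mem_nhds ht)] with t' ht'
    exact heq t' ht'

/-- A vector field that is smooth near a point has a smooth local flow there. -/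
theorem exists_smooth_flow_of_eventually {E : Type u} [NormedAddCommGroup E] [NormedSpace ℝ E]
    [FiniteDimensional ℝ E] {f : E → E} {z₀ : E} (hf : ∀ᶠ z in 𝓝 z₀, ContDiffAt ℝ ∞ f z) :
    ∃ X : ℝ × E → E, (∀ᶠ q in 𝓝 ((0 : ℝ), z₀), ContDiffAt ℝ ∞ X q) ∧
      (∀ᶠ z in 𝓝 z₀, X (0, z) = z) ∧
      ∀ᶠ q in 𝓝 ((0 : ℝ), z₀), HasDerivAt (fun t => X (t, q.2)) (f (X q)) q.1 := by
  have : CompleteSpace E := FiniteDimensional.complete ℝ E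
  obtain ⟨R, hR, hRf⟩ := Metric.mem_nhds_iff.1 hf
  -- The cut-off makes the field globally smooth. Near `(0, z₀)` the flow stays where `χ = 1`, so it
  -- also solves the original equation.
  let χ : ContDiffBump z₀ := ⟨R / 4, R / 2, by positivity, by linarith⟩
  have hχf : ContDiff ℝ ∞ fun z => χ z • f z := by
    rw [contDiff_iff_contDiffAt]
    intro z
    by_cases hz : z ∈ Metric.ball z₀ R
    · exact χ.contDiffAt.smul (hRf hz)
    · have hz' : z ∉ tsupport χ := by
        rw [χ.tsupport_eq]
        intro h
        exact hz (Metric.closedBall_subset_ball (by change R / 2 < R; linarith) h)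
      have h0 : (fun z => χ z • f z) =ᶠ[𝓝 z] fun _ => 0 := by
        filter_upwards [notMem_tsupport_iff_eventuallyEq.1 hz'] with y hy
        rw [hy]; simp
      exact contDiffAt_const.congr_of_eventuallyEq h0
  obtain ⟨X, hX, hX0, hXd⟩ := exists_smooth_flow hχf z₀
  refine ⟨X, hX, hX0, ?_⟩
  have hcont : Tendsto X (𝓝 ((0 : ℝ), z₀)) (𝓝 z₀) := by
    have := hX.self_of_nhds.continuousAt
    rwa [ContinuousAt, hX0.self_of_nhds] at this
  filter_upwards [hXd, hcont.eventually χ.eventuallyEq_one] with q h1 h2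
  simpa [h2] using h1

/-- Through every nonzero velocity there is a smooth field of solutions of the second order equation
`c'' = S (c, c')`. -/
theorem exists_smooth_velocity_field {E : Type u} [NormedAddCommGroup E] [NormedSpace ℝ E]
    [FiniteDimensional ℝ E] {S : E × E → E} {u₀ w : E} (hw : w ≠ 0)
    (hS : ∀ᶠ z in 𝓝 (u₀, w), ContDiffAt ℝ ∞ S z) :
    ∃ V : E → E, V u₀ = w ∧ (∀ᶠ u in 𝓝 u₀, ContDiffAt ℝ ∞ V u) ∧
      ∀ᶠ u in 𝓝 u₀, fderiv ℝ V u (V u) = S (u, V u) := by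
  have : CompleteSpace E := FiniteDimensional.complete ℝ E
  obtain ⟨X, hX, hX0, hXd⟩ := exists_smooth_flow_of_eventually
    (f := fun z : E × E => (z.2, S z)) (z₀ := (u₀, w))
    (hS.mono fun z hz => contDiffAt_snd.prodMk hz)
  -- The kernel of `ℓ` is a hyperplane transversal to `w`. The map `j` splits `z` into a time `ℓ z`
  -- and a starting point on the hyperplane through `u₀`, always with initial velocity `w`.
  obtain ⟨ℓ, hℓ⟩ := SeparatingDual.exists_eq_one (R := ℝ) hw
  let j : E → ℝ × (E × E) := fun z => (ℓ z, (u₀ + (z - ℓ z • w), w))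
  have hj : ContDiff ℝ ∞ j :=
    ℓ.contDiff.prodMk ((contDiff_const.add
      (contDiff_id.sub (ℓ.contDiff.smul contDiff_const))).prodMk contDiff_const)
  have hj0 : j 0 = (0, (u₀, w)) := by simp [j]
  have hjt : Tendsto j (𝓝 0) (𝓝 (0, (u₀, w))) := by
    rw [← hj0]; exact hj.continuous.tendsto 0
  let P : E → E × E := fun z => X (j z)
  have hP : ∀ᶠ z in 𝓝 (0 : E), ContDiffAt ℝ ∞ P z :=
    (hjt.eventually hX).mono fun z hz => hz.comp z hj.contDiffAt
  have hP0 : P 0 = (u₀, w) := by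
    simp only [P, hj0]; exact hX0.self_of_nhds
  have hPw : ∀ᶠ z in 𝓝 (0 : E), fderiv ℝ P z w = ((P z).2, S (P z)) := by
    filter_upwards [hP, hjt.eventually hXd] with z h1 h2
    have h3 : HasDerivAt (fun s : ℝ => z + s • w) w 0 := by
      simpa using ((hasDerivAt_id (0 : ℝ)).smul_const w).const_add z
    have h4 : HasDerivAt (fun s : ℝ => P (z + s • w)) (fderiv ℝ P z w) 0 := by
      have h5 : HasFDerivAt P (fderiv ℝ P z) (z + (0 : ℝ) • w) := by
        simpa using (h1.differentiableAt (by simp)).hasFDerivAt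
      exact h5.comp_hasDerivAt 0 h3
    have h6 : (fun s : ℝ => P (z + s • w)) = fun s => X (ℓ z + s, (j z).2) := by
      funext s
      simp only [P, j, map_add, map_smul, hℓ, smul_eq_mul, mul_one, add_smul]
      congr 4
      abel
    rw [h6] at h4
    have h7 : HasDerivAt (fun s : ℝ => X (ℓ z + s, (j z).2)) ((P z).2, S (P z)) 0 := by
      have h8 : HasDerivAt (fun t => X (t, (j z).2)) ((P z).2, S (P z)) (ℓ z + 0) := by
        simpa [P, j] using h2
      exact HasDerivAt.comp_const_add (ℓ z) 0 h8
    exact h4.unique h7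
  let Φ : E → E := fun z => (P z).1
  have hΦ : ∀ᶠ z in 𝓝 (0 : E), ContDiffAt ℝ ∞ Φ z := hP.mono fun z hz => hz.fst
  have hΦ0 : Φ 0 = u₀ := by simp [Φ, hP0]
  -- The differential is the identity on both summands: along `w` one moves with the flow, whose
  -- velocity is `w`, and on the kernel of `ℓ` time is zero and `Φ` is translation by `u₀`.
  have hΦd : HasFDerivAt Φ (ContinuousLinearEquiv.refl ℝ E : E →L[ℝ] E) 0 := by
    have h1 : HasFDerivAt Φ (fderiv ℝ Φ 0) 0 :=
      (hΦ.self_of_nhds.differentiableAt (by simp)).hasFDerivAt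
    have hw' : fderiv ℝ Φ 0 w = w := by
      have h2 := ((hP.self_of_nhds.differentiableAt (by simp)).hasFDerivAt.fst).fderiv
      have h3 := hPw.self_of_nhds
      change fderiv ℝ (fun z => (P z).1) 0 w = w
      rw [h2]
      simp [h3, hP0]
    refine h1.congr_fderiv ?_
    ext z
    have hz : z = (z - ℓ z • w) + ℓ z • w := by abel
    have hk : fderiv ℝ Φ 0 (z - ℓ z • w) = z - ℓ z • w := by
      have hℓk : ℓ (z - ℓ z • w) = 0 := by simp [hℓ]
      generalize z - ℓ z • w = k at hℓk
      have h3 : HasDerivAt (fun s : ℝ => s • k) k 0 := by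
        simpa using (hasDerivAt_id (0 : ℝ)).smul_const k
      have h4 : HasDerivAt (fun s : ℝ => Φ (s • k)) (fderiv ℝ Φ 0 k) 0 := by
        have h5 : HasFDerivAt Φ (fderiv ℝ Φ 0) ((0 : ℝ) • k) := by simpa using h1
        exact h5.comp_hasDerivAt 0 h3
      have h6 : (fun s : ℝ => Φ (s • k)) =ᶠ[𝓝 0] fun s => u₀ + s • k := by
        have ht : Tendsto (fun s : ℝ => (u₀ + s • k, w)) (𝓝 0) (𝓝 (u₀, w)) := by
          have : Continuous fun s : ℝ => (u₀ + s • k, w) := by fun_prop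
          simpa using this.tendsto 0
        filter_upwards [ht.eventually hX0] with s hs
        simp only [Φ, P, j, map_smul, hℓk, smul_zero, zero_smul, sub_zero, hs]
      exact (h4.congr_of_eventuallyEq h6.symm).unique (h3.const_add u₀)
    conv_lhs => rw [hz, map_add, map_smul, hk, hw']
    simp
  obtain ⟨T, hT0, hT, hTs⟩ := exists_smooth_local_inverse hΦ _ hΦd
  rw [hΦ0] at hTs
  have hT00 : T.symm u₀ = 0 := by
    rw [← hΦ0, ← hT]; exact T.left_inv hT0
  have hTt : Tendsto T.symm (𝓝 u₀) (𝓝 0) := by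
    have := hTs.self_of_nhds.continuousAt
    rwa [ContinuousAt, hT00] at this
  have htgt : ∀ᶠ u in 𝓝 u₀, u ∈ T.target := by
    refine T.open_target.mem_nhds ?_
    rw [← hΦ0, ← hT]; exact T.map_source hT0
  have hsrc : ∀ᶠ z in 𝓝 (0 : E), z ∈ T.source := T.open_source.mem_nhds hT0
  refine ⟨fun u => (P (T.symm u)).2, by simp [hT00, hP0], ?_, ?_⟩
  · filter_upwards [hTs, hTt.eventually hP] with u h1 h2
    exact (h2.comp u h1).snd
  · filter_upwards [hTs, hTt.eventually hP, hTt.eventually hPw, htgt] with u h1 h2 h3 h4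
    have hu : (P (T.symm u)).1 = u := by
      have := T.right_inv h4
      rwa [hT] at this
    have hPd := (h2.differentiableAt (by simp)).hasFDerivAt
    have hTd := (h1.differentiableAt (by simp)).hasFDerivAt
    have hcomp : fderiv ℝ (fun u => (P (T.symm u)).2) u
        = (ContinuousLinearMap.snd ℝ E E).comp
          ((fderiv ℝ P (T.symm u)).comp (fderiv ℝ T.symm u)) :=
      (hPd.comp u hTd).snd.fderiv
    -- `Φ` carries the parameter direction `w` to the velocity, so its inverse carries the velocity
    -- back to `w`. Differentiating the field along itself thus becomes differentiating the flow in
    -- time, which yields `S`.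
    have hinv : fderiv ℝ T.symm u (P (T.symm u)).2 = w := by
      have hd : HasFDerivAt (fun z => T.symm (Φ z))
          ((fderiv ℝ T.symm u).comp
            ((ContinuousLinearMap.fst ℝ E E).comp (fderiv ℝ P (T.symm u)))) (T.symm u) := by
        have hTd' : HasFDerivAt T.symm (fderiv ℝ T.symm u) (Φ (T.symm u)) := by
          simp only [Φ]; rw [hu]; exact hTd
        exact hTd'.comp _ hPd.fst
      have hid : HasFDerivAt (fun z => T.symm (Φ z)) (ContinuousLinearMap.id ℝ E) (T.symm u) := by
        refine (hasFDerivAt_id _).congr_of_eventuallyEq ?_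
        filter_upwards [T.open_source.mem_nhds (T.map_target h4)] with z hz
        rw [← hT]; exact T.left_inv hz
      have := congrArg (fun A : E →L[ℝ] E => A w) (hd.unique hid)
      simpa [h3] using this
    rw [hcomp]
    simp only [ContinuousLinearMap.comp_apply, hinv, h3, ContinuousLinearMap.coe_snd']
    rw [show P (T.symm u) = ((P (T.symm u)).1, (P (T.symm u)).2) from rfl, hu]

end Flow

/-! ### Functions that are smooth near a point -/

section SmoothNear

variable {X : Type*} [NormedAddCommGroup X] [NormedSpace ℝ X]
  {Y : Type*} [NormedAddCommGroup Y] [NormedSpace ℝ Y]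
  {Z : Type*} [NormedAddCommGroup Z] [NormedSpace ℝ Z]
  {W : Type*} [NormedAddCommGroup W] [NormedSpace ℝ W]

/-- `f` is smooth on a neighbourhood of `x`. -/
def SmoothNear (f : X → Y) (x : X) : Prop := ∀ᶠ x' in 𝓝 x, ContDiffAt ℝ ∞ f x'

namespace SmoothNear

variable {f f' : X → Y} {x : X}

lemma contDiffAt (h : SmoothNear f x) : ContDiffAt ℝ ∞ f x := h.self_of_nhds

lemma differentiableAt (h : SmoothNear f x) : DifferentiableAt ℝ f x :=
  h.contDiffAt.differentiableAt (by simp)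

lemma hasFDerivAt (h : SmoothNear f x) : HasFDerivAt f (fderiv ℝ f x) x :=
  h.differentiableAt.hasFDerivAt

lemma continuousAt (h : SmoothNear f x) : ContinuousAt f x := h.contDiffAt.continuousAt

lemma eventually (h : SmoothNear f x) : ∀ᶠ x' in 𝓝 x, SmoothNear f x' :=
  eventually_eventually_nhds.2 h

lemma congr (h : SmoothNear f x) (h' : f' =ᶠ[𝓝 x] f) : SmoothNear f' x := by
  filter_upwards [h, eventually_eventually_nhds.2 h'] with y h1 h2
  exact h1.congr_of_eventuallyEq h2

lemma of_contDiff (h : ContDiff ℝ ∞ f) : SmoothNear f x :=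
  Eventually.of_forall fun _ => h.contDiffAt

lemma const (c : Y) : SmoothNear (fun _ : X => c) x := of_contDiff contDiff_const

lemma clm (A : X →L[ℝ] Y) : SmoothNear A x := of_contDiff A.contDiff

lemma fst {x : X × Y} : SmoothNear (Prod.fst : X × Y → X) x := of_contDiff contDiff_fst

lemma snd {x : X × Y} : SmoothNear (Prod.snd : X × Y → Y) x := of_contDiff contDiff_snd

lemma id : SmoothNear (fun y : X => y) x := of_contDiff contDiff_id

lemma fderiv (h : SmoothNear f x) : SmoothNear (fderiv ℝ f) x :=
  h.mono fun _ hy => hy.fderiv_right (by simp)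

lemma comp {g : Y → Z} (hg : SmoothNear g (f x)) (hf : SmoothNear f x) :
    SmoothNear (fun y => g (f y)) x := by
  filter_upwards [hf, hf.continuousAt.eventually hg] with y h1 h2
  exact h2.comp y h1

lemma prodMk {g : X → Z} (hf : SmoothNear f x) (hg : SmoothNear g x) :
    SmoothNear (fun y => (f y, g y)) x := by
  filter_upwards [hf, hg] with y h1 h2
  exact h1.prodMk h2

lemma add (hf : SmoothNear f x) (hg : SmoothNear f' x) : SmoothNear (fun y => f y + f' y) x := by
  filter_upwards [hf, hg] with y h1 h2
  exact h1.add h2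

lemma sub (hf : SmoothNear f x) (hg : SmoothNear f' x) : SmoothNear (fun y => f y - f' y) x := by
  filter_upwards [hf, hg] with y h1 h2
  exact h1.sub h2

lemma neg (hf : SmoothNear f x) : SmoothNear (fun y => -f y) x := by
  filter_upwards [hf] with y h1
  exact h1.neg

lemma smul {c : X → ℝ} (hc : SmoothNear c x) (hf : SmoothNear f x) :
    SmoothNear (fun y => c y • f y) x := by
  filter_upwards [hc, hf] with y h1 h2
  exact h1.smul h2

lemma mul {c c' : X → ℝ} (hc : SmoothNear c x) (hf : SmoothNear c' x) :
    SmoothNear (fun y => c y * c' y) x := hc.smul hf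

lemma clm_apply {A : X → Y →L[ℝ] Z} {g : X → Y} (hA : SmoothNear A x) (hg : SmoothNear g x) :
    SmoothNear (fun y => A y (g y)) x := by
  filter_upwards [hA, hg] with y h1 h2
  exact h1.clm_apply h2

lemma clm_comp {A : X → Y →L[ℝ] Z} {B : X → W →L[ℝ] Y} (hA : SmoothNear A x)
    (hB : SmoothNear B x) : SmoothNear (fun y => (A y).comp (B y)) x := by
  filter_upwards [hA, hB] with y h1 h2
  exact h1.clm_comp h2

lemma log {c : X → ℝ} (hc : SmoothNear c x) (h : c x ≠ 0) :
    SmoothNear (fun y => Real.log (c y)) x := by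
  filter_upwards [hc, hc.continuousAt.eventually_ne h] with y h1 h2
  exact h1.log h2

lemma inv {c : X → ℝ} (hc : SmoothNear c x) (h : c x ≠ 0) :
    SmoothNear (fun y => (c y)⁻¹) x := by
  filter_upwards [hc, hc.continuousAt.eventually_ne h] with y h1 h2
  exact h1.inv h2

lemma eventually_isInvertible [CompleteSpace Y] {A : X → Y →L[ℝ] Z} (hA : ContinuousAt A x)
    (h : (A x).IsInvertible) : ∀ᶠ y in 𝓝 x, (A y).IsInvertible := by
  obtain ⟨e, he⟩ := h
  have : range ((↑) : (Y ≃L[ℝ] Z) → Y →L[ℝ] Z) ∈ 𝓝 (A x) := by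
    rw [← he]; exact ContinuousLinearEquiv.nhds e
  exact hA this

lemma clm_inverse [CompleteSpace Y] {A : X → Y →L[ℝ] Z} (hA : SmoothNear A x)
    (h : (A x).IsInvertible) : SmoothNear (fun y => (A y).inverse) x := by
  filter_upwards [hA, eventually_isInvertible hA.continuousAt h] with y h1 ⟨e, he⟩
  have h3 : ContDiffAt ℝ ∞ (ContinuousLinearMap.inverse (R := ℝ) (M := Y) (M₂ := Z)) (A y) := by
    rw [← he]; exact contDiffAt_map_inverse e
  exact h3.comp y h1

lemma fderiv_fderiv_symm (h : SmoothNear f x) (a b : X) :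
    _root_.fderiv ℝ (_root_.fderiv ℝ f) x a b = _root_.fderiv ℝ (_root_.fderiv ℝ f) x b a :=
  (h.contDiffAt.isSymmSndFDerivAt (by
    rw [minSmoothness_of_isRCLikeNormedField]; exact ENat.LEInfty.out)) a b

end SmoothNear

lemma fderiv_clm_apply_const {A : X → Y →L[ℝ] Z} {x : X} (hA : DifferentiableAt ℝ A x) (c : Y)
    (a : X) : fderiv ℝ (fun y => A y c) x a = fderiv ℝ A x a c := by
  rw [(hA.hasFDerivAt.clm_apply (hasFDerivAt_const c x)).fderiv]
  simp

lemma fderiv_clm_comp_const {A : X → Y →L[ℝ] Z} {x : X} (hA : DifferentiableAt ℝ A x)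
    (B : W →L[ℝ] Y) (a : X) : fderiv ℝ (fun y => (A y).comp B) x a = (fderiv ℝ A x a).comp B := by
  rw [(hA.hasFDerivAt.clm_comp (hasFDerivAt_const B x)).fderiv]
  ext; simp

lemma fderiv_clm_apply' {A : X → Y →L[ℝ] Z} {g : X → Y} {x : X} (hA : DifferentiableAt ℝ A x)
    (hg : DifferentiableAt ℝ g x) (a : X) :
    fderiv ℝ (fun y => A y (g y)) x a = fderiv ℝ A x a (g x) + A x (fderiv ℝ g x a) := by
  rw [(hA.hasFDerivAt.clm_apply hg.hasFDerivAt).fderiv]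
  simp [add_comm]

/-- A function of a point and a velocity, along a field. -/
lemma fderiv_comp_graph {Q : X × Y → Z} {V : X → Y} {x : X}
    (hQ : DifferentiableAt ℝ Q (x, V x)) (hV : DifferentiableAt ℝ V x) (a : X) :
    fderiv ℝ (fun y => Q (y, V y)) x a = fderiv ℝ Q (x, V x) (a, fderiv ℝ V x a) := by
  have h := hQ.hasFDerivAt.comp x ((hasFDerivAt_id x).prodMk hV.hasFDerivAt)
  change HasFDerivAt (fun y => Q (y, V y)) _ x at h
  rw [h.fderiv]
  rfl

end SmoothNear

/-! ### Sprays -/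

section Spray

variable {E : Type*} [NormedAddCommGroup E] [NormedSpace ℝ E]
  {F : Type*} [NormedAddCommGroup F] [NormedSpace ℝ F]

/-- The partial derivative in the direction of the fibre. -/
def fiberDeriv (Q : E × E → F) (z : E × E) : E →L[ℝ] F :=
  (fderiv ℝ Q z).comp (ContinuousLinearMap.inr ℝ E E)

/-- The partial derivative in the direction of the base. -/
def baseDeriv (Q : E × E → F) (z : E × E) : E →L[ℝ] F :=
  (fderiv ℝ Q z).comp (ContinuousLinearMap.inl ℝ E E)

/-- The fundamental tensor of an energy function. -/
def fiberHessian (Λ : E × E → ℝ) (z : E × E) : E →L[ℝ] E →L[ℝ] ℝ := fiberDeriv (fiberDeriv Λ) z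

/-- The acceleration `c'' = spray Λ (c, c')` of the solutions of the Euler-Lagrange equation. -/
def spray (Λ : E × E → ℝ) (z : E × E) : E :=
  (fiberHessian Λ z).inverse (baseDeriv Λ z - baseDeriv (fiberDeriv Λ) z z.2)

/-- The derivative along the solutions of `c'' = S (c, c')`. -/
def sprayDeriv (S : E × E → E) (h : E × E → F) (z : E × E) : F := fderiv ℝ h z (z.2, S z)

/-- The Riemann curvature `X ↦ R(X, y) y` of the spray `S`. -/
def sprayCurvature (S : E × E → E) (z : E × E) : E →L[ℝ] E :=
  -(baseDeriv S z) + (1 / 2 : ℝ) • sprayDeriv S (fiberDeriv S) z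
    - (1 / 4 : ℝ) • (fiberDeriv S z).comp (fiberDeriv S z)

lemma fiberDeriv_apply (Q : E × E → F) (z : E × E) (X : E) :
    fiberDeriv Q z X = fderiv ℝ Q z (0, X) := rfl

lemma baseDeriv_apply (Q : E × E → F) (z : E × E) (X : E) :
    baseDeriv Q z X = fderiv ℝ Q z (X, 0) := rfl

lemma fderiv_prod_eq (Q : E × E → F) (z : E × E) (X Y : E) :
    fderiv ℝ Q z (X, Y) = fderiv ℝ Q z (X, 0) + fderiv ℝ Q z (0, Y) := by
  rw [← map_add]; simp

lemma SmoothNear.fiberDeriv {Q : E × E → F} {z : E × E} (h : SmoothNear Q z) :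
    SmoothNear (fiberDeriv Q) z := h.fderiv.clm_comp (SmoothNear.const _)

lemma SmoothNear.baseDeriv {Q : E × E → F} {z : E × E} (h : SmoothNear Q z) :
    SmoothNear (baseDeriv Q) z := h.fderiv.clm_comp (SmoothNear.const _)

lemma SmoothNear.fiberHessian {Q : E × E → ℝ} {z : E × E} (h : SmoothNear Q z) :
    SmoothNear (fiberHessian Q) z := h.fiberDeriv.fiberDeriv

lemma SmoothNear.sprayDeriv {S : E × E → E} {Q : E × E → F} {z : E × E} (hS : SmoothNear S z)
    (h : SmoothNear Q z) : SmoothNear (sprayDeriv S Q) z :=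
  h.fderiv.clm_apply (SmoothNear.snd.prodMk hS)

lemma SmoothNear.spray [CompleteSpace E] {Λ : E × E → ℝ} {z : E × E} (h : SmoothNear Λ z)
    (hi : (WarpedFinsler.fiberHessian Λ z).IsInvertible) :
    SmoothNear (WarpedFinsler.spray Λ) z :=
  (h.fiberHessian.clm_inverse hi).clm_apply
    (h.baseDeriv.sub (h.fiberDeriv.baseDeriv.clm_apply SmoothNear.snd))

lemma fderiv_fiberDeriv {Q : E × E → F} {z : E × E} (h : SmoothNear Q z) (a : E × E) (X : E) :
    fderiv ℝ (fiberDeriv Q) z a X = fderiv ℝ (fderiv ℝ Q) z a (0, X) := by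
  have := fderiv_clm_comp_const h.fderiv.differentiableAt (ContinuousLinearMap.inr ℝ E E) a
  exact congrArg (fun A : E →L[ℝ] F => A X) this

lemma fderiv_baseDeriv {Q : E × E → F} {z : E × E} (h : SmoothNear Q z) (a : E × E) (X : E) :
    fderiv ℝ (baseDeriv Q) z a X = fderiv ℝ (fderiv ℝ Q) z a (X, 0) := by
  have := fderiv_clm_comp_const h.fderiv.differentiableAt (ContinuousLinearMap.inl ℝ E E) a
  exact congrArg (fun A : E →L[ℝ] F => A X) this

lemma fiberHessian_apply {Λ : E × E → ℝ} {z : E × E} (h : SmoothNear Λ z) (X Z : E) :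
    fiberHessian Λ z X Z = fderiv ℝ (fderiv ℝ Λ) z (0, X) (0, Z) :=
  fderiv_fiberDeriv h _ _

lemma fiberHessian_symm {Λ : E × E → ℝ} {z : E × E} (h : SmoothNear Λ z) (X Z : E) :
    fiberHessian Λ z X Z = fiberHessian Λ z Z X := by
  rw [fiberHessian_apply h, fiberHessian_apply h, h.fderiv_fderiv_symm]

lemma fderiv_fiberHessian {Λ : E × E → ℝ} {z : E × E} (h : SmoothNear Λ z) (a : E × E) (X Z : E) :
    fderiv ℝ (fiberHessian Λ) z a X Z
      = fderiv ℝ (fderiv ℝ (fderiv ℝ Λ)) z a (0, X) (0, Z) := by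
  have h1 : fderiv ℝ (fiberHessian Λ) z a X = fderiv ℝ (fderiv ℝ (fiberDeriv Λ)) z a (0, X) :=
    fderiv_fiberDeriv h.fiberDeriv a X
  rw [h1]
  have h2 : (fun z' => fderiv ℝ (fiberDeriv Λ) z' (0, X)) =ᶠ[𝓝 z]
      fun z' => (fderiv ℝ (fderiv ℝ Λ) z' (0, X)).comp (ContinuousLinearMap.inr ℝ E E) := by
    filter_upwards [h.eventually] with z' hz'
    exact fderiv_clm_comp_const hz'.fderiv.differentiableAt (ContinuousLinearMap.inr ℝ E E) _
  rw [← fderiv_clm_apply_const h.fiberDeriv.fderiv.differentiableAt, h2.fderiv_eq,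
    fderiv_clm_comp_const (h.fderiv.fderiv.clm_apply (SmoothNear.const _)).differentiableAt,
    fderiv_clm_apply_const h.fderiv.fderiv.differentiableAt]
  rfl

lemma SmoothNear.fderiv_three_symm {Λ : E → ℝ} {z : E} (h : SmoothNear Λ z) (a b c : E) :
    _root_.fderiv ℝ (_root_.fderiv ℝ (_root_.fderiv ℝ Λ)) z a b c
      = _root_.fderiv ℝ (_root_.fderiv ℝ (_root_.fderiv ℝ Λ)) z a c b := by
  have h1 : (fun z' => _root_.fderiv ℝ (_root_.fderiv ℝ Λ) z' b c) =ᶠ[𝓝 z]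
      fun z' => _root_.fderiv ℝ (_root_.fderiv ℝ Λ) z' c b :=
    h.eventually.mono fun z' hz' => hz'.fderiv_fderiv_symm b c
  have h2 := congrArg (fun A : E →L[ℝ] ℝ => A a) h1.fderiv_eq
  have h3 : ∀ b c, _root_.fderiv ℝ (fun z' => _root_.fderiv ℝ (_root_.fderiv ℝ Λ) z' b c) z a
      = _root_.fderiv ℝ (_root_.fderiv ℝ (_root_.fderiv ℝ Λ)) z a b c := by
    intro b c
    rw [fderiv_clm_apply_const (h.fderiv.fderiv.clm_apply (SmoothNear.const _)).differentiableAt,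
      fderiv_clm_apply_const h.fderiv.fderiv.differentiableAt]
  simpa only [h3] using h2

/-! #### Homogeneity -/

/-- Positive homogeneity of degree `k` on the fibres. -/
def IsFiberHomogeneous (k : ℕ) (Q : E × E → F) : Prop :=
  ∀ (u y : E) (t : ℝ), 0 < t → Q (u, t • y) = t ^ k • Q (u, y)

namespace IsFiberHomogeneous

variable {k : ℕ} {Q : E × E → F}

/-- Dilation of the fibre is a linear equivalence, and composing with an equivalence commutes with
`fderiv` without any differentiability. So homogeneity passes to derivatives at all points,
including those where `Q` is not smooth. -/
lemma fderiv_apply (h : IsFiberHomogeneous k Q) (u y : E) {t : ℝ} (ht : 0 < t) (X Y : E) :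
    fderiv ℝ Q (u, t • y) (X, t • Y) = t ^ k • fderiv ℝ Q (u, y) (X, Y) := by
  let σ : (E × E) ≃L[ℝ] (E × E) := (ContinuousLinearEquiv.refl ℝ E).prodCongr
    (ContinuousLinearEquiv.smulLeft (Units.mk0 t ht.ne'))
  have hσ : ∀ X Y : E, σ (X, Y) = (X, t • Y) := fun X Y => rfl
  have h1 : Q ∘ σ = fun z => t ^ k • Q z := by
    funext ⟨u, y⟩
    exact h u y t ht
  have h2 := σ.comp_right_fderiv (f := Q) (x := (u, y))
  let _ : Invertible (t ^ k) := invertibleOfNonzero (pow_ne_zero k ht.ne')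
  rw [h1, show (fun z => t ^ k • Q z) = t ^ k • Q from rfl,
    fderiv_const_smul_of_invertible] at h2
  have h3 := congrArg (fun A : E × E →L[ℝ] F => A (X, Y)) h2
  simpa [hσ] using h3.symm

lemma euler (h : IsFiberHomogeneous k Q) {z : E × E} (hd : DifferentiableAt ℝ Q z) :
    fderiv ℝ Q z (0, z.2) = (k : ℝ) • Q z := by
  obtain ⟨u, y⟩ := z
  have h1 : HasDerivAt (fun t : ℝ => (u, t • y)) (0, y) 1 := by
    have := (hasDerivAt_id (1 : ℝ)).smul_const y
    simpa using (hasDerivAt_const (1 : ℝ) u).prodMk this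
  have h2 : HasDerivAt (fun t : ℝ => Q (u, t • y)) (fderiv ℝ Q (u, y) (0, y)) 1 := by
    have h3 : HasFDerivAt Q (fderiv ℝ Q (u, y)) (u, (1 : ℝ) • y) := by
      simpa using hd.hasFDerivAt
    exact h3.comp_hasDerivAt 1 h1
  have h4 : (fun t : ℝ => Q (u, t • y)) =ᶠ[𝓝 1] fun t => t ^ k • Q (u, y) := by
    filter_upwards [lt_mem_nhds (zero_lt_one : (0 : ℝ) < 1)] with t ht
    exact h u y t ht
  have h5 : HasDerivAt (fun t : ℝ => t ^ k • Q (u, y)) ((k : ℝ) • Q (u, y)) 1 := by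
    have := (hasDerivAt_pow k (1 : ℝ)).smul_const (Q (u, y))
    simpa using this
  exact (h2.congr_of_eventuallyEq h4.symm).unique h5

lemma baseDeriv (h : IsFiberHomogeneous k Q) : IsFiberHomogeneous k (baseDeriv Q) := by
  intro u y t ht
  ext X
  simpa [baseDeriv_apply] using h.fderiv_apply u y ht X 0

lemma fiberDeriv (h : IsFiberHomogeneous (k + 1) Q) : IsFiberHomogeneous k (fiberDeriv Q) := by
  intro u y t ht
  ext X
  have h1 := h.fderiv_apply u y ht 0 (t⁻¹ • X)
  rw [smul_inv_smul₀ ht.ne'] at h1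
  have h2 : ((0 : E), t⁻¹ • X) = t⁻¹ • ((0 : E), X) := by simp
  rw [h2, map_smul, smul_smul, pow_succ, mul_assoc, mul_inv_cancel₀ ht.ne', mul_one] at h1
  exact h1

lemma sprayDeriv {S : E × E → E} (hS : IsFiberHomogeneous 2 S) (h : IsFiberHomogeneous k Q) :
    IsFiberHomogeneous (k + 1) (sprayDeriv S Q) := by
  intro u y t ht
  have h1 : ((t • y : E), S (u, t • y)) = t • ((y : E), t • S (u, y)) := by
    rw [hS u y t ht]; simp [pow_two, mul_smul]
  change fderiv ℝ Q (u, t • y) (t • y, S (u, t • y)) = t ^ (k + 1) • fderiv ℝ Q (u, y) (y, S (u, y))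
  rw [h1, map_smul, h.fderiv_apply u y ht, smul_smul, pow_succ']

lemma spray {Λ : E × E → ℝ} (h : IsFiberHomogeneous 2 Λ) : IsFiberHomogeneous 2 (spray Λ) := by
  intro u y t ht
  have h1 : fiberHessian Λ (u, t • y) = fiberHessian Λ (u, y) := by
    have := h.fiberDeriv.fiberDeriv u y t ht
    rw [pow_zero, one_smul] at this
    exact this
  have h2 := h.baseDeriv u y t ht
  have h3 := h.fiberDeriv.baseDeriv u y t ht
  simp only [WarpedFinsler.spray]
  rw [h1, h2, h3, ← map_smul]
  congr 1
  simp [smul_sub, smul_smul, pow_two]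

end IsFiberHomogeneous

end Spray

/-! ### The curvature of the metric along a geodesic field -/

section GeodesicField

variable {E : Type*} [NormedAddCommGroup E] [NormedSpace ℝ E]

lemma christoffelFirst_apply (G : E → E →L[ℝ] E →L[ℝ] ℝ) (u X Y Z : E) :
    christoffelFirst G u X Y Z
      = 1 / 2 * (fderiv ℝ G u X Y Z + fderiv ℝ G u Y X Z - fderiv ℝ G u Z X Y) := rfl

lemma christoffel_apply (G : E → E →L[ℝ] E →L[ℝ] ℝ) (u X Y : E) :
    christoffel G u X Y = (G u).inverse (christoffelFirst G u X Y) := rfl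

lemma curvatureEndo_apply (G : E → E →L[ℝ] E →L[ℝ] ℝ) (u X Y Z : E) :
    curvatureEndo G u Y Z X = fderiv ℝ (christoffel G) u X Y Z - fderiv ℝ (christoffel G) u Y X Z
      + christoffel G u X (christoffel G u Y Z) - christoffel G u Y (christoffel G u X Z) := rfl

lemma localHessian_apply (G : E → E →L[ℝ] E →L[ℝ] ℝ) (h : E → ℝ) (u X Y : E) :
    localHessian G h u X Y
      = fderiv ℝ (fderiv ℝ h) u X Y - fderiv ℝ h u (christoffel G u X Y) := rfl

lemma smoothNear_christoffelFirst {G : E → E →L[ℝ] E →L[ℝ] ℝ} {u : E} (h : SmoothNear G u) :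
    SmoothNear (christoffelFirst G) u := by
  let fl : (E →L[ℝ] E →L[ℝ] E →L[ℝ] ℝ) →L[ℝ] (E →L[ℝ] E →L[ℝ] E →L[ℝ] ℝ) :=
    (ContinuousLinearMap.flipₗᵢ ℝ E E (E →L[ℝ] ℝ)).toContinuousLinearEquiv.toContinuousLinearMap
  let fr : (E →L[ℝ] E →L[ℝ] E →L[ℝ] ℝ) →L[ℝ] (E →L[ℝ] E →L[ℝ] E →L[ℝ] ℝ) :=
    ContinuousLinearMap.compL ℝ E (E →L[ℝ] E →L[ℝ] ℝ) (E →L[ℝ] E →L[ℝ] ℝ)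
      (ContinuousLinearMap.flipₗᵢ ℝ E E ℝ).toContinuousLinearEquiv.toContinuousLinearMap
  have h1 : SmoothNear (fun y => fl (fderiv ℝ G y)) u := (SmoothNear.const fl).clm_apply h.fderiv
  have h2 : SmoothNear (fun y => fr (fl (fderiv ℝ G y))) u := (SmoothNear.const fr).clm_apply h1
  exact (SmoothNear.const (1 / 2 : ℝ)).smul ((h.fderiv.add h1).sub h2)

lemma smoothNear_christoffel [CompleteSpace E] {G : E → E →L[ℝ] E →L[ℝ] ℝ} {u : E}
    (h : SmoothNear G u) (hi : (G u).IsInvertible) : SmoothNear (christoffel G) u := by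
  have h1 : SmoothNear (fun y =>
      ContinuousLinearMap.compL ℝ E (E →L[ℝ] ℝ) E (G y).inverse) u :=
    (SmoothNear.const _).clm_apply (h.clm_inverse hi)
  exact h1.clm_comp (smoothNear_christoffelFirst h)

lemma christoffelFirst_symm {G : E → E →L[ℝ] E →L[ℝ] ℝ} {u : E} (hG : DifferentiableAt ℝ G u)
    (hs : ∀ᶠ y in 𝓝 u, ∀ X Y, G y X Y = G y Y X) (X Y : E) :
    christoffelFirst G u X Y = christoffelFirst G u Y X := by
  have hsd : ∀ A X Y : E, fderiv ℝ G u A X Y = fderiv ℝ G u A Y X := by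
    intro A X Y
    have h1 : (fun y => G y X Y) =ᶠ[𝓝 u] fun y => G y Y X := hs.mono fun y hy => hy X Y
    have h3 : ∀ X Y : E, fderiv ℝ (fun y => G y X Y) u A = fderiv ℝ G u A X Y := by
      intro X Y
      rw [fderiv_clm_apply_const (A := fun y => G y X)
        (hG.clm_apply (differentiableAt_const X)), fderiv_clm_apply_const hG]
    rw [← h3, ← h3, h1.fderiv_eq]
  ext Z
  rw [christoffelFirst_apply, christoffelFirst_apply, hsd Z X Y]
  ring

lemma christoffel_symm {G : E → E →L[ℝ] E →L[ℝ] ℝ} {u : E} (hG : DifferentiableAt ℝ G u)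
    (hs : ∀ᶠ y in 𝓝 u, ∀ X Y, G y X Y = G y Y X) (X Y : E) :
    christoffel G u X Y = christoffel G u Y X := by
  rw [christoffel_apply, christoffel_apply, christoffelFirst_symm hG hs]

lemma fderiv_christoffel_symm [CompleteSpace E] {G : E → E →L[ℝ] E →L[ℝ] ℝ} {u : E}
    (h : SmoothNear G u) (hi : (G u).IsInvertible)
    (hs : ∀ᶠ y in 𝓝 u, ∀ X Y, G y X Y = G y Y X) (A X Y : E) :
    fderiv ℝ (christoffel G) u A X Y = fderiv ℝ (christoffel G) u A Y X := by
  have hΓ := smoothNear_christoffel h hi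
  have h1 : (fun y => christoffel G y X Y) =ᶠ[𝓝 u] fun y => christoffel G y Y X := by
    filter_upwards [h.eventually, eventually_eventually_nhds.2 hs] with y h1 h2
    exact christoffel_symm h1.differentiableAt h2 X Y
  have h3 : ∀ X Y : E, fderiv ℝ (fun y => christoffel G y X Y) u A
      = fderiv ℝ (christoffel G) u A X Y := by
    intro X Y
    rw [fderiv_clm_apply_const (A := fun y => christoffel G y X)
      (hΓ.clm_apply (SmoothNear.const X)).differentiableAt,
      fderiv_clm_apply_const hΓ.differentiableAt]
  rw [← h3, ← h3, h1.fderiv_eq]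

variable {Λ : E × E → ℝ} {z : E × E}

lemma fiberHessian_spray (hi : (fiberHessian Λ z).IsInvertible) :
    fiberHessian Λ z (spray Λ z) = baseDeriv Λ z - baseDeriv (fiberDeriv Λ) z z.2 :=
  hi.self_apply_inverse _

/-- The spray is determined by the Euler-Lagrange equation. -/
lemma spray_eq_of_fiberHessian (hi : (fiberHessian Λ z).IsInvertible) {a : E}
    (ha : fiberHessian Λ z a = baseDeriv Λ z - baseDeriv (fiberDeriv Λ) z z.2) :
    spray Λ z = a := by
  rw [spray, ← ha, hi.inverse_apply_self]

/-- This is the Euler–Lagrange identity `fiberHessian_spray` differentiated along the fibre. Pairing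
with the fundamental tensor avoids differentiating its inverse. -/
lemma fiberHessian_fiberDeriv_spray [CompleteSpace E] (hΛ : SmoothNear Λ z)
    (hi : (fiberHessian Λ z).IsInvertible) (X Z : E) :
    fiberHessian Λ z (fiberDeriv (spray Λ) z X) Z
      = fderiv ℝ (fderiv ℝ Λ) z (0, X) (Z, 0)
        - fderiv ℝ (fderiv ℝ (fderiv ℝ Λ)) z (0, X) (z.2, 0) (0, Z)
        - fderiv ℝ (fderiv ℝ Λ) z (X, 0) (0, Z)
        - fderiv ℝ (fderiv ℝ (fderiv ℝ Λ)) z (0, X) (0, spray Λ z) (0, Z) := by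
  have hS := hΛ.spray hi
  have h1 : (fun z' => fiberHessian Λ z' (spray Λ z') Z) =ᶠ[𝓝 z]
      fun z' => fderiv ℝ Λ z' (Z, 0)
        - fderiv ℝ (fderiv ℝ Λ) z' (ContinuousLinearMap.inl ℝ E E z'.2) (0, Z) := by
    filter_upwards [hΛ.eventually,
      SmoothNear.eventually_isInvertible hΛ.fiberHessian.continuousAt hi] with z' h1 h2
    rw [fiberHessian_spray h2, _root_.sub_apply, baseDeriv_apply, baseDeriv_apply,
      fderiv_fiberDeriv h1]
    rfl
  have h2 := congrArg (fun A : E × E →L[ℝ] ℝ => A (0, X)) h1.fderiv_eq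
  have hD2 := hΛ.fderiv.fderiv
  have hin : SmoothNear (fun z' : E × E => ContinuousLinearMap.inl ℝ E E z'.2) z :=
    (SmoothNear.const _).clm_apply SmoothNear.snd
  have hind : fderiv ℝ (fun z' : E × E => ContinuousLinearMap.inl ℝ E E z'.2) z (0, X)
      = (X, 0) := by
    have : HasFDerivAt (fun z' : E × E => ContinuousLinearMap.inl ℝ E E z'.2)
      ((ContinuousLinearMap.inl ℝ E E).comp (ContinuousLinearMap.snd ℝ E E)) z :=
        ((ContinuousLinearMap.inl ℝ E E).comp (ContinuousLinearMap.snd ℝ E E)).hasFDerivAt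
    rw [this.fderiv]; rfl
  rw [fderiv_clm_apply_const (A := fun z' => fiberHessian Λ z' (spray Λ z'))
      (hΛ.fiberHessian.clm_apply hS).differentiableAt,
    fderiv_clm_apply' hΛ.fiberHessian.differentiableAt hS.differentiableAt,
    fderiv_fun_sub (hΛ.fderiv.clm_apply (SmoothNear.const _)).differentiableAt
      ((hD2.clm_apply hin).clm_apply (SmoothNear.const _)).differentiableAt,
    _root_.sub_apply, fderiv_clm_apply_const hΛ.fderiv.differentiableAt,
    fderiv_clm_apply_const (A := fun z' => fderiv ℝ (fderiv ℝ Λ) z'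
      (ContinuousLinearMap.inl ℝ E E z'.2)) (hD2.clm_apply hin).differentiableAt,
    fderiv_clm_apply' hD2.differentiableAt hin.differentiableAt, hind,
    _root_.add_apply, _root_.add_apply, fderiv_fiberHessian hΛ] at h2
  rw [fiberDeriv_apply]
  have h3 : ContinuousLinearMap.inl ℝ E E z.2 = (z.2, 0) := rfl
  rw [h3] at h2
  linarith

/-- For a geodesic field `V`, the connection of the metric `g^V` in the direction `V` is the
nonlinear connection of the spray. -/
lemma christoffel_geodesicField [CompleteSpace E] (hh : IsFiberHomogeneous 2 Λ) {V : E → E} {u : E}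
    (hΛ : SmoothNear Λ (u, V u)) (hV : SmoothNear V u)
    (hi : (fiberHessian Λ (u, V u)).IsInvertible) (hgeo : fderiv ℝ V u (V u) = spray Λ (u, V u))
    (X : E) :
    christoffel (fun y => fiberHessian Λ (y, V y)) u (V u) X
      = -((1 / 2 : ℝ) • fiberDeriv (spray Λ) (u, V u) X) := by
  have hD : ∀ A X Y : E, fderiv ℝ (fun y => fiberHessian Λ (y, V y)) u A X Y
      = fderiv ℝ (fderiv ℝ (fderiv ℝ Λ)) (u, V u) (A, 0) (0, X) (0, Y)
        + fderiv ℝ (fderiv ℝ (fderiv ℝ Λ)) (u, V u) (0, fderiv ℝ V u A) (0, X) (0, Y) := by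
    intro A X Y
    rw [fderiv_comp_graph hΛ.fiberHessian.differentiableAt hV.differentiableAt,
      fderiv_prod_eq, _root_.add_apply, _root_.add_apply,
      fderiv_fiberHessian hΛ, fderiv_fiberHessian hΛ]
  have s12 : ∀ a b c : E × E, fderiv ℝ (fderiv ℝ (fderiv ℝ Λ)) (u, V u) a b c
      = fderiv ℝ (fderiv ℝ (fderiv ℝ Λ)) (u, V u) b a c := by
    intro a b c
    rw [hΛ.fderiv.fderiv_fderiv_symm]
  have s23 := hΛ.fderiv_three_symm
  -- The fundamental tensor has degree zero, so its fibre derivative vanishes when contracted with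
  -- `V`. Of the terms containing derivatives of `V`, only the one with `fderiv ℝ V u (V u)`
  -- survives, and the geodesic equation replaces it by the spray.
  have e0 : ∀ Y Z : E, fderiv ℝ (fderiv ℝ (fderiv ℝ Λ)) (u, V u) (0, V u) (0, Y) (0, Z) = 0 := by
    intro Y Z
    have := hh.fiberDeriv.fiberDeriv.euler (z := (u, V u)) hΛ.fiberHessian.differentiableAt
    rw [← fderiv_fiberHessian hΛ]
    have h2 := congrArg (fun A : E →L[ℝ] E →L[ℝ] ℝ => A Y Z) this
    rw [Nat.cast_zero, zero_smul] at h2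
    exact h2
  have e1 : ∀ Y Z : E, fderiv ℝ (fderiv ℝ (fderiv ℝ Λ)) (u, V u) (0, V u) (Y, 0) (0, Z)
      = fderiv ℝ (fderiv ℝ Λ) (u, V u) (Y, 0) (0, Z) := by
    intro Y Z
    have := hh.fiberDeriv.baseDeriv.euler (z := (u, V u))
      hΛ.fiberDeriv.baseDeriv.differentiableAt
    have h2 := congrArg (fun A : E →L[ℝ] E →L[ℝ] ℝ => A Y Z) this
    simp only [Nat.cast_one, one_smul] at h2
    rw [fderiv_baseDeriv hΛ.fiberDeriv, baseDeriv_apply, fderiv_fiberDeriv hΛ] at h2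
    rw [← h2]
    have h3 : (fun z' => fderiv ℝ (fiberDeriv Λ) z' (Y, 0)) =ᶠ[𝓝 (u, V u)]
        fun z' => (fderiv ℝ (fderiv ℝ Λ) z' (Y, 0)).comp (ContinuousLinearMap.inr ℝ E E) := by
      filter_upwards [hΛ.eventually] with z' hz'
      exact fderiv_clm_comp_const hz'.fderiv.differentiableAt (ContinuousLinearMap.inr ℝ E E) _
    rw [← fderiv_clm_apply_const hΛ.fiberDeriv.fderiv.differentiableAt, h3.fderiv_eq,
      fderiv_clm_comp_const (hΛ.fderiv.fderiv.clm_apply (SmoothNear.const _)).differentiableAt,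
      fderiv_clm_apply_const hΛ.fderiv.fderiv.differentiableAt]
    rfl
  rw [christoffel_apply]
  suffices h : christoffelFirst (fun y => fiberHessian Λ (y, V y)) u (V u) X
      = fiberHessian Λ (u, V u) (-((1 / 2 : ℝ) • fiberDeriv (spray Λ) (u, V u) X)) by
    rw [h, hi.inverse_apply_self]
  ext Z
  rw [christoffelFirst_apply, map_neg, map_smul, _root_.neg_apply,
    _root_.smul_apply, fiberHessian_fiberDeriv_spray hΛ hi, hD, hD, hD, hgeo,
    smul_eq_mul]
  have t1 : fderiv ℝ (fderiv ℝ (fderiv ℝ Λ)) (u, V u) (X, 0) (0, V u) (0, Z)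
      = fderiv ℝ (fderiv ℝ Λ) (u, V u) (X, 0) (0, Z) := by rw [s12, e1]
  have t2 : fderiv ℝ (fderiv ℝ (fderiv ℝ Λ)) (u, V u) (Z, 0) (0, V u) (0, X)
      = fderiv ℝ (fderiv ℝ Λ) (u, V u) (Z, 0) (0, X) := by rw [s12, e1]
  have t3 : ∀ A B : E,
      fderiv ℝ (fderiv ℝ (fderiv ℝ Λ)) (u, V u) (0, A) (0, V u) (0, B) = 0 := by
    intro A B
    rw [s12, e0]
  have t4 := s12 (0, X) (V u, 0) (0, Z)
  have t5 := s12 (0, X) (0, spray Λ (u, V u)) (0, Z)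
  have t6 := hΛ.fderiv_fderiv_symm (0, X) (Z, 0)
  rw [t1, t2, t3, t3, t4, t5, t6]
  ring

/-- The metric `g^V` along a field. -/
lemma smoothNear_fiberHessian_field {V : E → E} {u : E}
    (hΛ : SmoothNear Λ (u, V u)) (hV : SmoothNear V u) :
    SmoothNear (fun y => fiberHessian Λ (y, V y)) u :=
  SmoothNear.comp (g := fiberHessian Λ) hΛ.fiberHessian (SmoothNear.id.prodMk hV)

lemma eventually_field {V : E → E} {u : E} (hV : SmoothNear V u) {P : E × E → Prop}
    (h : ∀ᶠ z in 𝓝 (u, V u), P z) : ∀ᶠ y in 𝓝 u, P (y, V y) :=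
  (SmoothNear.id.prodMk hV).continuousAt.eventually h

variable [CompleteSpace E]

lemma eventually_christoffel_geodesicField (hh : IsFiberHomogeneous 2 Λ) {V : E → E} {u : E}
    (hΛ : SmoothNear Λ (u, V u)) (hV : SmoothNear V u)
    (hi : (fiberHessian Λ (u, V u)).IsInvertible)
    (hgeo : ∀ᶠ y in 𝓝 u, fderiv ℝ V y (V y) = spray Λ (y, V y)) :
    ∀ᶠ y in 𝓝 u, christoffel (fun y => fiberHessian Λ (y, V y)) y (V y)
      = -((1 / 2 : ℝ) • fiberDeriv (spray Λ) (y, V y)) := by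
  filter_upwards [eventually_field hV hΛ.eventually, hV.eventually, hgeo, eventually_field hV
    (SmoothNear.eventually_isInvertible hΛ.fiberHessian.continuousAt hi)] with y h1 h2 h3 h4
  ext X
  exact christoffel_geodesicField hh h1 h2 h4 h3 X

lemma fiberDeriv_spray_self (hh : IsFiberHomogeneous 2 Λ) (hΛ : SmoothNear Λ z)
    (hi : (fiberHessian Λ z).IsInvertible) :
    fiberDeriv (spray Λ) z z.2 = (2 : ℝ) • spray Λ z := by
  have := hh.spray.euler (hΛ.spray hi).differentiableAt
  simpa [fiberDeriv_apply] using this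

/-- For a geodesic field `V`, the curvature of `g^V` in the direction `V` is that of the spray. -/
theorem curvatureEndo_geodesicField (hh : IsFiberHomogeneous 2 Λ) {V : E → E} {u : E}
    (hΛ : SmoothNear Λ (u, V u)) (hV : SmoothNear V u)
    (hi : (fiberHessian Λ (u, V u)).IsInvertible)
    (hgeo : ∀ᶠ y in 𝓝 u, fderiv ℝ V y (V y) = spray Λ (y, V y)) :
    curvatureEndo (fun y => fiberHessian Λ (y, V y)) u (V u) (V u)
      = sprayCurvature (spray Λ) (u, V u) := by
  set G : E → E →L[ℝ] E →L[ℝ] ℝ := fun y => fiberHessian Λ (y, V y) with hGdef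
  have hG : SmoothNear G u := smoothNear_fiberHessian_field hΛ hV
  have hsymm : ∀ᶠ y in 𝓝 u, ∀ X Y, G y X Y = G y Y X :=
    (eventually_field hV hΛ.eventually).mono fun y hy X Y => fiberHessian_symm hy X Y
  have hΓ : SmoothNear (christoffel G) u := smoothNear_christoffel hG hi
  have hS : SmoothNear (spray Λ) (u, V u) := hΛ.spray hi
  have hMs : SmoothNear (fun y => fiberDeriv (spray Λ) (y, V y)) u :=
    SmoothNear.comp (g := fiberDeriv (spray Λ)) hS.fiberDeriv (SmoothNear.id.prodMk hV)
  have hSs : SmoothNear (fun y => spray Λ (y, V y)) u :=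
    SmoothNear.comp (g := spray Λ) hS (SmoothNear.id.prodMk hV)
  -- Only the Christoffel symbols with `V` as an argument are known through the spray.
  -- Differentiating this identity and Euler's identity for `M` suffices, because the curvature is
  -- evaluated at `(V, V)`.
  have hΓV := eventually_christoffel_geodesicField hh hΛ hV hi hgeo
  set M : E → E →L[ℝ] E := fun y => fiberDeriv (spray Λ) (y, V y) with hM
  have hMV : ∀ᶠ y in 𝓝 u, M y (V y) = (2 : ℝ) • spray Λ (y, V y) := by
    filter_upwards [eventually_field hV hΛ.eventually, eventually_field hV
      (SmoothNear.eventually_isInvertible hΛ.fiberHessian.continuousAt hi)] with y h1 h2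
    exact fiberDeriv_spray_self hh h1 h2
  -- derivatives of these identities
  have d1 : ∀ X, fderiv ℝ (christoffel G) u X (V u) + christoffel G u (fderiv ℝ V u X)
      = -((1 / 2 : ℝ) • fderiv ℝ M u X) := by
    intro X
    have := congrArg (fun A : E →L[ℝ] (E →L[ℝ] E) => A X) (EventuallyEq.fderiv_eq hΓV)
    rw [fderiv_clm_apply' hΓ.differentiableAt hV.differentiableAt, fderiv_fun_neg,
      fderiv_fun_const_smul hMs.differentiableAt] at this
    exact this
  have d2 : ∀ X, fderiv ℝ M u X (V u) + M u (fderiv ℝ V u X)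
      = (2 : ℝ) • (baseDeriv (spray Λ) (u, V u) X + M u (fderiv ℝ V u X)) := by
    intro X
    have := congrArg (fun A : E →L[ℝ] E => A X) (EventuallyEq.fderiv_eq hMV)
    rw [fderiv_clm_apply' hMs.differentiableAt hV.differentiableAt,
      fderiv_fun_const_smul hSs.differentiableAt, _root_.smul_apply,
      fderiv_comp_graph hS.differentiableAt hV.differentiableAt, fderiv_prod_eq] at this
    exact this
  have hDM : fderiv ℝ M u (V u) = sprayDeriv (spray Λ) (fiberDeriv (spray Λ)) (u, V u) := by
    rw [hM, fderiv_comp_graph hS.fiberDeriv.differentiableAt hV.differentiableAt,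
      hgeo.self_of_nhds]
    rfl
  have hΓu : christoffel G u (V u) = -((1 / 2 : ℝ) • M u) := hΓV.self_of_nhds
  have hsy := christoffel_symm hG.differentiableAt hsymm
  have hdsy := fderiv_christoffel_symm hG hi hsymm
  have hgeo0 := hgeo.self_of_nhds
  have hMV0 := hMV.self_of_nhds
  ext X
  -- The two contributions of `fderiv ℝ V u X`, one from each differentiated identity, cancel; what
  -- is left does not involve the extension `V` of the vector.
  have h1 : fderiv ℝ (christoffel G) u X (V u) (V u) = -(baseDeriv (spray Λ) (u, V u) X) := by
    have a1 := congrArg (fun A : E →L[ℝ] E => A (V u)) (d1 X)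
    simp only [_root_.add_apply, _root_.neg_apply, _root_.smul_apply] at a1
    rw [hsy (fderiv ℝ V u X) (V u), hΓu] at a1
    have a2 := d2 X
    simp only [_root_.neg_apply, _root_.smul_apply] at a1
    have a3 : fderiv ℝ M u X (V u)
        = (2 : ℝ) • (baseDeriv (spray Λ) (u, V u) X + M u (fderiv ℝ V u X))
          - M u (fderiv ℝ V u X) := by rw [← a2]; abel
    rw [a3] at a1
    have a4 := eq_sub_of_add_eq a1
    rw [a4]
    module
  have h2 : fderiv ℝ (christoffel G) u (V u) X (V u)
      = -((1 / 2 : ℝ) • fderiv ℝ M u (V u) X) - christoffel G u (spray Λ (u, V u)) X := by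
    have a1 := congrArg (fun A : E →L[ℝ] E => A X) (d1 (V u))
    simp only [_root_.add_apply, _root_.neg_apply, _root_.smul_apply] at a1
    rw [hgeo0] at a1
    rw [hdsy, eq_sub_iff_add_eq]
    exact a1
  have h3 : christoffel G u (V u) (V u) = -spray Λ (u, V u) := by
    rw [hΓu, _root_.neg_apply, _root_.smul_apply, hMV0]
    module
  rw [curvatureEndo_apply, h1, h2, h3, hsy X (-spray Λ (u, V u)), hsy X (V u), hΓu, hDM]
  simp only [sprayCurvature, _root_.add_apply, _root_.sub_apply, _root_.neg_apply,
    _root_.smul_apply, map_neg, map_smul, ContinuousLinearMap.comp_apply, hM]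
  module

theorem fderiv_geodesicField {F : Type*} [NormedAddCommGroup F] [NormedSpace ℝ F]
    {S : E × E → E} {τ : E × E → F} {V : E → E} {u : E}
    (hτ : SmoothNear τ (u, V u)) (hV : SmoothNear V u)
    (hgeo : fderiv ℝ V u (V u) = S (u, V u)) :
    fderiv ℝ (fun y => τ (y, V y)) u (V u) = sprayDeriv S τ (u, V u) := by
  rw [fderiv_comp_graph hτ.differentiableAt hV.differentiableAt, hgeo]
  rfl

/-- `V` is parallel along itself for `g^V`: the Christoffel term is `-S`, and `V` differentiated
along itself is `S`. So the Hessian is a second derivative along `V`, and on functions of the form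
`τ (y, V y)` that differentiation is `sprayDeriv`. -/
theorem localHessian_geodesicField (hh : IsFiberHomogeneous 2 Λ) {V : E → E} {u : E}
    (hΛ : SmoothNear Λ (u, V u)) (hV : SmoothNear V u)
    (hi : (fiberHessian Λ (u, V u)).IsInvertible)
    (hgeo : ∀ᶠ y in 𝓝 u, fderiv ℝ V y (V y) = spray Λ (y, V y))
    {τ : E × E → ℝ} (hτ : SmoothNear τ (u, V u)) :
    localHessian (fun y => fiberHessian Λ (y, V y)) (fun y => τ (y, V y)) u (V u) (V u)
      = sprayDeriv (spray Λ) (sprayDeriv (spray Λ) τ) (u, V u) := by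
  have hS : SmoothNear (spray Λ) (u, V u) := hΛ.spray hi
  have hΨ : SmoothNear (fun y => τ (y, V y)) u :=
    SmoothNear.comp (g := τ) hτ (SmoothNear.id.prodMk hV)
  have h1 : (fun y => fderiv ℝ (fun y => τ (y, V y)) y (V y)) =ᶠ[𝓝 u]
      fun y => sprayDeriv (spray Λ) τ (y, V y) := by
    filter_upwards [eventually_field hV hτ.eventually, hV.eventually, hgeo] with y a1 a2 a3
    exact fderiv_geodesicField a1 a2 a3
  have h2 := congrArg (fun A : E →L[ℝ] ℝ => A (V u)) h1.fderiv_eq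
  rw [fderiv_clm_apply' hΨ.fderiv.differentiableAt hV.differentiableAt,
    fderiv_geodesicField (hS.sprayDeriv hτ) hV hgeo.self_of_nhds] at h2
  rw [localHessian_apply, ← h2, hgeo.self_of_nhds, christoffel_geodesicField hh hΛ hV hi
    hgeo.self_of_nhds, fiberDeriv_spray_self hh hΛ hi]
  simp

end GeodesicField

/-! ### The spray of a warped product -/

section WarpedSpray

variable {EB : Type*} [NormedAddCommGroup EB] [NormedSpace ℝ EB]
  {EF : Type*} [NormedAddCommGroup EF] [NormedSpace ℝ EF]

/-- The base components of a point and a velocity in a product. -/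
def projBase (EB EF : Type*) [NormedAddCommGroup EB] [NormedSpace ℝ EB]
    [NormedAddCommGroup EF] [NormedSpace ℝ EF] : (EB × EF) × (EB × EF) →L[ℝ] EB × EB :=
  (ContinuousLinearMap.fst ℝ EB EF).prodMap (ContinuousLinearMap.fst ℝ EB EF)

/-- The fibre components of a point and a velocity in a product. -/
def projFiber (EB EF : Type*) [NormedAddCommGroup EB] [NormedSpace ℝ EB]
    [NormedAddCommGroup EF] [NormedSpace ℝ EF] : (EB × EF) × (EB × EF) →L[ℝ] EF × EF :=
  (ContinuousLinearMap.snd ℝ EB EF).prodMap (ContinuousLinearMap.snd ℝ EB EF)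

lemma SmoothNear.comp_projBase {Y : Type*} [NormedAddCommGroup Y] [NormedSpace ℝ Y]
    {Q : EB × EB → Y} {z : (EB × EF) × (EB × EF)} (h : SmoothNear Q (z.1.1, z.2.1)) :
    SmoothNear (fun z' : (EB × EF) × (EB × EF) => Q (z'.1.1, z'.2.1)) z :=
  SmoothNear.comp (f := projBase EB EF) h (SmoothNear.clm _)

lemma SmoothNear.comp_projFiber {Y : Type*} [NormedAddCommGroup Y] [NormedSpace ℝ Y]
    {Q : EF × EF → Y} {z : (EB × EF) × (EB × EF)} (h : SmoothNear Q (z.1.2, z.2.2)) :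
    SmoothNear (fun z' : (EB × EF) × (EB × EF) => Q (z'.1.2, z'.2.2)) z :=
  SmoothNear.comp (f := projFiber EB EF) h (SmoothNear.clm _)

lemma fderiv_comp_projBase {Y : Type*} [NormedAddCommGroup Y] [NormedSpace ℝ Y]
    {Q : EB × EB → Y} {z : (EB × EF) × (EB × EF)} (h : SmoothNear Q (z.1.1, z.2.1))
    (a : (EB × EF) × (EB × EF)) :
    fderiv ℝ (fun z' : (EB × EF) × (EB × EF) => Q (z'.1.1, z'.2.1)) z a
      = fderiv ℝ Q (z.1.1, z.2.1) (a.1.1, a.2.1) := by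
  have h1 : HasFDerivAt Q (fderiv ℝ Q (z.1.1, z.2.1)) (projBase EB EF z) := h.hasFDerivAt
  have h2 := h1.comp z (projBase EB EF).hasFDerivAt
  change HasFDerivAt (fun z' : (EB × EF) × (EB × EF) => Q (z'.1.1, z'.2.1)) _ z at h2
  rw [h2.fderiv]
  rfl

lemma fderiv_comp_projFiber {Y : Type*} [NormedAddCommGroup Y] [NormedSpace ℝ Y]
    {Q : EF × EF → Y} {z : (EB × EF) × (EB × EF)} (h : SmoothNear Q (z.1.2, z.2.2))
    (a : (EB × EF) × (EB × EF)) :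
    fderiv ℝ (fun z' : (EB × EF) × (EB × EF) => Q (z'.1.2, z'.2.2)) z a
      = fderiv ℝ Q (z.1.2, z.2.2) (a.1.2, a.2.2) := by
  have h1 : HasFDerivAt Q (fderiv ℝ Q (z.1.2, z.2.2)) (projFiber EB EF z) := h.hasFDerivAt
  have h2 := h1.comp z (projFiber EB EF).hasFDerivAt
  change HasFDerivAt (fun z' : (EB × EF) × (EB × EF) => Q (z'.1.2, z'.2.2)) _ z at h2
  rw [h2.fderiv]
  rfl

lemma SmoothNear.comp_fst {X Y : Type*} [NormedAddCommGroup X] [NormedSpace ℝ X]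
    [NormedAddCommGroup Y] [NormedSpace ℝ Y] {W : Type*} [NormedAddCommGroup W] [NormedSpace ℝ W]
    {Q : X → Y} {z : X × W} (h : SmoothNear Q z.1) :
    SmoothNear (fun z' : X × W => Q z'.1) z :=
  SmoothNear.comp (f := Prod.fst) h SmoothNear.fst

lemma fderiv_comp_fst {X Y : Type*} [NormedAddCommGroup X] [NormedSpace ℝ X]
    [NormedAddCommGroup Y] [NormedSpace ℝ Y] {W : Type*} [NormedAddCommGroup W] [NormedSpace ℝ W]
    {Q : X → Y} {z : X × W} (h : SmoothNear Q z.1) (a : X × W) :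
    fderiv ℝ (fun z' : X × W => Q z'.1) z a = fderiv ℝ Q z.1 a.1 := by
  have h2 := h.hasFDerivAt.comp z (hasFDerivAt_fst (p := z))
  change HasFDerivAt (fun z' : X × W => Q z'.1) _ z at h2
  rw [h2.fderiv]
  rfl

lemma fderiv_pairing {X Y : Type*} [NormedAddCommGroup X] [NormedSpace ℝ X]
    [NormedAddCommGroup Y] [NormedSpace ℝ Y] {μ : X → X →L[ℝ] Y} {z : X × X}
    (h : SmoothNear μ z.1) (a : X × X) :
    fderiv ℝ (fun z' : X × X => μ z'.1 z'.2) z a = fderiv ℝ μ z.1 a.1 z.2 + μ z.1 a.2 := by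
  rw [fderiv_clm_apply' h.comp_fst.differentiableAt differentiableAt_snd,
    fderiv_comp_fst h, fderiv_snd]
  rfl

/-- A spray on a product: `S_B` and `S_F` coupled by a vector field `H` and a one-form `μ` on the
base and a function `Λ` on the fibre. -/
def coupledSpray (SB : EB × EB → EB) (H : EB → EB) (μ : EB → EB →L[ℝ] ℝ) (Λ : EF × EF → ℝ)
    (SF : EF × EF → EF) (z : (EB × EF) × (EB × EF)) : EB × EF :=
  (SB (z.1.1, z.2.1) + Λ (z.1.2, z.2.2) • H z.1.1,
    SF (z.1.2, z.2.2) - (2 * μ z.1.1 z.2.1) • z.2.2)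

section Coupled

variable {SB : EB × EB → EB} {H : EB → EB} {μ : EB → EB →L[ℝ] ℝ} {Λ : EF × EF → ℝ}
  {SF : EF × EF → EF} {z : (EB × EF) × (EB × EF)}

lemma smoothNear_coupledSpray (hSB : SmoothNear SB (z.1.1, z.2.1)) (hH : SmoothNear H z.1.1)
    (hμ : SmoothNear μ z.1.1) (hΛ : SmoothNear Λ (z.1.2, z.2.2))
    (hSF : SmoothNear SF (z.1.2, z.2.2)) : SmoothNear (coupledSpray SB H μ Λ SF) z := by
  have h1 : SmoothNear (fun z' : (EB × EF) × (EB × EF) => H z'.1.1) z :=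
    (SmoothNear.comp_fst (z := z.1) hH).comp_fst
  have h2 : SmoothNear (fun q : EB × EB => μ q.1 q.2) (z.1.1, z.2.1) :=
    (SmoothNear.comp_fst (z := (z.1.1, z.2.1)) hμ).clm_apply SmoothNear.snd
  have h3 : SmoothNear (fun z' : (EB × EF) × (EB × EF) => z'.2.2) z :=
    SmoothNear.comp_projFiber (Q := Prod.snd) SmoothNear.snd
  exact (hSB.comp_projBase.add (hΛ.comp_projFiber.smul h1)).prodMk
    (hSF.comp_projFiber.sub (((SmoothNear.const 2).mul h2.comp_projBase).smul h3))

lemma fderiv_coupledSpray (hSB : SmoothNear SB (z.1.1, z.2.1)) (hH : SmoothNear H z.1.1)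
    (hμ : SmoothNear μ z.1.1) (hΛ : SmoothNear Λ (z.1.2, z.2.2))
    (hSF : SmoothNear SF (z.1.2, z.2.2)) (a : (EB × EF) × (EB × EF)) :
    fderiv ℝ (coupledSpray SB H μ Λ SF) z a
      = (fderiv ℝ SB (z.1.1, z.2.1) (a.1.1, a.2.1) +
          (fderiv ℝ Λ (z.1.2, z.2.2) (a.1.2, a.2.2) • H z.1.1
            + Λ (z.1.2, z.2.2) • fderiv ℝ H z.1.1 a.1.1),
        fderiv ℝ SF (z.1.2, z.2.2) (a.1.2, a.2.2)
          - ((2 * (fderiv ℝ μ z.1.1 a.1.1 z.2.1 + μ z.1.1 a.2.1)) • z.2.2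
            + (2 * μ z.1.1 z.2.1) • a.2.2)) := by
  have h1 : SmoothNear (fun z' : (EB × EF) × (EB × EF) => H z'.1.1) z :=
    (SmoothNear.comp_fst (z := z.1) hH).comp_fst
  have h1' : fderiv ℝ (fun z' : (EB × EF) × (EB × EF) => H z'.1.1) z a
      = fderiv ℝ H z.1.1 a.1.1 := by
    rw [fderiv_comp_fst (Q := fun q : EB × EF => H q.1) (SmoothNear.comp_fst (z := z.1) hH),
      fderiv_comp_fst hH]
  have h2 : SmoothNear (fun q : EB × EB => μ q.1 q.2) (z.1.1, z.2.1) :=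
    (SmoothNear.comp_fst (z := (z.1.1, z.2.1)) hμ).clm_apply SmoothNear.snd
  have h3 : SmoothNear (fun z' : (EB × EF) × (EB × EF) => z'.2.2) z :=
    SmoothNear.comp_projFiber (Q := Prod.snd) SmoothNear.snd
  have h3' : fderiv ℝ (fun z' : (EB × EF) × (EB × EF) => z'.2.2) z a = a.2.2 := by
    rw [fderiv_comp_projFiber (Q := Prod.snd) SmoothNear.snd, fderiv_snd]
    rfl
  have h4 : fderiv ℝ (fun z' : (EB × EF) × (EB × EF) => μ z'.1.1 z'.2.1) z a
      = fderiv ℝ μ z.1.1 a.1.1 z.2.1 + μ z.1.1 a.2.1 := by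
    rw [fderiv_comp_projBase (Q := fun q : EB × EB => μ q.1 q.2) h2,
      fderiv_pairing (z := (z.1.1, z.2.1)) hμ]
  have hA := (hSB.comp_projBase (EF := EF) (z := z)).hasFDerivAt.add
    ((hΛ.comp_projFiber (EB := EB) (z := z)).hasFDerivAt.smul h1.hasFDerivAt)
  have hB := (hSF.comp_projFiber (EB := EB) (z := z)).hasFDerivAt.sub
    ((h2.comp_projBase (EF := EF) (z := z)).hasFDerivAt.const_mul 2 |>.smul h3.hasFDerivAt)
  have hAB := hA.prodMk hB
  change HasFDerivAt (coupledSpray SB H μ Λ SF) _ z at hAB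
  rw [hAB.fderiv]
  refine Prod.ext ?_ ?_
  · simp only [ContinuousLinearMap.prod_apply, _root_.add_apply, _root_.smul_apply,
      ContinuousLinearMap.smulRight_apply, h1', fderiv_comp_projBase hSB,
      fderiv_comp_projFiber hΛ]
    abel
  · simp only [ContinuousLinearMap.prod_apply, _root_.sub_apply, _root_.add_apply,
      _root_.smul_apply, ContinuousLinearMap.smulRight_apply, h3', h4, smul_eq_mul,
      fderiv_comp_projFiber hSF]
    abel

end Coupled

end WarpedSpray

/-! ### Diagonal curvature blocks of a coupled spray on a product. -/

section CoupledCurvature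

variable {EB : Type*} [NormedAddCommGroup EB] [NormedSpace ℝ EB]
  {EF : Type*} [NormedAddCommGroup EF] [NormedSpace ℝ EF]

/-- The trace of an endomorphism of a product is the sum of the traces of its diagonal blocks. -/
lemma trace_prod [FiniteDimensional ℝ EB] [FiniteDimensional ℝ EF]
    (A : EB × EF →L[ℝ] EB × EF) :
    LinearMap.trace ℝ (EB × EF) (A : EB × EF →ₗ[ℝ] EB × EF)
      = LinearMap.trace ℝ EB (((ContinuousLinearMap.fst ℝ EB EF).comp
          (A.comp (ContinuousLinearMap.inl ℝ EB EF)) : EB →L[ℝ] EB) : EB →ₗ[ℝ] EB)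
        + LinearMap.trace ℝ EF (((ContinuousLinearMap.snd ℝ EB EF).comp
          (A.comp (ContinuousLinearMap.inr ℝ EB EF)) : EF →L[ℝ] EF) : EF →ₗ[ℝ] EF) := by
  let A' : EB × EF →ₗ[ℝ] EB × EF := A
  have h1 : A' = (A' ∘ₗ LinearMap.inl ℝ EB EF) ∘ₗ LinearMap.fst ℝ EB EF
      + (A' ∘ₗ LinearMap.inr ℝ EB EF) ∘ₗ LinearMap.snd ℝ EB EF := by
    refine LinearMap.ext fun q => ?_
    simp only [LinearMap.add_apply, LinearMap.comp_apply, ← map_add]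
    simp
  change LinearMap.trace ℝ (EB × EF) A' = LinearMap.trace ℝ EB
    (LinearMap.fst ℝ EB EF ∘ₗ (A' ∘ₗ LinearMap.inl ℝ EB EF)) + LinearMap.trace ℝ EF
    (LinearMap.snd ℝ EB EF ∘ₗ (A' ∘ₗ LinearMap.inr ℝ EB EF))
  conv_lhs => rw [h1]
  rw [map_add, LinearMap.trace_comp_comm' (A' ∘ₗ LinearMap.inl ℝ EB EF),
    LinearMap.trace_comp_comm' (A' ∘ₗ LinearMap.inr ℝ EB EF)]

variable {SB : EB × EB → EB} {H : EB → EB} {μ : EB → EB →L[ℝ] ℝ} {Λ : EF × EF → ℝ}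
  {SF : EF × EF → EF} {z : (EB × EF) × (EB × EF)}

/-- The blocks of the fibre derivative of a coupled spray. -/
lemma fiberDeriv_coupledSpray (hSB : SmoothNear SB (z.1.1, z.2.1)) (hH : SmoothNear H z.1.1)
    (hμ : SmoothNear μ z.1.1) (hΛ : SmoothNear Λ (z.1.2, z.2.2))
    (hSF : SmoothNear SF (z.1.2, z.2.2)) (η : EB) (ν : EF) :
    fiberDeriv (coupledSpray SB H μ Λ SF) z (η, ν)
      = (fiberDeriv SB (z.1.1, z.2.1) η + fiberDeriv Λ (z.1.2, z.2.2) ν • H z.1.1,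
        fiberDeriv SF (z.1.2, z.2.2) ν
          - ((2 * μ z.1.1 η) • z.2.2 + (2 * μ z.1.1 z.2.1) • ν)) := by
  rw [fiberDeriv_apply, fderiv_coupledSpray hSB hH hμ hΛ hSF]
  simp [fiberDeriv_apply]

lemma eventually_projBase {P : EB × EB → Prop} (h : ∀ᶠ q in 𝓝 (z.1.1, z.2.1), P q) :
    ∀ᶠ z' in 𝓝 z, P (z'.1.1, z'.2.1) :=
  ((projBase EB EF).continuous.tendsto z).eventually h

lemma eventually_projFiber {P : EF × EF → Prop} (h : ∀ᶠ q in 𝓝 (z.1.2, z.2.2), P q) :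
    ∀ᶠ z' in 𝓝 z, P (z'.1.2, z'.2.2) :=
  ((projFiber EB EF).continuous.tendsto z).eventually h

lemma eventually_basePoint {P : EB → Prop} (h : ∀ᶠ q in 𝓝 z.1.1, P q) :
    ∀ᶠ z' in 𝓝 z, P z'.1.1 :=
  ((continuous_fst.comp continuous_fst).tendsto z).eventually h

/-- The coupling enters three times: the base derivative hits `H`; the extra acceleration `Λ • H`
differentiates `fiberDeriv SB`; and in the square of the fibre derivative the two off-diagonal
blocks compose to a multiple of `H`. The other component is irrelevant for the trace. -/
lemma sprayCurvature_coupledSpray_base (hSB : SmoothNear SB (z.1.1, z.2.1))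
    (hH : SmoothNear H z.1.1)
    (hμ : SmoothNear μ z.1.1) (hΛ : SmoothNear Λ (z.1.2, z.2.2))
    (hSF : SmoothNear SF (z.1.2, z.2.2)) (η : EB) :
    (sprayCurvature (coupledSpray SB H μ Λ SF) z (η, 0)).1
      = sprayCurvature SB (z.1.1, z.2.1) η - Λ (z.1.2, z.2.2) • fderiv ℝ H z.1.1 η
        + (Λ (z.1.2, z.2.2) / 2) •
          fderiv ℝ (fiberDeriv SB) (z.1.1, z.2.1) (0, H z.1.1) η
        + ((1 / 2) * (μ z.1.1 η * fiberDeriv Λ (z.1.2, z.2.2) z.2.2)) • H z.1.1 := by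
  have hS := smoothNear_coupledSpray hSB hH hμ hΛ hSF
  have hbase : (baseDeriv (coupledSpray SB H μ Λ SF) z (η, 0)).1
      = baseDeriv SB (z.1.1, z.2.1) η + Λ (z.1.2, z.2.2) • fderiv ℝ H z.1.1 η := by
    rw [baseDeriv_apply, fderiv_coupledSpray hSB hH hμ hΛ hSF]
    simp only [baseDeriv_apply, Prod.mk_zero_zero, map_zero, zero_smul, zero_add, Prod.fst_zero,
      Prod.snd_zero]
  have hsq : (fiberDeriv (coupledSpray SB H μ Λ SF) z
      (fiberDeriv (coupledSpray SB H μ Λ SF) z (η, 0))).1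
      = fiberDeriv SB (z.1.1, z.2.1) (fiberDeriv SB (z.1.1, z.2.1) η)
        - (2 * (μ z.1.1 η * fiberDeriv Λ (z.1.2, z.2.2) z.2.2)) • H z.1.1 := by
    rw [fiberDeriv_coupledSpray hSB hH hμ hΛ hSF η 0, fiberDeriv_coupledSpray hSB hH hμ hΛ hSF]
    simp only [map_zero, zero_smul, add_zero, smul_zero, zero_sub, map_neg, map_smul, smul_eq_mul]
    module
  have hder : ∀ a, (fderiv ℝ (fiberDeriv (coupledSpray SB H μ Λ SF)) z a (η, 0)).1
      = fderiv ℝ (fiberDeriv SB) (z.1.1, z.2.1) (a.1.1, a.2.1) η := by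
    intro a
    have h1 : (fun z' => (ContinuousLinearMap.fst ℝ EB EF)
        (fiberDeriv (coupledSpray SB H μ Λ SF) z' (η, 0)))
        =ᶠ[𝓝 z] fun z' => fiberDeriv SB (z'.1.1, z'.2.1) η := by
      filter_upwards [eventually_projBase hSB.eventually, eventually_basePoint hH.eventually,
        eventually_basePoint hμ.eventually, eventually_projFiber hΛ.eventually,
        eventually_projFiber hSF.eventually] with z' a1 a2 a3 a4 a5
      rw [fiberDeriv_coupledSpray a1 a2 a3 a4 a5]
      simp
    have h2 := congrArg (fun A : (EB × EF) × (EB × EF) →L[ℝ] EB => A a) h1.fderiv_eq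
    rw [fderiv_clm_apply' (differentiableAt_const _)
        (hS.fiberDeriv.clm_apply (SmoothNear.const _)).differentiableAt,
      fderiv_clm_apply_const hS.fiberDeriv.differentiableAt,
      fderiv_clm_apply_const (A := fun z' : (EB × EF) × (EB × EF) =>
        fiberDeriv SB (z'.1.1, z'.2.1)) hSB.fiberDeriv.comp_projBase.differentiableAt,
      fderiv_comp_projBase hSB.fiberDeriv] at h2
    simpa using h2
  have hspr : (sprayDeriv (coupledSpray SB H μ Λ SF)
        (fiberDeriv (coupledSpray SB H μ Λ SF)) z (η, 0)).1
      = sprayDeriv SB (fiberDeriv SB) (z.1.1, z.2.1) η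
        + Λ (z.1.2, z.2.2) • fderiv ℝ (fiberDeriv SB) (z.1.1, z.2.1) (0, H z.1.1) η := by
    rw [sprayDeriv, hder]
    have : (z.2.1, (coupledSpray SB H μ Λ SF z).1)
        = (z.2.1, SB (z.1.1, z.2.1)) + Λ (z.1.2, z.2.2) • ((0 : EB), H z.1.1) := by
      simp [coupledSpray]
    change fderiv ℝ (fiberDeriv SB) (z.1.1, z.2.1) (z.2.1, (coupledSpray SB H μ Λ SF z).1) η = _
    rw [this, map_add, map_smul]
    rfl
  simp only [sprayCurvature, _root_.add_apply, _root_.sub_apply, _root_.neg_apply,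
    _root_.smul_apply, ContinuousLinearMap.comp_apply, Prod.fst_add, Prod.fst_sub, Prod.fst_neg,
    Prod.smul_fst, hbase, hsq, hspr]
  module

/-- The friction `-2 μ v` produces multiples of `fiberDeriv SF` both in the derivative along the
spray and in the square. With the weights `1/2` and `-1/4` these cancel, leaving a multiple of the
identity and a rank-one term. -/
lemma sprayCurvature_coupledSpray_fiber (hSB : SmoothNear SB (z.1.1, z.2.1))
    (hH : SmoothNear H z.1.1)
    (hμ : SmoothNear μ z.1.1) (hΛ : SmoothNear Λ (z.1.2, z.2.2))
    (hSF : SmoothNear SF (z.1.2, z.2.2)) (hhom : IsFiberHomogeneous 2 SF) (ν : EF) :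
    (sprayCurvature (coupledSpray SB H μ Λ SF) z (0, ν)).2
      = sprayCurvature SF (z.1.2, z.2.2) ν
        - (fderiv ℝ μ z.1.1 z.2.1 z.2.1 + μ z.1.1 (SB (z.1.1, z.2.1))
            + Λ (z.1.2, z.2.2) * μ z.1.1 (H z.1.1) + μ z.1.1 z.2.1 ^ 2) • ν
        + ((1 / 2) * (μ z.1.1 (H z.1.1) * fiberDeriv Λ (z.1.2, z.2.2) ν)) • z.2.2 := by
  have hS := smoothNear_coupledSpray hSB hH hμ hΛ hSF
  have hbase : (baseDeriv (coupledSpray SB H μ Λ SF) z (0, ν)).2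
      = baseDeriv SF (z.1.2, z.2.2) ν := by
    rw [baseDeriv_apply, fderiv_coupledSpray hSB hH hμ hΛ hSF]
    simp [baseDeriv_apply]
  have hsq : (fiberDeriv (coupledSpray SB H μ Λ SF) z
      (fiberDeriv (coupledSpray SB H μ Λ SF) z (0, ν))).2
      = fiberDeriv SF (z.1.2, z.2.2) (fiberDeriv SF (z.1.2, z.2.2) ν)
        - (4 * μ z.1.1 z.2.1) • fiberDeriv SF (z.1.2, z.2.2) ν
        + (4 * μ z.1.1 z.2.1 ^ 2) • ν
        - (2 * (μ z.1.1 (H z.1.1) * fiberDeriv Λ (z.1.2, z.2.2) ν)) • z.2.2 := by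
    rw [fiberDeriv_coupledSpray hSB hH hμ hΛ hSF 0 ν, fiberDeriv_coupledSpray hSB hH hμ hΛ hSF]
    simp only [map_zero, zero_smul, zero_add, map_sub, map_smul, smul_eq_mul,
      mul_zero]
    module
  have hμ' : SmoothNear (fun q : EB × EB => μ q.1 q.2) (z.1.1, z.2.1) :=
    (SmoothNear.comp_fst (z := (z.1.1, z.2.1)) hμ).clm_apply SmoothNear.snd
  have hder : ∀ a, (fderiv ℝ (fiberDeriv (coupledSpray SB H μ Λ SF)) z a (0, ν)).2
      = fderiv ℝ (fiberDeriv SF) (z.1.2, z.2.2) (a.1.2, a.2.2) ν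
        - (2 * (fderiv ℝ μ z.1.1 a.1.1 z.2.1 + μ z.1.1 a.2.1)) • ν := by
    intro a
    have h1 : (fun z' => (ContinuousLinearMap.snd ℝ EB EF)
        (fiberDeriv (coupledSpray SB H μ Λ SF) z' (0, ν)))
        =ᶠ[𝓝 z] fun z' => fiberDeriv SF (z'.1.2, z'.2.2) ν
          - (2 * μ z'.1.1 z'.2.1) • ν := by
      filter_upwards [eventually_projBase hSB.eventually, eventually_basePoint hH.eventually,
        eventually_basePoint hμ.eventually, eventually_projFiber hΛ.eventually,
        eventually_projFiber hSF.eventually] with z' a1 a2 a3 a4 a5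
      rw [fiberDeriv_coupledSpray a1 a2 a3 a4 a5]
      simp
    have h2 := congrArg (fun A : (EB × EF) × (EB × EF) →L[ℝ] EF => A a) h1.fderiv_eq
    have h3 : HasFDerivAt (fun z' : (EB × EF) × (EB × EF) => (2 * μ z'.1.1 z'.2.1) • ν) _ z :=
      ((hμ'.comp_projBase (EF := EF) (z := z)).hasFDerivAt.const_mul 2).smul_const ν
    rw [fderiv_clm_apply' (differentiableAt_const _)
        (hS.fiberDeriv.clm_apply (SmoothNear.const _)).differentiableAt,
      fderiv_clm_apply_const hS.fiberDeriv.differentiableAt,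
      fderiv_fun_sub (hSF.fiberDeriv.comp_projFiber.clm_apply (SmoothNear.const _)).differentiableAt
        h3.differentiableAt, h3.fderiv, _root_.sub_apply,
      fderiv_clm_apply_const (A := fun z' : (EB × EF) × (EB × EF) =>
        fiberDeriv SF (z'.1.2, z'.2.2)) hSF.fiberDeriv.comp_projFiber.differentiableAt,
      fderiv_comp_projFiber hSF.fiberDeriv, ContinuousLinearMap.smulRight_apply,
      _root_.smul_apply, fderiv_comp_projBase hμ',
      fderiv_pairing (z := (z.1.1, z.2.1)) hμ] at h2
    simpa using h2
  -- `fiberDeriv SF` has degree one, so the friction part of the acceleration, which is proportional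
  -- to `v`, acts on it as a scalar.
  have heuler : fderiv ℝ (fiberDeriv SF) (z.1.2, z.2.2) (0, z.2.2)
      = fiberDeriv SF (z.1.2, z.2.2) := by
    have := hhom.fiberDeriv.euler (z := (z.1.2, z.2.2)) hSF.fiberDeriv.differentiableAt
    simpa using this
  have hspr : (sprayDeriv (coupledSpray SB H μ Λ SF)
        (fiberDeriv (coupledSpray SB H μ Λ SF)) z (0, ν)).2
      = sprayDeriv SF (fiberDeriv SF) (z.1.2, z.2.2) ν
        - (2 * μ z.1.1 z.2.1) • fiberDeriv SF (z.1.2, z.2.2) ν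
        - (2 * (fderiv ℝ μ z.1.1 z.2.1 z.2.1 + μ z.1.1 (SB (z.1.1, z.2.1))
            + Λ (z.1.2, z.2.2) * μ z.1.1 (H z.1.1))) • ν := by
    rw [sprayDeriv, hder]
    have : (z.2.2, (coupledSpray SB H μ Λ SF z).2)
        = (z.2.2, SF (z.1.2, z.2.2)) - (2 * μ z.1.1 z.2.1) • ((0 : EF), z.2.2) := by
      simp [coupledSpray]
    have h1 : fderiv ℝ (fiberDeriv SF) (z.1.2, z.2.2) (z.2.2, (coupledSpray SB H μ Λ SF z).2) ν
        = sprayDeriv SF (fiberDeriv SF) (z.1.2, z.2.2) ν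
          - (2 * μ z.1.1 z.2.1) • fiberDeriv SF (z.1.2, z.2.2) ν := by
      rw [this, map_sub, map_smul, heuler]
      rfl
    have h2 : μ z.1.1 (coupledSpray SB H μ Λ SF z).1
        = μ z.1.1 (SB (z.1.1, z.2.1)) + Λ (z.1.2, z.2.2) * μ z.1.1 (H z.1.1) := by
      simp [coupledSpray]
    rw [h1, h2]
    module
  simp only [sprayCurvature, _root_.add_apply, _root_.sub_apply, _root_.neg_apply,
    _root_.smul_apply, ContinuousLinearMap.comp_apply, Prod.snd_add, Prod.snd_sub, Prod.snd_neg,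
    Prod.smul_snd, hbase, hsq, hspr]
  module

/-- The derivative of a function of the fibre variables along a coupled spray. -/
lemma sprayDeriv_coupledSpray_fiber {σ : EF × EF → ℝ} {k : ℕ} (hσh : IsFiberHomogeneous k σ)
    (hσ : SmoothNear σ (z.1.2, z.2.2)) :
    sprayDeriv (coupledSpray SB H μ Λ SF)
        (fun z' : (EB × EF) × (EB × EF) => σ (z'.1.2, z'.2.2)) z
      = sprayDeriv SF σ (z.1.2, z.2.2) - 2 * k * μ z.1.1 z.2.1 * σ (z.1.2, z.2.2) := by
  rw [sprayDeriv, fderiv_comp_projFiber hσ]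
  have : (z.2.2, (coupledSpray SB H μ Λ SF z).2)
      = (z.2.2, SF (z.1.2, z.2.2)) - (2 * μ z.1.1 z.2.1) • ((0 : EF), z.2.2) := by
    simp [coupledSpray]
  change fderiv ℝ σ (z.1.2, z.2.2) (z.2.2, (coupledSpray SB H μ Λ SF z).2) = _
  have he := hσh.euler (z := (z.1.2, z.2.2)) hσ.differentiableAt
  simp only at he
  rw [this, map_sub, map_smul, he, smul_eq_mul, smul_eq_mul, sprayDeriv]
  ring

/-- The derivative of a one-form on the base along a coupled spray. -/
lemma sprayDeriv_coupledSpray_base (hμ : SmoothNear μ z.1.1) :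
    sprayDeriv (coupledSpray SB H μ Λ SF)
        (fun z' : (EB × EF) × (EB × EF) => μ z'.1.1 z'.2.1) z
      = fderiv ℝ μ z.1.1 z.2.1 z.2.1 + μ z.1.1 (SB (z.1.1, z.2.1))
        + Λ (z.1.2, z.2.2) * μ z.1.1 (H z.1.1) := by
  have hμ' : SmoothNear (fun q : EB × EB => μ q.1 q.2) (z.1.1, z.2.1) :=
    (SmoothNear.comp_fst (z := (z.1.1, z.2.1)) hμ).clm_apply SmoothNear.snd
  rw [sprayDeriv, fderiv_comp_projBase (Q := fun q : EB × EB => μ q.1 q.2) hμ',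
    fderiv_pairing (z := (z.1.1, z.2.1)) hμ]
  simp [coupledSpray, add_assoc]

end CoupledCurvature

/-! ### Positive definite forms -/

section PosDef

variable {E : Type*} [NormedAddCommGroup E] [NormedSpace ℝ E] [FiniteDimensional ℝ E]

lemma isInvertible_of_pos {b : E →L[ℝ] E →L[ℝ] ℝ} (hb : ∀ y, y ≠ 0 → 0 < b y y) :
    b.IsInvertible := by
  have hinj : Function.Injective (b : E →ₗ[ℝ] E →L[ℝ] ℝ) := by
    rw [← LinearMap.ker_eq_bot, LinearMap.ker_eq_bot']
    intro y hy
    by_contra h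
    have h1 : b y = 0 := hy
    have := hb y h
    rw [h1] at this
    simp at this
  have hdim : finrank ℝ E = finrank ℝ (E →L[ℝ] ℝ) := by
    rw [← LinearEquiv.finrank_eq (LinearMap.toContinuousLinearMap (𝕜 := ℝ) (E := E) (F' := ℝ))]
    exact (Subspace.dual_finrank_eq (K := ℝ) (V := E)).symm
  let e : E ≃ₗ[ℝ] (E →L[ℝ] ℝ) := LinearEquiv.ofInjectiveOfFinrankEq _ hinj hdim
  exact ⟨e.toContinuousLinearEquiv, by ext; rfl⟩

/-- Compactness of the unit sphere makes the neighbourhood independent of the vector; quadratic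
scaling covers all other vectors. -/
lemma eventually_pos {X : Type*} [TopologicalSpace X] {A : X → E →L[ℝ] E →L[ℝ] ℝ} {x : X}
    (hA : ContinuousAt A x) (h : ∀ y, y ≠ 0 → 0 < A x y y) :
    ∀ᶠ x' in 𝓝 x, ∀ y, y ≠ 0 → 0 < A x' y y := by
  have hcomp : IsCompact (Metric.sphere (0 : E) 1) := isCompact_sphere 0 1
  have h1 : ∀ y ∈ Metric.sphere (0 : E) 1, ∀ᶠ q in 𝓝 (x, y), 0 < A q.1 q.2 q.2 := by
    intro y hy
    have hc : ContinuousAt (fun q : X × E => A q.1 q.2 q.2) (x, y) := by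
      have hA' : ContinuousAt (fun q : X × E => A q.1) (x, y) :=
        ContinuousAt.comp (f := Prod.fst) hA continuousAt_fst
      exact (hA'.clm_apply continuousAt_snd).clm_apply continuousAt_snd
    refine hc.eventually (lt_mem_nhds (h y ?_))
    rintro rfl
    simp at hy
  have h2 := hcomp.eventually_forall_of_forall_eventually (P := fun x' y => 0 < A x' y y) h1
  filter_upwards [h2] with x' hx' y hy
  have hn : ‖y‖ ≠ 0 := norm_ne_zero_iff.2 hy
  have h3 := hx' (‖y‖⁻¹ • y) (by simp [norm_smul, hn])
  rw [map_smul, map_smul, _root_.smul_apply, smul_eq_mul, smul_eq_mul, ← mul_assoc] at h3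
  exact pos_of_mul_pos_right h3 (by positivity)

end PosDef

/-! ### The energy of a warped product -/

section WarpedEnergy

variable {EB : Type*} [NormedAddCommGroup EB] [NormedSpace ℝ EB]
  {EF : Type*} [NormedAddCommGroup EF] [NormedSpace ℝ EF]

/-- The gradient in coordinates. -/
def localGradient (G : EB → EB →L[ℝ] EB →L[ℝ] ℝ) (f : EB → ℝ) (b : EB) : EB :=
  (G b).inverse (fderiv ℝ f b)

/-- The geodesic spray of a Riemannian metric. -/
def metricSpray (G : EB → EB →L[ℝ] EB →L[ℝ] ℝ) (q : EB × EB) : EB := -christoffel G q.1 q.2 q.2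

/-- The energy of a warped product in coordinates. -/
def warpedEnergy (G : EB → EB →L[ℝ] EB →L[ℝ] ℝ) (f : EB → ℝ) (Λ : EF × EF → ℝ)
    (z : (EB × EF) × (EB × EF)) : ℝ :=
  1 / 2 * G z.1.1 z.2.1 z.2.1 + f z.1.1 ^ 2 * Λ (z.1.2, z.2.2)

/-- The spray of a warped product in coordinates. -/
def warpedSpray (G : EB → EB →L[ℝ] EB →L[ℝ] ℝ) (f : EB → ℝ) (Λ : EF × EF → ℝ) :
    (EB × EF) × (EB × EF) → EB × EF :=
  coupledSpray (metricSpray G) (fun b => (2 * f b) • localGradient G f b)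
    (fun b => (f b)⁻¹ • fderiv ℝ f b) Λ (spray Λ)

/-- Regularity of the data of a warped product at a point and a velocity. -/
structure WarpedRegular (G : EB → EB →L[ℝ] EB →L[ℝ] ℝ) (f : EB → ℝ) (Λ : EF × EF → ℝ)
    (z : (EB × EF) × (EB × EF)) : Prop where
  smooth_metric : SmoothNear G z.1.1
  symm_metric : ∀ᶠ b in 𝓝 z.1.1, ∀ X Y, G b X Y = G b Y X
  pos_metric : ∀ X, X ≠ 0 → 0 < G z.1.1 X X
  smooth_fun : SmoothNear f z.1.1
  pos_fun : 0 < f z.1.1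
  smooth_energy : SmoothNear Λ (z.1.2, z.2.2)
  pos_energy : ∀ y, y ≠ 0 → 0 < fiberHessian Λ (z.1.2, z.2.2) y y

variable {G : EB → EB →L[ℝ] EB →L[ℝ] ℝ} {f : EB → ℝ} {Λ : EF × EF → ℝ}
  {z : (EB × EF) × (EB × EF)}

lemma WarpedRegular.eventually [FiniteDimensional ℝ EB] [FiniteDimensional ℝ EF]
    (h : WarpedRegular G f Λ z) : ∀ᶠ z' in 𝓝 z, WarpedRegular G f Λ z' := by
  filter_upwards [eventually_basePoint h.smooth_metric.eventually,
    eventually_basePoint (eventually_eventually_nhds.2 h.symm_metric),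
    eventually_basePoint (eventually_pos h.smooth_metric.continuousAt h.pos_metric),
    eventually_basePoint h.smooth_fun.eventually,
    eventually_basePoint (h.smooth_fun.continuousAt.eventually (lt_mem_nhds h.pos_fun)),
    eventually_projFiber h.smooth_energy.eventually,
    eventually_projFiber (eventually_pos h.smooth_energy.fiberHessian.continuousAt h.pos_energy)]
    with z' a1 a2 a3 a4 a5 a6 a7
  exact ⟨a1, a2, a3, a4, a5, a6, a7⟩

lemma smoothNear_quadratic {q : EB × EB} (hG : SmoothNear G q.1) :
    SmoothNear (fun q : EB × EB => G q.1 q.2) q := hG.comp_fst.clm_apply SmoothNear.snd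

lemma WarpedRegular.smoothNear_warpedEnergy (h : WarpedRegular G f Λ z) :
    SmoothNear (warpedEnergy G f Λ) z := by
  have h1 : SmoothNear (fun q : EB × EB => G q.1 q.2 q.2) (z.1.1, z.2.1) :=
    (smoothNear_quadratic (q := (z.1.1, z.2.1)) h.smooth_metric).clm_apply SmoothNear.snd
  have h2 : SmoothNear (fun z' : (EB × EF) × (EB × EF) => f z'.1.1) z :=
    (SmoothNear.comp_fst (z := z.1) h.smooth_fun).comp_fst
  have h3 := ((SmoothNear.const (1 / 2 : ℝ)).mul h1.comp_projBase).add
    ((h2.mul h2).mul h.smooth_energy.comp_projFiber)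
  exact h3.congr (Eventually.of_forall fun z' => by simp [warpedEnergy, pow_two])

lemma fderiv_comp_basePoint {Y : Type*} [NormedAddCommGroup Y] [NormedSpace ℝ Y] {Q : EB → Y}
    (h : SmoothNear Q z.1.1) (a : (EB × EF) × (EB × EF)) :
    fderiv ℝ (fun z' : (EB × EF) × (EB × EF) => Q z'.1.1) z a = fderiv ℝ Q z.1.1 a.1.1 := by
  rw [fderiv_comp_fst (Q := fun q : EB × EF => Q q.1) (SmoothNear.comp_fst (z := z.1) h),
    fderiv_comp_fst h]

lemma SmoothNear.comp_basePoint {Y : Type*} [NormedAddCommGroup Y] [NormedSpace ℝ Y] {Q : EB → Y}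
    (h : SmoothNear Q z.1.1) : SmoothNear (fun z' : (EB × EF) × (EB × EF) => Q z'.1.1) z :=
  (SmoothNear.comp_fst (z := z.1) h).comp_fst

lemma WarpedRegular.fderiv_warpedEnergy (h : WarpedRegular G f Λ z)
    (a : (EB × EF) × (EB × EF)) :
    fderiv ℝ (warpedEnergy G f Λ) z a
      = 1 / 2 * fderiv ℝ G z.1.1 a.1.1 z.2.1 z.2.1 + G z.1.1 z.2.1 a.2.1
        + 2 * f z.1.1 * fderiv ℝ f z.1.1 a.1.1 * Λ (z.1.2, z.2.2)
        + f z.1.1 ^ 2 * fderiv ℝ Λ (z.1.2, z.2.2) (a.1.2, a.2.2) := by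
  have h1' : SmoothNear (fun q : EB × EB => G q.1 q.2) (z.1.1, z.2.1) :=
    smoothNear_quadratic (q := (z.1.1, z.2.1)) h.smooth_metric
  have h1 : SmoothNear (fun q : EB × EB => G q.1 q.2 q.2) (z.1.1, z.2.1) :=
    h1'.clm_apply SmoothNear.snd
  have h2 : SmoothNear (fun z' : (EB × EF) × (EB × EF) => f z'.1.1) z :=
    h.smooth_fun.comp_basePoint
  have hd := ((h1.comp_projBase (EF := EF) (z := z)).hasFDerivAt.const_mul (1 / 2)).add
    ((h2.hasFDerivAt.pow 2).mul (h.smooth_energy.comp_projFiber (EB := EB) (z := z)).hasFDerivAt)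
  change HasFDerivAt (warpedEnergy G f Λ) _ z at hd
  rw [hd.fderiv]
  simp only [_root_.add_apply, _root_.smul_apply, smul_eq_mul]
  rw [fderiv_comp_projBase h1, fderiv_comp_projFiber h.smooth_energy,
    fderiv_comp_basePoint h.smooth_fun,
    fderiv_clm_apply' h1'.differentiableAt differentiableAt_snd,
    fderiv_pairing (z := (z.1.1, z.2.1)) h.smooth_metric, fderiv_snd, _root_.add_apply]
  have hs := h.symm_metric.self_of_nhds a.2.1 z.2.1
  simp only [ContinuousLinearMap.coe_snd', hs]
  ring

lemma WarpedRegular.fiberDeriv_warpedEnergy (h : WarpedRegular G f Λ z) (Y : EB) (W : EF) :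
    fiberDeriv (warpedEnergy G f Λ) z (Y, W)
      = G z.1.1 z.2.1 Y + f z.1.1 ^ 2 * fiberDeriv Λ (z.1.2, z.2.2) W := by
  rw [fiberDeriv_apply, h.fderiv_warpedEnergy]
  simp [fiberDeriv_apply]

lemma WarpedRegular.fderiv_fiberDeriv_warpedEnergy [FiniteDimensional ℝ EB]
    [FiniteDimensional ℝ EF] (h : WarpedRegular G f Λ z)
    (a : (EB × EF) × (EB × EF)) (Y : EB) (W : EF) :
    fderiv ℝ (fiberDeriv (warpedEnergy G f Λ)) z a (Y, W)
      = fderiv ℝ G z.1.1 a.1.1 z.2.1 Y + G z.1.1 a.2.1 Y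
        + 2 * f z.1.1 * fderiv ℝ f z.1.1 a.1.1 * fiberDeriv Λ (z.1.2, z.2.2) W
        + f z.1.1 ^ 2 * fderiv ℝ (fiberDeriv Λ) (z.1.2, z.2.2) (a.1.2, a.2.2) W := by
  have h0 : (fun z' => fiberDeriv (warpedEnergy G f Λ) z' (Y, W)) =ᶠ[𝓝 z]
      fun z' => G z'.1.1 z'.2.1 Y + f z'.1.1 ^ 2 * fiberDeriv Λ (z'.1.2, z'.2.2) W :=
    h.eventually.mono fun z' hz' => hz'.fiberDeriv_warpedEnergy Y W
  have h1' : SmoothNear (fun q : EB × EB => G q.1 q.2) (z.1.1, z.2.1) :=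
    smoothNear_quadratic (q := (z.1.1, z.2.1)) h.smooth_metric
  have h1 : SmoothNear (fun q : EB × EB => G q.1 q.2 Y) (z.1.1, z.2.1) :=
    h1'.clm_apply (SmoothNear.const _)
  have h2 : SmoothNear (fun z' : (EB × EF) × (EB × EF) => f z'.1.1) z :=
    h.smooth_fun.comp_basePoint
  have h3 : SmoothNear (fun q => fiberDeriv Λ q W) (z.1.2, z.2.2) :=
    h.smooth_energy.fiberDeriv.clm_apply (SmoothNear.const _)
  have hd := (h1.comp_projBase (EF := EF) (z := z)).hasFDerivAt.add
    ((h2.hasFDerivAt.pow 2).mul (h3.comp_projFiber (EB := EB) (z := z)).hasFDerivAt)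
  change HasFDerivAt (fun z' : (EB × EF) × (EB × EF) => G z'.1.1 z'.2.1 Y
    + f z'.1.1 ^ 2 * fiberDeriv Λ (z'.1.2, z'.2.2) W) _ z at hd
  rw [← fderiv_clm_apply_const h.smoothNear_warpedEnergy.fiberDeriv.differentiableAt,
    h0.fderiv_eq, hd.fderiv]
  simp only [_root_.add_apply, _root_.smul_apply, smul_eq_mul]
  rw [fderiv_comp_projBase h1, fderiv_comp_projFiber h3, fderiv_comp_basePoint h.smooth_fun,
    fderiv_clm_apply_const h1'.differentiableAt,
    fderiv_clm_apply_const h.smooth_energy.fiberDeriv.differentiableAt,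
    fderiv_pairing (z := (z.1.1, z.2.1)) h.smooth_metric, _root_.add_apply]
  simp only
  ring

variable [FiniteDimensional ℝ EB] [FiniteDimensional ℝ EF]

lemma WarpedRegular.fiberHessian_warpedEnergy (h : WarpedRegular G f Λ z) (X Y : EB) (V W : EF) :
    fiberHessian (warpedEnergy G f Λ) z (X, V) (Y, W)
      = G z.1.1 X Y + f z.1.1 ^ 2 * fiberHessian Λ (z.1.2, z.2.2) V W := by
  rw [fiberHessian, fiberDeriv_apply, h.fderiv_fiberDeriv_warpedEnergy]
  simp [fiberHessian, fiberDeriv_apply]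

lemma WarpedRegular.pos_warpedEnergy (h : WarpedRegular G f Λ z) (y : EB × EF) (hy : y ≠ 0) :
    0 < fiberHessian (warpedEnergy G f Λ) z y y := by
  obtain ⟨X, V⟩ := y
  rw [h.fiberHessian_warpedEnergy]
  have hf := h.pos_fun
  by_cases hX : X = 0
  · subst hX
    have hV : V ≠ 0 := fun h0 => hy (by simp [h0])
    have := h.pos_energy V hV
    simp only [map_zero, zero_add]
    positivity
  · have h1 := h.pos_metric X hX
    have h2 : 0 ≤ fiberHessian Λ (z.1.2, z.2.2) V V := by
      by_cases hV : V = 0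
      · subst hV; simp
      · exact (h.pos_energy V hV).le
    positivity

/-- Since the Euler–Lagrange equation determines the acceleration, it suffices to test `warpedSpray`
in it. The fundamental tensor is block diagonal: the base derivative of `f² Λ` gives the force `2 f
Λ ∇f`, and differentiating the factor `f²` of the fibre momentum gives the friction, through Euler's
identity `he`. -/
lemma WarpedRegular.spray_warpedEnergy (h : WarpedRegular G f Λ z)
    (hh : IsFiberHomogeneous 2 Λ) :
    spray (warpedEnergy G f Λ) z = warpedSpray G f Λ z := by
  have hGi := isInvertible_of_pos h.pos_metric
  have hΛi := isInvertible_of_pos h.pos_energy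
  refine spray_eq_of_fiberHessian (isInvertible_of_pos h.pos_warpedEnergy) ?_
  refine ContinuousLinearMap.ext fun q => ?_
  obtain ⟨Y, W⟩ := q
  have hS := congrArg (fun A : EF →L[ℝ] ℝ => A W) (fiberHessian_spray hΛi)
  simp only [_root_.sub_apply, baseDeriv_apply] at hS
  have he : fiberHessian Λ (z.1.2, z.2.2) z.2.2 W = fiberDeriv Λ (z.1.2, z.2.2) W := by
    have := hh.fiberDeriv.euler (z := (z.1.2, z.2.2)) h.smooth_energy.fiberDeriv.differentiableAt
    have h2 := congrArg (fun A : EF →L[ℝ] ℝ => A W) this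
    simpa [fiberHessian, fiberDeriv_apply] using h2
  have hΓ : G z.1.1 (christoffel G z.1.1 z.2.1 z.2.1) Y
      = fderiv ℝ G z.1.1 z.2.1 z.2.1 Y - 1 / 2 * fderiv ℝ G z.1.1 Y z.2.1 z.2.1 := by
    rw [christoffel_apply, hGi.self_apply_inverse, christoffelFirst_apply]
    ring
  have hgrad : G z.1.1 (localGradient G f z.1.1) Y = fderiv ℝ f z.1.1 Y := by
    rw [localGradient, hGi.self_apply_inverse]
  rw [_root_.sub_apply, baseDeriv_apply, baseDeriv_apply, h.fderiv_warpedEnergy,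
    h.fderiv_fiberDeriv_warpedEnergy, show warpedSpray G f Λ z
      = ((warpedSpray G f Λ z).1, (warpedSpray G f Λ z).2) from rfl, h.fiberHessian_warpedEnergy]
  simp only [warpedSpray, coupledSpray, metricSpray, map_add, map_neg, map_smul, map_sub,
    _root_.add_apply, _root_.neg_apply, _root_.smul_apply, _root_.sub_apply, smul_eq_mul, hΓ,
    hgrad, hS, he]
  have hf := h.pos_fun.ne'
  field_simp
  simp only [Prod.fst_zero, Prod.snd_zero, map_zero, _root_.zero_apply]
  ring

end WarpedEnergy

/-! ### The Riemannian base: geodesic spray, its curvature, and the gradient. -/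

section MetricSpray

variable {E : Type*} [NormedAddCommGroup E] [NormedSpace ℝ E] [CompleteSpace E]
  {G : E → E →L[ℝ] E →L[ℝ] ℝ} {f : E → ℝ} {b : E}

lemma smoothNear_metricSpray (hG : SmoothNear G b) (hi : (G b).IsInvertible) (ξ : E) :
    SmoothNear (metricSpray G) (b, ξ) :=
  ((((SmoothNear.comp_fst (z := (b, ξ)) (smoothNear_christoffel hG hi)).clm_apply
    SmoothNear.snd).clm_apply SmoothNear.snd)).neg

lemma fderiv_metricSpray (hG : SmoothNear G b) (hi : (G b).IsInvertible)
    (hs : ∀ᶠ y in 𝓝 b, ∀ X Y, G y X Y = G y Y X) (ξ : E) (a : E × E) :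
    fderiv ℝ (metricSpray G) (b, ξ) a
      = -(fderiv ℝ (christoffel G) b a.1 ξ ξ) - (2 : ℝ) • christoffel G b ξ a.2 := by
  have hΓ := smoothNear_christoffel hG hi
  have h1 : SmoothNear (fun q : E × E => christoffel G q.1 q.2) (b, ξ) :=
    (SmoothNear.comp_fst (z := (b, ξ)) hΓ).clm_apply SmoothNear.snd
  have h2 : fderiv ℝ (metricSpray G) (b, ξ) a
      = -fderiv ℝ (fun q : E × E => christoffel G q.1 q.2 q.2) (b, ξ) a := by
    change fderiv ℝ (fun q : E × E => -christoffel G q.1 q.2 q.2) (b, ξ) a = _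
    rw [fderiv_fun_neg]
    rfl
  rw [h2, fderiv_clm_apply' h1.differentiableAt differentiableAt_snd,
    fderiv_pairing (z := (b, ξ)) hΓ, fderiv_snd, _root_.add_apply,
    christoffel_symm hG.differentiableAt hs a.2 ξ]
  simp only [ContinuousLinearMap.coe_snd']
  module

lemma fiberDeriv_metricSpray (hG : SmoothNear G b) (hi : (G b).IsInvertible)
    (hs : ∀ᶠ y in 𝓝 b, ∀ X Y, G y X Y = G y Y X) (ξ : E) :
    fiberDeriv (metricSpray G) (b, ξ) = -((2 : ℝ) • christoffel G b ξ) := by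
  ext X
  rw [fiberDeriv_apply, fderiv_metricSpray hG hi hs]
  simp

lemma fderiv_fiberDeriv_metricSpray (hG : SmoothNear G b) (hi : (G b).IsInvertible)
    (hs : ∀ᶠ y in 𝓝 b, ∀ X Y, G y X Y = G y Y X) (ξ : E) (a : E × E) :
    fderiv ℝ (fiberDeriv (metricSpray G)) (b, ξ) a
      = -((2 : ℝ) • (fderiv ℝ (christoffel G) b a.1 ξ + christoffel G b a.2)) := by
  have hΓ := smoothNear_christoffel hG hi
  have h1 : SmoothNear (fun q : E × E => christoffel G q.1 q.2) (b, ξ) :=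
    (SmoothNear.comp_fst (z := (b, ξ)) hΓ).clm_apply SmoothNear.snd
  have h0 : fiberDeriv (metricSpray G) =ᶠ[𝓝 (b, ξ)]
      fun q => -((2 : ℝ) • christoffel G q.1 q.2) := by
    have hc : Tendsto (Prod.fst : E × E → E) (𝓝 (b, ξ)) (𝓝 b) := continuous_fst.tendsto _
    filter_upwards [hc.eventually hG.eventually, hc.eventually (eventually_eventually_nhds.2 hs),
      hc.eventually (SmoothNear.eventually_isInvertible hG.continuousAt hi)] with q a1 a2 a3
    exact fiberDeriv_metricSpray a1 a3 a2 q.2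
  rw [h0.fderiv_eq, fderiv_fun_neg, fderiv_fun_const_smul h1.differentiableAt, _root_.neg_apply,
    _root_.smul_apply, fderiv_pairing (z := (b, ξ)) hΓ]

/-- The curvature of the geodesic spray of a Riemannian metric. -/
lemma sprayCurvature_metricSpray (hG : SmoothNear G b) (hi : (G b).IsInvertible)
    (hs : ∀ᶠ y in 𝓝 b, ∀ X Y, G y X Y = G y Y X) (ξ : E) :
    sprayCurvature (metricSpray G) (b, ξ) = curvatureEndo G b ξ ξ := by
  ext X
  have hsy := christoffel_symm hG.differentiableAt hs
  have hdsy := fderiv_christoffel_symm hG hi hs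
  rw [curvatureEndo_apply, sprayCurvature, sprayDeriv, fderiv_fiberDeriv_metricSpray hG hi hs,
    fiberDeriv_metricSpray hG hi hs]
  simp only [_root_.add_apply, _root_.sub_apply, _root_.neg_apply, _root_.smul_apply,
    ContinuousLinearMap.comp_apply, baseDeriv_apply, fderiv_metricSpray hG hi hs, map_zero,
    map_neg, map_smul]
  rw [hdsy ξ X ξ, hsy X (christoffel G b ξ ξ), hsy X ξ, metricSpray, map_neg, _root_.neg_apply]
  module

lemma smoothNear_localGradient (hG : SmoothNear G b) (hi : (G b).IsInvertible)
    (hf : SmoothNear f b) : SmoothNear (localGradient G f) b :=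
  (hG.clm_inverse hi).clm_apply hf.fderiv

/-- The covariant derivative of the gradient is the Hessian. -/
lemma fderiv_localGradient (hG : SmoothNear G b) (hi : (G b).IsInvertible)
    (hs : ∀ᶠ y in 𝓝 b, ∀ X Y, G y X Y = G y Y X) (hf : SmoothNear f b) (X : E) :
    fderiv ℝ (localGradient G f) b X + christoffel G b (localGradient G f b) X
      = (G b).inverse (localHessian G f b X) := by
  have hg := smoothNear_localGradient hG hi hf
  -- Differentiating `G ∇f = df` rather than `∇f = G⁻¹ df` avoids the derivative of the inverse
  -- metric.
  have h0 : (fun y => G y (localGradient G f y)) =ᶠ[𝓝 b] fderiv ℝ f := by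
    filter_upwards [SmoothNear.eventually_isInvertible hG.continuousAt hi] with y hy
    exact hy.self_apply_inverse _
  have h1 := congrArg (fun A : E →L[ℝ] E →L[ℝ] ℝ => A X) h0.fderiv_eq
  rw [fderiv_clm_apply' hG.differentiableAt hg.differentiableAt] at h1
  suffices h : localHessian G f b X = G b (fderiv ℝ (localGradient G f) b X
      + christoffel G b (localGradient G f b) X) by rw [h, hi.inverse_apply_self]
  ext Z
  have h2 : fderiv ℝ f b (christoffel G b X Z)
      = G b (christoffel G b X Z) (localGradient G f b) := by
    rw [hs.self_of_nhds]
    exact (congrArg (fun A : E →L[ℝ] ℝ => A (christoffel G b X Z)) h0.self_of_nhds).symm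
  have h3 := congrArg (fun A : E →L[ℝ] ℝ => A Z) h1
  have hsd : ∀ A X Y : E, fderiv ℝ G b A X Y = fderiv ℝ G b A Y X := by
    intro A X Y
    have h1 : (fun y => G y X Y) =ᶠ[𝓝 b] fun y => G y Y X := hs.mono fun y hy => hy X Y
    have h3 : ∀ X Y : E, fderiv ℝ (fun y => G y X Y) b A = fderiv ℝ G b A X Y := by
      intro X Y
      rw [fderiv_clm_apply_const (A := fun y => G y X)
        (hG.clm_apply (SmoothNear.const X)).differentiableAt,
        fderiv_clm_apply_const hG.differentiableAt]
    rw [← h3, ← h3, h1.fderiv_eq]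
  rw [localHessian_apply, h2, map_add, _root_.add_apply, christoffel_apply, christoffel_apply,
    hi.self_apply_inverse, hi.self_apply_inverse, christoffelFirst_apply, christoffelFirst_apply]
  simp only [_root_.add_apply] at h3
  rw [← h3]
  linarith [hsd X Z (localGradient G f b), hsd Z X (localGradient G f b)]

lemma localGradSq_eq : localGradSq G f b = fderiv ℝ f b (localGradient G f b) := rfl

end MetricSpray

/-! ### Ricci curvature and weight derivatives of the warped product spray. -/

section WarpedRicci

variable {EB : Type*} [NormedAddCommGroup EB] [NormedSpace ℝ EB] [FiniteDimensional ℝ EB]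
  {EF : Type*} [NormedAddCommGroup EF] [NormedSpace ℝ EF] [FiniteDimensional ℝ EF]

/-- The Ricci curvature of a spray. -/
def sprayRicci {E : Type*} [NormedAddCommGroup E] [NormedSpace ℝ E] (S : E × E → E) (z : E × E) :
    ℝ :=
  LinearMap.trace ℝ E (sprayCurvature S z : E →ₗ[ℝ] E)

variable {G : EB → EB →L[ℝ] EB →L[ℝ] ℝ} {f : EB → ℝ} {Λ : EF × EF → ℝ}
  {z : (EB × EF) × (EB × EF)}

/-- The logarithmic derivative of `f`, in the direction of the Riemannian spray. -/
lemma WarpedRegular.fderiv_logDeriv (h : WarpedRegular G f Λ z) (X Y : EB) :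
    fderiv ℝ (fun b => (f b)⁻¹ • fderiv ℝ f b) z.1.1 X Y
      = fderiv ℝ (fderiv ℝ f) z.1.1 X Y / f z.1.1
        - fderiv ℝ f z.1.1 X * fderiv ℝ f z.1.1 Y / f z.1.1 ^ 2 := by
  have hf := h.smooth_fun
  have h0 := h.pos_fun.ne'
  have h1 : HasFDerivAt (fun b => (f b)⁻¹ • fderiv ℝ f b) _ z.1.1 :=
    ((hasDerivAt_inv h0).comp_hasFDerivAt _ hf.hasFDerivAt).smul hf.fderiv.hasFDerivAt
  rw [h1.fderiv]
  simp only [_root_.add_apply, _root_.smul_apply, ContinuousLinearMap.smulRight_apply,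
    smul_eq_mul, Function.comp_apply]
  field_simp
  ring

lemma WarpedRegular.smoothNear_logDeriv (h : WarpedRegular G f Λ z) :
    SmoothNear (fun b => (f b)⁻¹ • fderiv ℝ f b) z.1.1 :=
  (h.smooth_fun.inv h.pos_fun.ne').smul h.smooth_fun.fderiv

/-- The Ricci curvature of the spray of a warped product. -/
theorem WarpedRegular.sprayRicci_warpedSpray (h : WarpedRegular G f Λ z)
    (hh : IsFiberHomogeneous 2 Λ) :
    sprayRicci (warpedSpray G f Λ) z
      = localRicci G z.1.1 z.2.1 z.2.1 + sprayRicci (spray Λ) (z.1.2, z.2.2)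
        - finrank ℝ EF * (localHessian G f z.1.1 z.2.1 z.2.1 / f z.1.1)
        - 2 * Λ (z.1.2, z.2.2) * (f z.1.1 * localLaplacian G f z.1.1
          + (finrank ℝ EF - 1) * localGradSq G f z.1.1) := by
  have hGi := isInvertible_of_pos h.pos_metric
  have hΛi := isInvertible_of_pos h.pos_energy
  have hf0 := h.pos_fun.ne'
  have hSB := smoothNear_metricSpray h.smooth_metric hGi z.2.1
  have hg := smoothNear_localGradient h.smooth_metric hGi h.smooth_fun
  have hH : SmoothNear (fun b => (2 * f b) • localGradient G f b) z.1.1 :=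
    ((SmoothNear.const 2).mul h.smooth_fun).smul hg
  have hμ := h.smoothNear_logDeriv
  have hSF : SmoothNear (spray Λ) (z.1.2, z.2.2) := h.smooth_energy.spray hΛi
  have heuler : fiberDeriv Λ (z.1.2, z.2.2) z.2.2 = 2 * Λ (z.1.2, z.2.2) := by
    have := hh.euler (z := (z.1.2, z.2.2)) h.smooth_energy.differentiableAt
    simpa [fiberDeriv_apply] using this
  have hHd : ∀ X, fderiv ℝ (fun b => (2 * f b) • localGradient G f b) z.1.1 X
      = (2 * fderiv ℝ f z.1.1 X) • localGradient G f z.1.1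
        + (2 * f z.1.1) • fderiv ℝ (localGradient G f) z.1.1 X := by
    intro X
    have h1 : HasFDerivAt (fun b => (2 * f b) • localGradient G f b) _ z.1.1 :=
      (h.smooth_fun.hasFDerivAt.const_mul 2).smul hg.hasFDerivAt
    rw [h1.fderiv]
    simp only [_root_.add_apply, _root_.smul_apply, ContinuousLinearMap.smulRight_apply,
      smul_eq_mul]
    abel
  set lam := Λ (z.1.2, z.2.2) with hlam
  set grad := localGradient G f z.1.1 with hgrad
  set df := fderiv ℝ f z.1.1 with hdf
  have hgs : df grad = localGradSq G f z.1.1 := rfl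
  -- the diagonal blocks
  have hB : (ContinuousLinearMap.fst ℝ EB EF).comp ((sprayCurvature (warpedSpray G f Λ) z).comp
      (ContinuousLinearMap.inl ℝ EB EF)) = curvatureEndo G z.1.1 z.2.1 z.2.1
        - (2 * f z.1.1 * lam) • (G z.1.1).inverse.comp (localHessian G f z.1.1) := by
    ext X
    have h1 := sprayCurvature_coupledSpray_base hSB hH hμ h.smooth_energy hSF X
    change (sprayCurvature (warpedSpray G f Λ) z (X, 0)).1 = _
    rw [warpedSpray, h1, hHd, heuler, fderiv_fiberDeriv_metricSpray h.smooth_metric hGi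
      h.symm_metric, sprayCurvature_metricSpray h.smooth_metric hGi h.symm_metric]
    simp only [_root_.sub_apply, _root_.smul_apply, ContinuousLinearMap.comp_apply, map_zero,
      _root_.neg_apply, zero_add, map_smul, smul_eq_mul, _root_.zero_apply]
    -- With `H = 2 f ∇f` and `μ = df / f`, the rank-one term `½ μ(X) · 2Λ · H` cancels the part of
    -- the derivative of `H` that differentiates the factor `f`. The rest is the covariant
    -- derivative of `∇f`, that is, the Hessian.
    rw [← fderiv_localGradient h.smooth_metric hGi h.symm_metric h.smooth_fun]
    match_scalars <;> field_simp <;> ring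
  -- The scalar part carries `∇²f(ξ,ξ)/f` because the `μ²` of the curvature compensates the `-μ²` in
  -- the derivative of `df / f`. The rank-one part has trace `2Λ |∇f|²`, which turns the factor `n`
  -- of `|∇f|²` into `n - 1`.
  have hF : (ContinuousLinearMap.snd ℝ EB EF).comp ((sprayCurvature (warpedSpray G f Λ) z).comp
      (ContinuousLinearMap.inr ℝ EB EF)) = sprayCurvature (spray Λ) (z.1.2, z.2.2)
        - (localHessian G f z.1.1 z.2.1 z.2.1 / f z.1.1
            + 2 * lam * localGradSq G f z.1.1) • ContinuousLinearMap.id ℝ EF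
        + localGradSq G f z.1.1 • (fiberDeriv Λ (z.1.2, z.2.2)).smulRight z.2.2 := by
    ext W
    have h1 := sprayCurvature_coupledSpray_fiber hSB hH hμ h.smooth_energy hSF hh.spray W
    change (sprayCurvature (warpedSpray G f Λ) z (0, W)).2 = _
    rw [warpedSpray, h1, h.fderiv_logDeriv]
    simp only [_root_.sub_apply, _root_.add_apply, _root_.smul_apply, map_smul, smul_eq_mul,
      metricSpray, map_neg, ← hgrad, ← hdf, hgs, ContinuousLinearMap.id_apply,
      ContinuousLinearMap.smulRight_apply, localHessian_apply, ← hlam]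
    match_scalars <;> field_simp
    ring
  rw [sprayRicci, trace_prod, hB, hF]
  have t1 : LinearMap.trace ℝ EB ((curvatureEndo G z.1.1 z.2.1 z.2.1
        - (2 * f z.1.1 * lam) • (G z.1.1).inverse.comp (localHessian G f z.1.1) :
          EB →L[ℝ] EB) : EB →ₗ[ℝ] EB)
      = localRicci G z.1.1 z.2.1 z.2.1 - 2 * f z.1.1 * lam * localLaplacian G f z.1.1 := by
    rw [ContinuousLinearMap.toLinearMap_sub, map_sub, ContinuousLinearMap.toLinearMap_smul, map_smul]
    rfl
  have t2 : LinearMap.trace ℝ EF ((sprayCurvature (spray Λ) (z.1.2, z.2.2)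
        - (localHessian G f z.1.1 z.2.1 z.2.1 / f z.1.1
            + 2 * lam * localGradSq G f z.1.1) • ContinuousLinearMap.id ℝ EF
        + localGradSq G f z.1.1 • (fiberDeriv Λ (z.1.2, z.2.2)).smulRight z.2.2 :
          EF →L[ℝ] EF) : EF →ₗ[ℝ] EF)
      = sprayRicci (spray Λ) (z.1.2, z.2.2)
        - (localHessian G f z.1.1 z.2.1 z.2.1 / f z.1.1
            + 2 * lam * localGradSq G f z.1.1) * finrank ℝ EF
        + localGradSq G f z.1.1 * (2 * lam) := by
    rw [ContinuousLinearMap.toLinearMap_add, ContinuousLinearMap.toLinearMap_sub, map_add, map_sub,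
      ContinuousLinearMap.toLinearMap_smul, ContinuousLinearMap.toLinearMap_smul, map_smul, map_smul,
      show ((ContinuousLinearMap.id ℝ EF : EF →L[ℝ] EF) : EF →ₗ[ℝ] EF) = LinearMap.id from rfl,
      LinearMap.trace_id, show (((fiberDeriv Λ (z.1.2, z.2.2)).smulRight z.2.2 : EF →L[ℝ] EF) :
        EF →ₗ[ℝ] EF) = ((fiberDeriv Λ (z.1.2, z.2.2)) : EF →ₗ[ℝ] ℝ).smulRight z.2.2 from rfl,
      LinearMap.trace_smulRight]
    change sprayRicci _ _ - _ • _ + _ • fiberDeriv Λ (z.1.2, z.2.2) z.2.2 = _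
    rw [heuler, smul_eq_mul, smul_eq_mul]
  rw [t1, t2]
  ring

/-- The derivative of the weight of a warped product along the spray. -/
theorem WarpedRegular.sprayDeriv_warpedSpray (h : WarpedRegular G f Λ z)
    {τ : EF × EF → ℝ} (hτh : IsFiberHomogeneous 0 τ) (hτ : SmoothNear τ (z.1.2, z.2.2))
    (k c : ℝ) :
    sprayDeriv (warpedSpray G f Λ) (fun z' : (EB × EF) × (EB × EF) =>
        τ (z'.1.2, z'.2.2) + k * Real.log (f z'.1.1) + c) z
      = sprayDeriv (spray Λ) τ (z.1.2, z.2.2)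
        + k * ((f z.1.1)⁻¹ • fderiv ℝ f z.1.1) z.2.1 := by
  have hl : SmoothNear (fun b => Real.log (f b)) z.1.1 := h.smooth_fun.log h.pos_fun.ne'
  have hd : HasFDerivAt (fun z' : (EB × EF) × (EB × EF) =>
      τ (z'.1.2, z'.2.2) + k * Real.log (f z'.1.1) + c) _ z :=
    ((hτ.comp_projFiber (EB := EB) (z := z)).hasFDerivAt.add
      ((hl.comp_basePoint (EF := EF) (z := z)).hasFDerivAt.const_mul k)).add_const c
  rw [sprayDeriv, hd.fderiv, _root_.add_apply, _root_.smul_apply,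
    fderiv_comp_basePoint hl, (h.smooth_fun.hasFDerivAt.log h.pos_fun.ne').fderiv]
  -- `τ` has degree zero, so the friction of the fibre does not act on it.
  have h1 := sprayDeriv_coupledSpray_fiber (z := z) (SB := metricSpray G)
    (H := fun b => (2 * f b) • localGradient G f b)
    (μ := fun b => (f b)⁻¹ • fderiv ℝ f b) (Λ := Λ) (SF := spray Λ) hτh hτ
  rw [Nat.cast_zero, mul_zero, zero_mul, zero_mul, sub_zero] at h1
  rw [← h1, smul_eq_mul]
  rfl

/-- After one differentiation the fibre term has degree one, so the friction now acts on it and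
produces the product of `df(ξ)/f` with the first derivative of `τ`. This is the term that the square
in the `N`-Ricci curvature has to absorb. -/
theorem WarpedRegular.sprayDeriv_sprayDeriv_warpedSpray (h : WarpedRegular G f Λ z)
    (hh : IsFiberHomogeneous 2 Λ)
    {τ : EF × EF → ℝ} (hτh : IsFiberHomogeneous 0 τ) (hτ : SmoothNear τ (z.1.2, z.2.2))
    (k c : ℝ) :
    sprayDeriv (warpedSpray G f Λ) (sprayDeriv (warpedSpray G f Λ)
        (fun z' : (EB × EF) × (EB × EF) => τ (z'.1.2, z'.2.2) + k * Real.log (f z'.1.1) + c)) z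
      = sprayDeriv (spray Λ) (sprayDeriv (spray Λ) τ) (z.1.2, z.2.2)
        - 2 * (fderiv ℝ f z.1.1 z.2.1 / f z.1.1) * sprayDeriv (spray Λ) τ (z.1.2, z.2.2)
        + k * (localHessian G f z.1.1 z.2.1 z.2.1 / f z.1.1
          - (fderiv ℝ f z.1.1 z.2.1 / f z.1.1) ^ 2
          + 2 * Λ (z.1.2, z.2.2) * localGradSq G f z.1.1) := by
  have hΛi := isInvertible_of_pos h.pos_energy
  have hSF : SmoothNear (spray Λ) (z.1.2, z.2.2) := h.smooth_energy.spray hΛi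
  have hσ := hSF.sprayDeriv hτ
  have hσh : IsFiberHomogeneous 1 (sprayDeriv (spray Λ) τ) := hh.spray.sprayDeriv hτh
  have h0 : sprayDeriv (warpedSpray G f Λ)
        (fun z' : (EB × EF) × (EB × EF) => τ (z'.1.2, z'.2.2) + k * Real.log (f z'.1.1) + c)
      =ᶠ[𝓝 z] fun z' => sprayDeriv (spray Λ) τ (z'.1.2, z'.2.2)
        + k * ((f z'.1.1)⁻¹ • fderiv ℝ f z'.1.1) z'.2.1 := by
    filter_upwards [h.eventually, eventually_projFiber hτ.eventually] with z' a1 a2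
    exact a1.sprayDeriv_warpedSpray hτh a2 k c
  have hμ := h.smoothNear_logDeriv
  have hμ' : SmoothNear (fun q : EB × EB => ((f q.1)⁻¹ • fderiv ℝ f q.1) q.2) (z.1.1, z.2.1) :=
    (SmoothNear.comp_fst (z := (z.1.1, z.2.1)) hμ).clm_apply SmoothNear.snd
  have hd : HasFDerivAt (fun z' : (EB × EF) × (EB × EF) =>
      sprayDeriv (spray Λ) τ (z'.1.2, z'.2.2)
        + k * ((f z'.1.1)⁻¹ • fderiv ℝ f z'.1.1) z'.2.1) _ z :=
    (hσ.comp_projFiber (EB := EB) (z := z)).hasFDerivAt.add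
      ((hμ'.comp_projBase (EF := EF) (z := z)).hasFDerivAt.const_mul k)
  rw [sprayDeriv, h0.fderiv_eq, hd.fderiv, _root_.add_apply, _root_.smul_apply]
  have h1 := sprayDeriv_coupledSpray_fiber (z := z) (SB := metricSpray G)
    (H := fun b => (2 * f b) • localGradient G f b)
    (μ := fun b => (f b)⁻¹ • fderiv ℝ f b) (Λ := Λ) (SF := spray Λ) hσh hσ
  have h2 := sprayDeriv_coupledSpray_base (z := z) (SB := metricSpray G)
    (H := fun b => (2 * f b) • localGradient G f b)
    (μ := fun b => (f b)⁻¹ • fderiv ℝ f b) (Λ := Λ) (SF := spray Λ) hμ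
  rw [sprayDeriv] at h1 h2
  change fderiv ℝ _ z (z.2, warpedSpray G f Λ z) = _ at h1
  change fderiv ℝ _ z (z.2, warpedSpray G f Λ z) = _ at h2
  rw [h1, h2, h.fderiv_logDeriv]
  have hf0 := h.pos_fun.ne'
  simp only [_root_.smul_apply, map_smul, smul_eq_mul, metricSpray, map_neg, localGradSq_eq,
    localHessian_apply]
  field_simp
  ring

end WarpedRicci

/-! ### The Euler-Lagrange equation for fields -/

section EulerLagrange

variable {E : Type*} [NormedAddCommGroup E] [NormedSpace ℝ E]

/-- The Euler-Lagrange equation of `Λ` at `u` for the integral curves of the field `V`. -/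
def IsEulerField (Λ : E × E → ℝ) (V : E → E) (u : E) : Prop :=
  fderiv ℝ (fun y => fiberDeriv Λ (y, V y)) u (V u) = baseDeriv Λ (u, V u)

variable {Λ Λ' : E × E → ℝ} {V V' : E → E} {u : E}

/-- The chain rule splits the derivative of the momentum along `V` into a base part and the
fundamental tensor applied to the acceleration. The Euler–Lagrange form is kept because it
transforms as a covector under coordinate changes, which the spray does not. -/
lemma isEulerField_iff (hΛ : SmoothNear Λ (u, V u)) (hV : SmoothNear V u)
    (hi : (fiberHessian Λ (u, V u)).IsInvertible) :
    IsEulerField Λ V u ↔ fderiv ℝ V u (V u) = spray Λ (u, V u) := by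
  have h1 : fderiv ℝ (fun y => fiberDeriv Λ (y, V y)) u (V u)
      = baseDeriv (fiberDeriv Λ) (u, V u) (V u)
        + fiberHessian Λ (u, V u) (fderiv ℝ V u (V u)) := by
    rw [fderiv_comp_graph hΛ.fiberDeriv.differentiableAt hV.differentiableAt, fderiv_prod_eq]
    rfl
  rw [IsEulerField, h1]
  constructor
  · intro h
    refine (spray_eq_of_fiberHessian hi ?_).symm
    rw [← h]
    simp
  · intro h
    rw [h, fiberHessian_spray hi]
    simp

lemma fderiv_coordChange {φ : E → E} {y : E} (hφ : SmoothNear φ u)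
    (hΛ : SmoothNear Λ (φ u, fderiv ℝ φ u y))
    (h : ∀ᶠ u' in 𝓝 u, ∀ y, Λ' (u', y) = Λ (φ u', fderiv ℝ φ u' y)) (a : E × E) :
    fderiv ℝ Λ' (u, y) a = fderiv ℝ Λ (φ u, fderiv ℝ φ u y)
      (fderiv ℝ φ u a.1, fderiv ℝ (fderiv ℝ φ) u a.1 y + fderiv ℝ φ u a.2) := by
  have h0 : Λ' =ᶠ[𝓝 (u, y)] fun z => Λ (φ z.1, fderiv ℝ φ z.1 z.2) := by
    have hc : Tendsto (Prod.fst : E × E → E) (𝓝 (u, y)) (𝓝 u) := continuous_fst.tendsto _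
    filter_upwards [hc.eventually h] with z hz
    exact hz z.2
  have h1 : HasFDerivAt (fun z : E × E => φ z.1) _ (u, y) :=
    (SmoothNear.comp_fst (z := (u, y)) hφ).hasFDerivAt
  have h2 : HasFDerivAt (fun z : E × E => fderiv ℝ φ z.1 z.2) _ (u, y) :=
    ((SmoothNear.comp_fst (z := (u, y)) hφ.fderiv).clm_apply SmoothNear.snd).hasFDerivAt
  have h3 : HasFDerivAt Λ (fderiv ℝ Λ (φ u, fderiv ℝ φ u y))
    ((fun z : E × E => (φ z.1, fderiv ℝ φ z.1 z.2)) (u, y)) := hΛ.hasFDerivAt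
  have h4 := h3.comp (u, y) (h1.prodMk h2)
  rw [h0.fderiv_eq]
  change HasFDerivAt (fun z : E × E => Λ (φ z.1, fderiv ℝ φ z.1 z.2)) _ _ at h4
  rw [h4.fderiv, ContinuousLinearMap.comp_apply, ContinuousLinearMap.prod_apply,
    fderiv_comp_fst (z := (u, y)) hφ, fderiv_pairing (z := (u, y)) hφ.fderiv]

/-- The Euler-Lagrange equation does not depend on the coordinates. -/
lemma IsEulerField.coordChange {φ : E → E} (hφ : SmoothNear φ u)
    (hΛ : SmoothNear Λ (φ u, V (φ u))) (hV : SmoothNear V (φ u))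
    (h : ∀ᶠ u' in 𝓝 u, ∀ y, Λ' (u', y) = Λ (φ u', fderiv ℝ φ u' y))
    (hVV' : ∀ᶠ u' in 𝓝 u, V (φ u') = fderiv ℝ φ u' (V' u'))
    (heul : IsEulerField Λ V (φ u)) : IsEulerField Λ' V' u := by
  have hVu := hVV'.self_of_nhds
  have hθ : SmoothNear (fun y => fiberDeriv Λ (y, V y)) (φ u) :=
    SmoothNear.comp (g := fiberDeriv Λ) hΛ.fiberDeriv (SmoothNear.id.prodMk hV)
  have hθφ : SmoothNear (fun y => fiberDeriv Λ (φ y, V (φ y))) u :=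
    SmoothNear.comp (g := fun y => fiberDeriv Λ (y, V y)) hθ hφ
  -- Momenta are covectors: they are pulled back by the differential of `φ`.
  have h0 : (fun y => fiberDeriv Λ' (y, V' y)) =ᶠ[𝓝 u]
      fun y => (fiberDeriv Λ (φ y, V (φ y))).comp (fderiv ℝ φ y) := by
    filter_upwards [hφ.eventually, eventually_eventually_nhds.2 h, hVV',
      hφ.continuousAt.eventually (eventually_field hV hΛ.eventually)] with y a1 a2 a3 a4
    ext ν
    rw [a3] at a4
    rw [fiberDeriv_apply, fderiv_coordChange a1 a4 a2, ContinuousLinearMap.comp_apply,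
      fiberDeriv_apply, a3]
    simp
  have hφd : SmoothNear (fderiv ℝ φ) u := hφ.fderiv
  have h1 : HasFDerivAt (fun y => (fiberDeriv Λ (φ y, V (φ y))).comp (fderiv ℝ φ y)) _ u :=
    hθφ.hasFDerivAt.clm_comp hφd.hasFDerivAt
  have h2 : fderiv ℝ (fun y => fiberDeriv Λ (φ y, V (φ y))) u (V' u)
      = baseDeriv Λ (φ u, V (φ u)) := by
    have h3 := (hθ.hasFDerivAt.comp u hφ.hasFDerivAt).fderiv
    change fderiv ℝ (fun y => fiberDeriv Λ (φ y, V (φ y))) u = _ at h3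
    rw [h3, ContinuousLinearMap.comp_apply, ← hVu]
    exact heul
  rw [IsEulerField, h0.fderiv_eq, h1.fderiv]
  ext ν
  rw [hVu] at hΛ
  rw [baseDeriv_apply, fderiv_coordChange hφ hΛ h]
  simp only [_root_.add_apply, ContinuousLinearMap.comp_apply, ContinuousLinearMap.compL_apply,
    ContinuousLinearMap.flip_apply, h2, map_zero, add_zero]
  -- The second derivative of `φ` occurs on both sides with its two arguments exchanged; its
  -- symmetry makes the equation coordinate independent.
  rw [hVu, fderiv_prod_eq, hφ.fderiv_fderiv_symm, add_comm]
  rfl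

end EulerLagrange

/-! ### Charts -/

section Charts

variable {E : Type*} [NormedAddCommGroup E] [NormedSpace ℝ E]
  {H : Type*} [TopologicalSpace H] (I : ModelWithCorners ℝ E H) [I.Boundaryless]
  {M : Type*} [TopologicalSpace M] [ChartedSpace H M] [IsManifold I ∞ M]

/-- The coordinate change from the chart at `p` to the chart at `q`. -/
def transition (p q : M) (u : E) : E := extChartAt I q ((extChartAt I p).symm u)

variable {I}

lemma frame_eq_mfderivWithin (p : M) (u : E) :
    frame I p u = mfderivWithin 𝓘(ℝ, E) I (extChartAt I p).symm (range I) u := by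
  rw [I.range_eq_univ, mfderivWithin_univ]
  rfl

lemma frame_isInvertible {p : M} {u : E} (hu : u ∈ (extChartAt I p).target) :
    (frame I p u).IsInvertible := by
  rw [frame_eq_mfderivWithin]
  exact isInvertible_mfderivWithin_extChartAt_symm hu

lemma frame_center (p : M) : frame I p (extChartAt I p p) = ContinuousLinearMap.id ℝ E := by
  rw [frame_eq_mfderivWithin]
  exact mfderivWithin_range_extChartAt_symm

lemma mdifferentiableAt_chart_symm {p : M} {u : E} (hu : u ∈ (extChartAt I p).target) :
    MDifferentiableAt 𝓘(ℝ, E) I (extChartAt I p).symm u := by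
  have h := mdifferentiableWithinAt_extChartAt_symm (I := I) hu
  rwa [I.range_eq_univ, mdifferentiableWithinAt_univ] at h

lemma eventually_mem_target {p : M} {u : E} (hu : u ∈ (extChartAt I p).target) :
    ∀ᶠ u' in 𝓝 u, u' ∈ (extChartAt I p).target := extChartAt_target_mem_nhds' hu

lemma continuousAt_chart_symm {p : M} {u : E} (hu : u ∈ (extChartAt I p).target) :
    ContinuousAt (extChartAt I p).symm u := (mdifferentiableAt_chart_symm hu).continuousAt

lemma contMDiffAt_chart_symm {p : M} {u : E} (hu : u ∈ (extChartAt I p).target) :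
    ContMDiffAt 𝓘(ℝ, E) I ∞ (extChartAt I p).symm u :=
  (contMDiffOn_extChartAt_symm p).contMDiffAt (extChartAt_target_mem_nhds' hu)

lemma eventually_mem_source {p q : M} {u : E} (hu : u ∈ (extChartAt I p).target)
    (hq : (extChartAt I p).symm u ∈ (extChartAt I q).source) :
    ∀ᶠ u' in 𝓝 u, (extChartAt I p).symm u' ∈ (extChartAt I q).source :=
  (continuousAt_chart_symm hu).eventually ((isOpen_extChartAt_source q).mem_nhds hq)

lemma transition_mem {p q : M} {u : E}
    (hq : (extChartAt I p).symm u ∈ (extChartAt I q).source) :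
    transition I p q u ∈ (extChartAt I q).target := (extChartAt I q).map_source hq

lemma symm_transition {p q : M} {u : E}
    (hq : (extChartAt I p).symm u ∈ (extChartAt I q).source) :
    (extChartAt I q).symm (transition I p q u) = (extChartAt I p).symm u :=
  (extChartAt I q).left_inv hq

lemma smoothNear_transition {p q : M} {u : E} (hu : u ∈ (extChartAt I p).target)
    (hq : (extChartAt I p).symm u ∈ (extChartAt I q).source) :
    SmoothNear (transition I p q) u := by
  filter_upwards [eventually_mem_target hu, eventually_mem_source hu hq] with u' h1 h2
  rw [← contMDiffAt_iff_contDiffAt]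
  exact (contMDiffAt_extChartAt' (by rwa [← extChartAt_source I])).comp u'
    (contMDiffAt_chart_symm h1)

lemma frame_transition {p q : M} {u : E} (hu : u ∈ (extChartAt I p).target)
    (hq : (extChartAt I p).symm u ∈ (extChartAt I q).source) :
    frame I p u = (frame I q (transition I p q u)).comp (fderiv ℝ (transition I p q) u) := by
  have h1 : (extChartAt I p).symm =ᶠ[𝓝 u]
      (extChartAt I q).symm ∘ transition I p q := by
    filter_upwards [eventually_mem_source hu hq] with u' h2
    exact (symm_transition h2).symm
  have h2 : MDifferentiableAt 𝓘(ℝ, E) 𝓘(ℝ, E) (transition I p q) u :=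
    (smoothNear_transition hu hq).differentiableAt.mdifferentiableAt
  have h3 := mfderiv_comp u (mdifferentiableAt_chart_symm (transition_mem hq)) h2
  have h4 : mfderiv 𝓘(ℝ, E) I (extChartAt I p).symm u
    = mfderiv 𝓘(ℝ, E) I ((extChartAt I q).symm ∘ transition I p q) u := h1.mfderiv_eq
  rw [mfderiv_eq_fderiv] at h3
  exact h4.trans h3

end Charts

/-! ### Energies and vector fields in charts -/

section ChartFields

variable {E : Type*} [NormedAddCommGroup E] [NormedSpace ℝ E]
  {H : Type*} [TopologicalSpace H] {I : ModelWithCorners ℝ E H}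
  {M : Type*} [TopologicalSpace M] [ChartedSpace H M]

/-- The tangent vector at `x` given by an element of the model space. -/
def tangentVector (I : ModelWithCorners ℝ E H) (x : M) (w : E) : TangentBundle I M := ⟨x, w⟩

/-- The vector field `V` in the chart at `p`. -/
def coordField (I : ModelWithCorners ℝ E H) (p : M) (V : ∀ x : M, TangentSpace I x) (u : E) : E :=
  let w : E := V ((extChartAt I p).symm u)
  (frame I p u).inverse w

/-- The vector field on `M` with the given expression in the chart at `p`. -/
def fieldOfCoord (I : ModelWithCorners ℝ E H) (p : M) (V : E → E) (x : M) : TangentSpace I x :=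
  let w : E := frame I p (extChartAt I p x) (V (extChartAt I p x))
  w

/-- The energy in the chart at `p`, as a function of a point and a velocity. -/
def chartEnergy (I : ModelWithCorners ℝ E H) (𝓕 : ∀ x : M, TangentSpace I x → ℝ) (p : M)
    (z : E × E) : ℝ :=
  energyInChart I 𝓕 p z.1 z.2

/-- The Finsler function as a function on the tangent bundle. -/
def totalFun (𝓕 : ∀ x : M, TangentSpace I x → ℝ) (z : TangentBundle I M) : ℝ := 𝓕 z.1 z.2

variable [I.Boundaryless] [IsManifold I ∞ M]

/-- The differential of the chart at `p`. -/
def chartDifferential (I : ModelWithCorners ℝ E H) (p x : M) : E →L[ℝ] E :=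
  mfderiv I 𝓘(ℝ, E) (extChartAt I p) x

lemma chartDifferential_eq {p : M} {u : E} (hu : u ∈ (extChartAt I p).target) :
    chartDifferential I p ((extChartAt I p).symm u) = (frame I p u).inverse := by
  have h1 : (chartDifferential I p ((extChartAt I p).symm u)).comp (frame I p u)
      = ContinuousLinearMap.id ℝ E := by
    have := mfderiv_extChartAt_comp_mfderivWithin_extChartAt_symm (I := I) hu
    rw [← frame_eq_mfderivWithin] at this
    exact this
  have h2 := frame_isInvertible hu
  ext y
  have h3 := congrArg (fun A : E →L[ℝ] E => A ((frame I p u).inverse y)) h1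
  simp only [ContinuousLinearMap.comp_apply, ContinuousLinearMap.id_apply,
    h2.self_apply_inverse] at h3
  exact h3

lemma trivializationAt_snd {p x : M} (hx : x ∈ (extChartAt I p).source) (w : E) :
    (trivializationAt E (TangentSpace I) p (tangentVector I x w)).2
      = chartDifferential I p x w := by
  rw [extChartAt_source] at hx
  have h1 := TangentBundle.continuousLinearMapAt_trivializationAt (I := I) hx
  have h2 := congrFun
    ((trivializationAt E (TangentSpace I) p).continuousLinearMapAt_apply ℝ (b := x)) w
  have h3 := congrFun ((trivializationAt E (TangentSpace I) p).coe_linearMapAt_of_mem (R := ℝ)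
    (b := x) (by simpa using hx)) w
  exact (h3.symm.trans h2.symm).trans
    (congrArg (fun A : TangentSpace I x →L[ℝ] E => A w) h1)

lemma trivializationAt_snd_frame {p : M} {u : E} (hu : u ∈ (extChartAt I p).target) (w : E) :
    (trivializationAt E (TangentSpace I) p (tangentVector I ((extChartAt I p).symm u) w)).2
      = (frame I p u).inverse w := by
  rw [trivializationAt_snd ((extChartAt I p).map_target hu), ← chartDifferential_eq hu]

lemma tangentVector_mem_source {p x : M} (hx : x ∈ (extChartAt I p).source) (w : E) :
    tangentVector I x w ∈ (trivializationAt E (TangentSpace I) p).source := by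
  rw [TangentBundle.trivializationAt_source]
  rw [extChartAt_source] at hx
  exact hx

lemma contMDiffAt_tangentBundle_iff {E' H' M' : Type*} [NormedAddCommGroup E'] [NormedSpace ℝ E']
    [TopologicalSpace H'] {J : ModelWithCorners ℝ E' H'} [TopologicalSpace M'] [ChartedSpace H' M']
    {f : M' → TangentBundle I M} {x₀ : M'} {p : M}
    (h : f x₀ ∈ (trivializationAt E (TangentSpace I) p).source) :
    ContMDiffAt J I.tangent ∞ f x₀ ↔ ContMDiffAt J I ∞ (fun x => (f x).proj) x₀ ∧
      ContMDiffAt J 𝓘(ℝ, E) ∞ (fun x => (trivializationAt E (TangentSpace I) p (f x)).2) x₀ :=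
  Bundle.Trivialization.contMDiffAt_iff h

/-- The trivialization at `p` undoes the frame, so in it the fibre coordinate is just `z.2`. -/
lemma contMDiffAt_frame {p : M} {u y : E} (hu : u ∈ (extChartAt I p).target) :
    ContMDiffAt 𝓘(ℝ, E × E) I.tangent ∞ (fun z : E × E =>
      tangentVector I ((extChartAt I p).symm z.1) (frame I p z.1 z.2)) (u, y) := by
  refine (contMDiffAt_tangentBundle_iff (J := 𝓘(ℝ, E × E)) (x₀ := (u, y)) (p := p)
    (f := fun z : E × E => tangentVector I ((extChartAt I p).symm z.1) (frame I p z.1 z.2))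
    (tangentVector_mem_source ((extChartAt I p).map_target hu) (frame I p u y))).2 ⟨?_, ?_⟩
  · exact ContMDiffAt.comp (f := Prod.fst) (u, y) (contMDiffAt_chart_symm hu)
      contDiff_fst.contMDiff.contMDiffAt
  · have h1 : ContMDiffAt 𝓘(ℝ, E × E) 𝓘(ℝ, E) ∞ (Prod.snd : E × E → E) (u, y) :=
      contDiff_snd.contMDiff.contMDiffAt
    refine h1.congr_of_eventuallyEq ?_
    have hc : Tendsto (Prod.fst : E × E → E) (𝓝 (u, y)) (𝓝 u) := continuous_fst.tendsto _
    filter_upwards [hc.eventually (eventually_mem_target hu)] with z hz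
    rw [trivializationAt_snd_frame hz, (frame_isInvertible hz).inverse_apply_self]

/-- The Finsler function is smooth near a tangent vector. -/
def IsRegularNear (𝓕 : ∀ x : M, TangentSpace I x → ℝ) (z : TangentBundle I M) : Prop :=
  ∀ᶠ z' in 𝓝 z, ContMDiffAt I.tangent 𝓘(ℝ, ℝ) ∞ (totalFun 𝓕) z'

lemma smoothNear_chartEnergy {𝓕 : ∀ x : M, TangentSpace I x → ℝ} {p : M} {u y : E}
    (hu : u ∈ (extChartAt I p).target)
    (h : IsRegularNear 𝓕 (tangentVector I ((extChartAt I p).symm u) (frame I p u y))) :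
    SmoothNear (chartEnergy I 𝓕 p) (u, y) := by
  have hc : Tendsto (Prod.fst : E × E → E) (𝓝 (u, y)) (𝓝 u) := continuous_fst.tendsto _
  filter_upwards [hc.eventually (eventually_mem_target hu),
    (contMDiffAt_frame (y := y) hu).continuousAt.eventually h] with z h1 h2
  have h3 := ContMDiffAt.comp z h2 (contMDiffAt_frame (y := z.2) h1)
  have h4 := contMDiffAt_iff_contDiffAt.1 h3
  exact (h4.pow 2).div_const 2

lemma frame_coordField {p : M} {V : ∀ x : M, TangentSpace I x} {u : E}
    (hu : u ∈ (extChartAt I p).target) :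
    frame I p u (coordField I p V u) = V ((extChartAt I p).symm u) :=
  (frame_isInvertible hu).self_apply_inverse _

lemma coordField_center (p : M) (V : ∀ x : M, TangentSpace I x) :
    coordField I p V (extChartAt I p p) = V p := by
  have h := frame_coordField (V := V) (mem_extChartAt_target (I := I) p)
  rw [frame_center, extChartAt_to_inv] at h
  exact h

lemma coordField_transition {p q : M} {V : ∀ x : M, TangentSpace I x} {u : E}
    (hu : u ∈ (extChartAt I p).target)
    (hq : (extChartAt I p).symm u ∈ (extChartAt I q).source) :
    coordField I q V (transition I p q u) = fderiv ℝ (transition I p q) u (coordField I p V u) := by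
  have h1 := frame_coordField (V := V) hu
  have h2 := frame_coordField (V := V) (transition_mem hq)
  rw [frame_transition hu hq, ContinuousLinearMap.comp_apply] at h1
  rw [symm_transition hq, ← h1] at h2
  exact (frame_isInvertible (transition_mem hq)).injective h2

lemma chartEnergy_transition {𝓕 : ∀ x : M, TangentSpace I x → ℝ} {p q : M} {u : E}
    (hu : u ∈ (extChartAt I p).target)
    (hq : (extChartAt I p).symm u ∈ (extChartAt I q).source) (y : E) :
    chartEnergy I 𝓕 p (u, y)
      = chartEnergy I 𝓕 q (transition I p q u, fderiv ℝ (transition I p q) u y) := by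
  have h1 : frame I q (transition I p q u) (fderiv ℝ (transition I p q) u y) = frame I p u y := by
    rw [frame_transition hu hq]; rfl
  change totalFun 𝓕 (tangentVector I ((extChartAt I p).symm u) (frame I p u y)) ^ 2 / 2
    = totalFun 𝓕 (tangentVector I ((extChartAt I q).symm (transition I p q u))
      (frame I q (transition I p q u) (fderiv ℝ (transition I p q) u y))) ^ 2 / 2
  rw [h1, symm_transition hq]

lemma smoothNear_coordField {p : M} {V : ∀ x : M, TangentSpace I x} {U : Set M} (hU : IsOpen U)
    (hV : ContMDiffOn I I.tangent ∞ (fun x => (⟨x, V x⟩ : TangentBundle I M)) U) {u : E}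
    (hu : u ∈ (extChartAt I p).target) (huU : (extChartAt I p).symm u ∈ U) :
    SmoothNear (coordField I p V) u := by
  filter_upwards [eventually_mem_target hu,
    (continuousAt_chart_symm hu).eventually (hU.mem_nhds huU)] with u' h1 h2
  have h3 : ContMDiffAt I I.tangent ∞ (fun x => tangentVector I x (V x))
    ((extChartAt I p).symm u') := hV.contMDiffAt (hU.mem_nhds h2)
  have h4 := ((contMDiffAt_tangentBundle_iff (p := p) (f := fun x => tangentVector I x (V x))
    (tangentVector_mem_source ((extChartAt I p).map_target h1) _)).1 h3).2
  have h5 := ContMDiffAt.comp u' h4 (contMDiffAt_chart_symm h1)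
  have h6 := contMDiffAt_iff_contDiffAt.1 h5
  refine h6.congr_of_eventuallyEq ?_
  filter_upwards [eventually_mem_target h1] with y hy
  exact (trivializationAt_snd_frame hy _).symm

lemma tangentVector_fieldOfCoord {p x : M} (V : E → E) (hx : x ∈ (extChartAt I p).source) :
    tangentVector I ((extChartAt I p).symm (extChartAt I p x))
      (frame I p (extChartAt I p x) (V (extChartAt I p x)))
      = (⟨x, fieldOfCoord I p V x⟩ : TangentBundle I M) := by
  rw [(extChartAt I p).left_inv hx]
  rfl

lemma contMDiffAt_fieldOfCoord {p x : M} {V : E → E} (hx : x ∈ (extChartAt I p).source)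
    (hV : ContDiffAt ℝ ∞ V (extChartAt I p x)) :
    ContMDiffAt I I.tangent ∞ (fun y => (⟨y, fieldOfCoord I p V y⟩ : TangentBundle I M)) x := by
  have h1 : ContMDiffAt I 𝓘(ℝ, E × E) ∞ (fun y => (extChartAt I p y, V (extChartAt I p y))) x := by
    have h2 : ContMDiffAt I 𝓘(ℝ, E) ∞ (extChartAt I p) x :=
      contMDiffAt_extChartAt' (by rwa [← extChartAt_source I])
    have h3 : ContDiffAt ℝ ∞ (fun u => (u, V u)) (extChartAt I p x) := contDiffAt_id.prodMk hV
    exact h3.contMDiffAt.comp x h2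
  have h4 := ContMDiffAt.comp x
    (contMDiffAt_frame (y := V (extChartAt I p x)) ((extChartAt I p).map_source hx)) h1
  refine h4.congr_of_eventuallyEq ?_
  filter_upwards [(isOpen_extChartAt_source p).mem_nhds hx] with y hy
  exact (tangentVector_fieldOfCoord V hy).symm

lemma coordField_fieldOfCoord {p : M} {V : E → E} {u : E} (hu : u ∈ (extChartAt I p).target) :
    coordField I p (fieldOfCoord I p V) u = V u := by
  have h : (fieldOfCoord I p V ((extChartAt I p).symm u) : E) = frame I p u (V u) := by
    change frame I p (extChartAt I p ((extChartAt I p).symm u)) (V (extChartAt I p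
      ((extChartAt I p).symm u))) = _
    rw [(extChartAt I p).right_inv hu]
  refine (frame_isInvertible hu).injective ?_
  rw [frame_coordField hu]
  exact h

end ChartFields

/-! ### The fundamental tensor in charts -/

section FiberHessian

variable {E : Type*} [NormedAddCommGroup E] [NormedSpace ℝ E] {Λ : E × E → ℝ} {u y : E}

lemma hasFDerivAt_mk_right (u y : E) :
    HasFDerivAt (fun w : E => (u, w)) (ContinuousLinearMap.inr ℝ E E) y :=
  hasFDerivAt_prodMk_right u y

lemma hasFDerivAt_mk_left (u y : E) :
    HasFDerivAt (fun w : E => (w, y)) (ContinuousLinearMap.inl ℝ E E) u :=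
  hasFDerivAt_prodMk_left u y

lemma fderiv_fiber (h : DifferentiableAt ℝ Λ (u, y)) :
    fderiv ℝ (fun w => Λ (u, w)) y = fiberDeriv Λ (u, y) :=
  (h.hasFDerivAt.comp y (hasFDerivAt_mk_right u y)).fderiv

lemma fderiv_base (h : DifferentiableAt ℝ Λ (u, y)) :
    fderiv ℝ (fun w => Λ (w, y)) u = baseDeriv Λ (u, y) :=
  HasFDerivAt.fderiv (HasFDerivAt.comp (f := fun w : E => (w, y)) u h.hasFDerivAt
    (hasFDerivAt_mk_left u y))

lemma eventually_fderiv_fiber (h : SmoothNear Λ (u, y)) :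
    fderiv ℝ (fun w => Λ (u, w)) =ᶠ[𝓝 y] fun w => fiberDeriv Λ (u, w) := by
  have hc : Tendsto (fun w : E => (u, w)) (𝓝 y) (𝓝 (u, y)) :=
    (hasFDerivAt_mk_right u y).continuousAt
  filter_upwards [hc.eventually h.eventually] with w hw
  exact fderiv_fiber hw.differentiableAt

lemma hasFDerivAt_fderiv_fiber (h : SmoothNear Λ (u, y)) :
    HasFDerivAt (fderiv ℝ fun w => Λ (u, w)) (fiberHessian Λ (u, y)) y :=
  (HasFDerivAt.comp (f := fun w : E => (u, w)) (g := fiberDeriv Λ) y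
    h.fiberDeriv.hasFDerivAt (hasFDerivAt_mk_right u y)).congr_of_eventuallyEq
    (eventually_fderiv_fiber h)

end FiberHessian

section ChartFields

variable {E : Type*} [NormedAddCommGroup E] [NormedSpace ℝ E]
  {H : Type*} [TopologicalSpace H] {I : ModelWithCorners ℝ E H}
  {M : Type*} [TopologicalSpace M] [ChartedSpace H M]
  [I.Boundaryless] [IsManifold I ∞ M] {𝓕 : ∀ x : M, TangentSpace I x → ℝ}

/-- The second derivative of a function in linearly transformed coordinates. -/
lemma fderiv_fderiv_comp_isInvertible {q : E → ℝ} {A : E →L[ℝ] E} (hA : A.IsInvertible)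
    {b : E →L[ℝ] E →L[ℝ] ℝ} {y : E} (h : HasFDerivAt (fderiv ℝ fun w => q (A w)) b y) :
    (fderiv ℝ (fderiv ℝ q) (A y)).bilinearComp A A = b := by
  obtain ⟨e, rfl⟩ := hA
  have h1 : fderiv ℝ q
      = fun w => (fderiv ℝ (fun w => q (e w)) (e.symm w)).comp (e.symm : E →L[ℝ] E) := by
    funext w
    have h2 := e.symm.comp_right_fderiv (f := fun w => q (e w)) (x := w)
    rw [← h2]
    congr 1
    funext z
    simp
  have h3 : HasFDerivAt (fun w => fderiv ℝ (fun w => q (e w)) (e.symm w))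
      (b.comp (e.symm : E →L[ℝ] E)) (e y) := by
    refine HasFDerivAt.comp (f := e.symm) (e y) ?_ e.symm.hasFDerivAt
    rw [e.symm_apply_apply]
    exact h
  have h4 : ∀ X, fderiv ℝ (fderiv ℝ q) (e y) X
      = (b (e.symm X)).comp (e.symm : E →L[ℝ] E) := by
    intro X
    rw [h1, fderiv_clm_comp_const h3.differentiableAt, h3.fderiv]
    rfl
  ext X Y
  rw [ContinuousLinearMap.bilinearComp_apply]
  simp [h4]

/-- On each fibre the frame is linear, so second fibre derivatives of `𝓕² / 2` pull back as a
bilinear form. This identifies `g^V` in the chart with the fibre Hessian of the chart energy along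
the coordinate field; it is pointwise and asks no regularity of `V`. -/
lemma metricInChart_fundamentalTensor {p : M} {V : ∀ x : M, TangentSpace I x} {u : E}
    (hu : u ∈ (extChartAt I p).target)
    (h : SmoothNear (chartEnergy I 𝓕 p) (u, coordField I p V u)) :
    metricInChart I (fun x => fundamentalTensor I 𝓕 x (V x)) p u
      = fiberHessian (chartEnergy I 𝓕 p) (u, coordField I p V u) := by
  have h1 := fderiv_fderiv_comp_isInvertible
    (q := fun w : E => 𝓕 ((extChartAt I p).symm u) w ^ 2 / 2) (frame_isInvertible hu)
    (hasFDerivAt_fderiv_fiber h)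
  rw [frame_coordField hu] at h1
  exact h1

lemma chartEnergy_homogeneous
    (h : ∀ (x : M) (v : TangentSpace I x) (t : ℝ), 0 < t → 𝓕 x (t • v) = t * 𝓕 x v) (p : M) :
    IsFiberHomogeneous 2 (chartEnergy I 𝓕 p) := by
  intro u y t ht
  have h1 := h ((extChartAt I p).symm u) (frame I p u y) t ht
  have h2 : frame I p u (t • y) = t • frame I p u y := map_smul _ _ _
  change 𝓕 ((extChartAt I p).symm u) (frame I p u (t • y)) ^ 2 / 2
    = t ^ 2 * (𝓕 ((extChartAt I p).symm u) (frame I p u y) ^ 2 / 2)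
  have h3 : 𝓕 ((extChartAt I p).symm u) (frame I p u (t • y))
      = t * 𝓕 ((extChartAt I p).symm u) (frame I p u y) := by
    rw [h2]; exact h1
  rw [h3]
  ring

/-! ### Geodesic fields in charts -/

/-- Integral curves on a manifold are phrased with `tangentCoordChange`, coordinate fields with
`frame`; this is the bridge between the two. -/
lemma tangentCoordChange_eq {p x : M} (hx : x ∈ (extChartAt I p).source) :
    tangentCoordChange I x p x = (frame I p (extChartAt I p x)).inverse := by
  have h0 : (extChartAt I x).symm (extChartAt I x x) = x := extChartAt_to_inv x
  have hx' : (extChartAt I x).symm (extChartAt I x x) ∈ (extChartAt I p).source := by rwa [h0]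
  have h1 := frame_transition (mem_extChartAt_target (I := I) x) hx'
  have h2 : transition I x p (extChartAt I x x) = extChartAt I p x := by rw [transition, h0]
  have h3 : tangentCoordChange I x p x = fderiv ℝ (transition I x p) (extChartAt I x x) := by
    rw [tangentCoordChange_def, I.range_eq_univ, fderivWithin_univ]
    rfl
  rw [frame_center, h2, ← h3] at h1
  have h4 := frame_isInvertible ((extChartAt I p).map_source hx)
  ext y
  have h5 := congrArg (fun A : E →L[ℝ] E => (frame I p (extChartAt I p x)).inverse (A y)) h1
  simp only [ContinuousLinearMap.comp_apply, ContinuousLinearMap.id_apply,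
    h4.inverse_apply_self] at h5
  exact h5.symm

lemma coordField_chart {p x : M} (hx : x ∈ (extChartAt I p).source)
    (V : ∀ x : M, TangentSpace I x) :
    coordField I p V (extChartAt I p x) = tangentCoordChange I x p x (V x) := by
  rw [tangentCoordChange_eq hx]
  change (frame I p (extChartAt I p x)).inverse
    (V ((extChartAt I p).symm (extChartAt I p x))) = _
  rw [(extChartAt I p).left_inv hx]

lemma IsMIntegralCurveAt.eventually_hasDerivAt_coordField {γ : ℝ → M} {t : ℝ}
    {V : ∀ x : M, TangentSpace I x} (h : IsMIntegralCurveAt γ V t) :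
    ∀ᶠ s in 𝓝 t, HasDerivAt (fun s => extChartAt I (γ t) (γ s))
      (coordField I (γ t) V (extChartAt I (γ t) (γ s))) s := by
  have : IsManifold I 1 M := IsManifold.of_le (n := ∞) (by simp)
  filter_upwards [h.eventually_hasDerivAt,
    h.continuousAt.eventually (extChartAt_source_mem_nhds (I := I) (γ t))] with s h1 h2
  rw [coordField_chart h2]
  exact h1

/-- Along an integral curve `c' = V(c)` at all nearby times, so the momentum of the curve is the
momentum of the field restricted to it. Its time derivative is then the derivative along `V`. -/
lemma isGeodesicAt_iff_isEulerField {γ : ℝ → M} {t : ℝ} {V : ∀ x : M, TangentSpace I x}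
    (h : IsMIntegralCurveAt γ V t)
    (hΛ : SmoothNear (chartEnergy I 𝓕 (γ t))
      (extChartAt I (γ t) (γ t), coordField I (γ t) V (extChartAt I (γ t) (γ t))))
    (hV : SmoothNear (coordField I (γ t) V) (extChartAt I (γ t) (γ t))) :
    IsGeodesicAt I 𝓕 γ t ↔
      IsEulerField (chartEnergy I 𝓕 (γ t)) (coordField I (γ t) V) (extChartAt I (γ t) (γ t)) := by
  have hc := IsMIntegralCurveAt.eventually_hasDerivAt_coordField h
  set q := γ t with hq
  set Λ := chartEnergy I 𝓕 q with hΛd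
  set W := coordField I q V with hW
  have hct := hc.self_of_nhds
  have h1 : (fun s => fderiv ℝ (energyInChart I 𝓕 q (extChartAt I q (γ s)))
      (deriv (fun s => extChartAt I q (γ s)) s)) =ᶠ[𝓝 t]
      fun s => fiberDeriv Λ (extChartAt I q (γ s), W (extChartAt I q (γ s))) := by
    filter_upwards [hc, hct.continuousAt.eventually (eventually_field hV hΛ.eventually)] with s a b
    rw [a.deriv]
    exact fderiv_fiber b.differentiableAt
  have hθ : SmoothNear (fun y => fiberDeriv Λ (y, W y)) (extChartAt I q (γ t)) :=
    SmoothNear.comp (g := fiberDeriv Λ) hΛ.fiberDeriv (SmoothNear.id.prodMk hV)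
  have h2 : HasDerivAt (fun s => fiberDeriv Λ (extChartAt I q (γ s), W (extChartAt I q (γ s)))) _ t :=
    HasFDerivAt.comp_hasDerivAt (f := fun s => extChartAt I q (γ s))
      (l := fun y => fiberDeriv Λ (y, W y)) t hθ.hasFDerivAt hct
  have h3 : fderiv ℝ (fun u => energyInChart I 𝓕 q u (deriv (fun s => extChartAt I q (γ s)) t))
      (extChartAt I q (γ t)) = baseDeriv Λ (extChartAt I q (γ t), W (extChartAt I q (γ t))) := by
    rw [hct.deriv]
    exact fderiv_base hΛ.differentiableAt
  have h4 := h2.congr_of_eventuallyEq h1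
  change HasDerivAt (fun s => fderiv ℝ (energyInChart I 𝓕 q (extChartAt I q (γ s)))
      (deriv (fun s => extChartAt I q (γ s)) s)) (fderiv ℝ (fun u => energyInChart I 𝓕 q u
      (deriv (fun s => extChartAt I q (γ s)) t)) (extChartAt I q (γ t))) t ↔ _
  rw [h3]
  constructor
  · intro h5
    exact h4.unique h5
  · intro h5
    rw [IsEulerField] at h5
    rw [← hq, ← h5]
    exact h4

lemma isRegularNear_coordField {p : M} {V : ∀ x : M, TangentSpace I x} {u : E}
    (hu : u ∈ (extChartAt I p).target)
    (h : IsRegularNear 𝓕 (tangentVector I ((extChartAt I p).symm u)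
      (V ((extChartAt I p).symm u)))) :
    SmoothNear (chartEnergy I 𝓕 p) (u, coordField I p V u) := by
  refine smoothNear_chartEnergy hu ?_
  rw [frame_coordField hu]
  exact h

/-- `IsGeodesicAt` reads the equation in the chart centred at the moving point `γ t`, whereas the
curvature is computed in one fixed chart; this passes between them. -/
lemma isEulerField_of_transition {p q : M} {V : ∀ x : M, TangentSpace I x} {U : Set M}
    (hU : IsOpen U) (hV : ContMDiffOn I I.tangent ∞ (fun x => (⟨x, V x⟩ : TangentBundle I M)) U)
    {u : E} (hu : u ∈ (extChartAt I p).target) (huU : (extChartAt I p).symm u ∈ U)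
    (hq : (extChartAt I p).symm u ∈ (extChartAt I q).source)
    (hr : IsRegularNear 𝓕 (tangentVector I ((extChartAt I p).symm u)
      (V ((extChartAt I p).symm u))))
    (h : IsEulerField (chartEnergy I 𝓕 q) (coordField I q V) (transition I p q u)) :
    IsEulerField (chartEnergy I 𝓕 p) (coordField I p V) u := by
  have ht := transition_mem hq
  have hs := symm_transition hq
  refine h.coordChange (smoothNear_transition hu hq) ?_ ?_ ?_ ?_
  · refine isRegularNear_coordField ht ?_
    rw [hs]
    exact hr
  · refine smoothNear_coordField hU hV ht ?_
    rw [hs]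
    exact huU
  · filter_upwards [eventually_mem_target hu, eventually_mem_source hu hq] with u' a b y
    exact chartEnergy_transition a b y
  · filter_upwards [eventually_mem_target hu, eventually_mem_source hu hq] with u' a b
    exact coordField_transition a b

variable [CompleteSpace E]

/-- The definition speaks of integral curves only. An integral curve exists through every point, so
the condition becomes an equation for the field, first in the chart centred at that point and then
in the chart at `p`. -/
lemma IsGeodesicField.isEulerField {U : Set M} {V : ∀ x : M, TangentSpace I x}
    (h : IsGeodesicField I 𝓕 U V) {p : M} {u : E} (hu : u ∈ (extChartAt I p).target)
    (huU : (extChartAt I p).symm u ∈ U)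
    (hr : IsRegularNear 𝓕 (tangentVector I ((extChartAt I p).symm u)
      (V ((extChartAt I p).symm u)))) :
    IsEulerField (chartEnergy I 𝓕 p) (coordField I p V) u := by
  have : IsManifold I 1 M := IsManifold.of_le (n := ∞) (by simp)
  set x := (extChartAt I p).symm u with hx
  have h1 : ContMDiffAt I I.tangent 1 (fun x => (⟨x, V x⟩ : TangentBundle I M)) x :=
    (h.smooth.contMDiffAt (h.isOpen.mem_nhds huU)).of_le (by simp)
  obtain ⟨γ, h2, h3⟩ := exists_isMIntegralCurveAt_of_contMDiffAt_boundaryless (t₀ := 0) h1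
  have h4 := h.geodesic γ 0 (by rwa [h2]) h3
  have hct := mem_extChartAt_target (I := I) (γ 0)
  have h5 : IsEulerField (chartEnergy I 𝓕 x) (coordField I x V) (extChartAt I x x) := by
    rw [← h2]
    refine (isGeodesicAt_iff_isEulerField h3 ?_ ?_).1 h4
    · refine isRegularNear_coordField hct ?_
      rw [extChartAt_to_inv, h2]
      exact hr
    · refine smoothNear_coordField h.isOpen h.smooth hct ?_
      rw [extChartAt_to_inv, h2]
      exact huU
  exact isEulerField_of_transition h.isOpen h.smooth hu huU (mem_extChartAt_source _) hr h5

lemma IsMIntegralCurveAt.isGeodesicAt {U : Set M} {V : ∀ x : M, TangentSpace I x}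
    (hU : IsOpen U) (hV : ContMDiffOn I I.tangent ∞ (fun x => (⟨x, V x⟩ : TangentBundle I M)) U)
    {p : M} {γ : ℝ → M} {t : ℝ} (hγ : IsMIntegralCurveAt γ V t) (hγU : γ t ∈ U)
    (hγp : γ t ∈ (extChartAt I p).source) (hr : IsRegularNear 𝓕 (tangentVector I (γ t) (V (γ t))))
    (h : IsEulerField (chartEnergy I 𝓕 p) (coordField I p V) (extChartAt I p (γ t))) :
    IsGeodesicAt I 𝓕 γ t := by
  have hct := mem_extChartAt_target (I := I) (γ t)
  have h0 := extChartAt_to_inv (I := I) (γ t)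
  have hr' : IsRegularNear 𝓕 (tangentVector I ((extChartAt I (γ t)).symm
      (extChartAt I (γ t) (γ t))) (V ((extChartAt I (γ t)).symm
      (extChartAt I (γ t) (γ t))))) := by
    rw [h0]; exact hr
  refine (isGeodesicAt_iff_isEulerField hγ (isRegularNear_coordField hct hr')
    (smoothNear_coordField hU hV hct (by rwa [h0]))).2 ?_
  refine isEulerField_of_transition (q := p) hU hV hct (by rwa [h0]) (by rwa [h0]) hr' ?_
  rw [transition, h0]
  exact h

end ChartFields

/-! ### Gram determinants -/

section Gram

open scoped Matrix

variable {E : Type*} [NormedAddCommGroup E] [NormedSpace ℝ E] {ι κ : Type*}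

/-- The Gram matrix of a family of vectors. -/
def gram (b : E →L[ℝ] E →L[ℝ] ℝ) (e : ι → E) : Matrix ι ι ℝ := Matrix.of fun i j => b (e i) (e j)

lemma gram_eq [Fintype ι] [Fintype κ] (b : E →L[ℝ] E →L[ℝ] ℝ) (e : Basis ι ℝ E) (e' : κ → E) :
    gram b e' = (e.toMatrix e')ᵀ * gram b e * e.toMatrix e' := by
  ext i j
  have h1 : ∀ k, e' k = ∑ l, e.toMatrix e' l k • e l := fun k => (e.sum_toMatrix_smul_self e' k).symm
  change b (e' i) (e' j) = _
  rw [h1 i, h1 j]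
  simp only [Matrix.mul_apply, Matrix.transpose_apply, gram, Matrix.of_apply, map_sum, map_smul,
    _root_.sum_apply, _root_.smul_apply, smul_eq_mul, Finset.sum_mul]
  refine Finset.sum_congr rfl fun k _ => ?_
  rw [Finset.mul_sum]
  refine Finset.sum_congr rfl fun l _ => ?_
  ring

lemma det_gram_eq [Fintype ι] [DecidableEq ι] (b : E →L[ℝ] E →L[ℝ] ℝ) (e : Basis ι ℝ E)
    (e' : ι → E) : (gram b e').det = (e.toMatrix e').det ^ 2 * (gram b e).det := by
  rw [gram_eq b e e', Matrix.det_mul, Matrix.det_mul, Matrix.det_transpose]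
  ring

lemma det_gram_pos [Fintype ι] [DecidableEq ι] {b : E →L[ℝ] E →L[ℝ] ℝ} (hs : ∀ X Y, b X Y = b Y X)
    (hp : ∀ X, X ≠ 0 → 0 < b X X) (e : Basis ι ℝ E) : 0 < (gram b e).det := by
  refine Matrix.PosDef.det_pos (Matrix.PosDef.of_dotProduct_mulVec_pos ?_ fun x hx => ?_)
  · ext i j
    exact hs _ _
  · have h1 : ∑ i, x i • e i ≠ 0 := by
      intro h0
      refine hx (funext fun i => ?_)
      exact Fintype.linearIndependent_iff.1 e.linearIndependent x h0 i
    have h2 := hp _ h1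
    simp only [map_sum, map_smul, _root_.sum_apply, _root_.smul_apply, smul_eq_mul] at h2
    simp only [dotProduct, Matrix.mulVec, gram, Matrix.of_apply, Finset.mul_sum]
    rw [Finset.sum_comm]
    refine h2.trans_le (le_of_eq ?_)
    refine Finset.sum_congr rfl fun i _ => ?_
    rw [Finset.mul_sum]
    refine Finset.sum_congr rfl fun j _ => ?_
    simp
    ring

variable [FiniteDimensional ℝ E]

lemma sqrtDet_eq (b : E →L[ℝ] E →L[ℝ] ℝ) : sqrtDet b = √((gram b (finBasis ℝ E)).det) := rfl

lemma sqrtDet_bilinearComp (b : E →L[ℝ] E →L[ℝ] ℝ) (A : E →L[ℝ] E) :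
    sqrtDet (b.bilinearComp A A) = |A.det| * sqrtDet b := by
  have h1 : gram (b.bilinearComp A A) (finBasis ℝ E) = gram b (A ∘ finBasis ℝ E) := rfl
  have h2 : (finBasis ℝ E).toMatrix (A ∘ finBasis ℝ E)
      = LinearMap.toMatrix (finBasis ℝ E) (finBasis ℝ E) (A : E →ₗ[ℝ] E) := by
    ext i j
    simp [Basis.toMatrix_apply, LinearMap.toMatrix_apply]
  rw [sqrtDet_eq, sqrtDet_eq, h1, det_gram_eq b (finBasis ℝ E), h2, LinearMap.det_toMatrix,
    Real.sqrt_mul (sq_nonneg _), Real.sqrt_sq_eq_abs]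

lemma sqrtDet_pos {b : E →L[ℝ] E →L[ℝ] ℝ} (hs : ∀ X Y, b X Y = b Y X)
    (hp : ∀ X, X ≠ 0 → 0 < b X X) : 0 < sqrtDet b :=
  Real.sqrt_pos.2 (det_gram_pos hs hp _)

lemma sqrtDet_nonneg (b : E →L[ℝ] E →L[ℝ] ℝ) : 0 ≤ sqrtDet b := Real.sqrt_nonneg _

lemma contDiff_det_gram [Fintype ι] [DecidableEq ι] (e : ι → E) :
    ContDiff ℝ ∞ fun b : E →L[ℝ] E →L[ℝ] ℝ => (gram b e).det := by
  simp only [Matrix.det_apply]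
  refine ContDiff.sum fun σ _ => ContDiff.const_smul _ (contDiff_prod fun i _ => ?_)
  change ContDiff ℝ ∞ fun b : E →L[ℝ] E →L[ℝ] ℝ => b (e (σ i)) (e i)
  fun_prop

lemma contDiffAt_sqrtDet {b : E →L[ℝ] E →L[ℝ] ℝ} (h : 0 < sqrtDet b) :
    ContDiffAt ℝ ∞ (sqrtDet : (E →L[ℝ] E →L[ℝ] ℝ) → ℝ) b :=
  (contDiff_det_gram _).contDiffAt.sqrt (Real.sqrt_pos.1 h).ne'

lemma SmoothNear.sqrtDet {X : Type*} [NormedAddCommGroup X] [NormedSpace ℝ X]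
    {G : X → E →L[ℝ] E →L[ℝ] ℝ} {x : X} (hG : SmoothNear G x)
    (hs : ∀ X Y, G x X Y = G x Y X) (hp : ∀ X, X ≠ 0 → 0 < G x X X) :
    SmoothNear (fun y => sqrtDet (G y)) x := by
  have h1 : ∀ᶠ y in 𝓝 x, 0 < (gram (G y) (finBasis ℝ E)).det :=
    ((contDiff_det_gram _).continuous.continuousAt.comp hG.continuousAt).eventually
      (lt_mem_nhds (det_gram_pos hs hp _))
  filter_upwards [hG, h1] with y h2 h3
  exact (contDiffAt_sqrtDet (Real.sqrt_pos.2 h3)).comp y h2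

lemma sqrtDet_smul {c : ℝ} (hc : 0 < c) (b : E →L[ℝ] E →L[ℝ] ℝ) :
    sqrtDet (c ^ 2 • b) = c ^ finrank ℝ E * sqrtDet b := by
  have h1 : gram (c ^ 2 • b) (finBasis ℝ E) = c ^ 2 • gram b (finBasis ℝ E) := rfl
  rw [sqrtDet_eq, sqrtDet_eq, h1, Matrix.det_smul, Fintype.card_fin, ← pow_mul, mul_comm 2, pow_mul,
    Real.sqrt_mul (sq_nonneg _), Real.sqrt_sq (by positivity)]

variable {F : Type*} [NormedAddCommGroup F] [NormedSpace ℝ F] [FiniteDimensional ℝ F]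

variable (E F) in
/-- The density of a block diagonal form, up to a constant that depends on the choice of bases. -/
lemma exists_sqrtDet_block : ∃ c : ℝ, 0 < c ∧ ∀ (b : (E × F) →L[ℝ] (E × F) →L[ℝ] ℝ)
    (g : E →L[ℝ] E →L[ℝ] ℝ) (h : F →L[ℝ] F →L[ℝ] ℝ),
    (∀ X Y, b X Y = g X.1 Y.1 + h X.2 Y.2) → 0 < (gram g (finBasis ℝ E)).det →
      sqrtDet b = c * (sqrtDet g * sqrtDet h) := by
  let e₀ := (finBasis ℝ E).prod (finBasis ℝ F)
  let σ : Fin (finrank ℝ E) ⊕ Fin (finrank ℝ F) ≃ Fin (finrank ℝ (E × F)) :=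
    finSumFinEquiv.trans (finCongr finrank_prod.symm)
  let e := e₀.reindex σ
  refine ⟨|(e.toMatrix (finBasis ℝ (E × F))).det|, abs_pos.2 ?_, fun b g h hb hg => ?_⟩
  · have : IsUnit (e.toMatrix (finBasis ℝ (E × F))).det := by
      rw [← Basis.det_apply]
      exact e.isUnit_det _
    exact this.ne_zero
  · have h1 : (gram b e).det = (gram g (finBasis ℝ E)).det * (gram h (finBasis ℝ F)).det := by
      have h2 : gram b e = (gram b e₀).submatrix σ.symm σ.symm := by
        ext i j
        simp [gram, e]
      have h3 : gram b e₀ = Matrix.fromBlocks (gram g (finBasis ℝ E)) 0 0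
          (gram h (finBasis ℝ F)) := by
        ext i j
        rcases i with i | i <;> rcases j with j | j <;> simp [gram, e₀, hb]
      rw [h2, Matrix.det_submatrix_equiv_self, h3, Matrix.det_fromBlocks_zero₂₁]
    rw [sqrtDet_eq, sqrtDet_eq, sqrtDet_eq, det_gram_eq b e, h1, Real.sqrt_mul (sq_nonneg _),
      Real.sqrt_sq_eq_abs, Real.sqrt_mul hg.le]

end Gram

/-! ### Measures in charts -/

section ChartMeasure

variable {E : Type*} [NormedAddCommGroup E] [NormedSpace ℝ E] [FiniteDimensional ℝ E]
  [MeasurableSpace E] [BorelSpace E]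
  {H : Type*} [TopologicalSpace H] {I : ModelWithCorners ℝ E H} [I.Boundaryless]
  {M : Type*} [TopologicalSpace M] [ChartedSpace H M] [IsManifold I ∞ M]
  [MeasurableSpace M] [BorelSpace M]

instance : (lebesgue E).IsAddHaarMeasure := by unfold lebesgue; infer_instance

lemma measurableSet_target (p : M) : MeasurableSet (extChartAt I p).target :=
  (isOpen_extChartAt_target p).measurableSet

lemma measurableSet_source (p : M) : MeasurableSet (extChartAt I p).source :=
  (isOpen_extChartAt_source p).measurableSet

lemma aemeasurable_chart_symm (p : M) :
    AEMeasurable (extChartAt I p).symm ((lebesgue E).restrict (extChartAt I p).target) :=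
  (continuousOn_extChartAt_symm p).aemeasurable (measurableSet_target p)

instance (p : M) (ρ : E → ℝ) : SFinite (chartMeasure I p ρ) := by
  unfold chartMeasure; infer_instance

lemma chartMeasure_apply (p : M) (ρ : E → ℝ) {S : Set M} (hS : MeasurableSet S) :
    chartMeasure I p ρ S = ∫⁻ u in (extChartAt I p).symm ⁻¹' S ∩ (extChartAt I p).target,
      ENNReal.ofReal (ρ u) ∂lebesgue E := by
  rw [chartMeasure, Measure.map_apply_of_aemeasurable
    ((aemeasurable_chart_symm p).mono_ac (withDensity_absolutelyContinuous _ _)) hS,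
    withDensity_apply', Measure.restrict_restrict' (measurableSet_target p)]

lemma measurableSet_inter_preimage_of_continuousOn {X Y : Type*} [TopologicalSpace X]
    [MeasurableSpace X] [OpensMeasurableSpace X] [TopologicalSpace Y] [MeasurableSpace Y]
    [BorelSpace Y] {f : X → Y} {s : Set X} (hf : ContinuousOn f s) (hs : MeasurableSet s)
    {t : Set Y} (ht : MeasurableSet t) : MeasurableSet (s ∩ f ⁻¹' t) := by
  have h1 := hs.subtype_image ((continuousOn_iff_continuous_domRestrict.1 hf).measurable ht)
  convert h1 using 1
  ext x
  simp [and_comm]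

lemma measurableSet_preimage_chart_symm (p : M) {S : Set M} (hS : MeasurableSet S) :
    MeasurableSet ((extChartAt I p).symm ⁻¹' S ∩ (extChartAt I p).target) := by
  rw [inter_comm]
  exact measurableSet_inter_preimage_of_continuousOn (continuousOn_extChartAt_symm p) (measurableSet_target p) hS

lemma chartMeasure_inter_source (p : M) (ρ : E → ℝ) {S : Set M} (hS : MeasurableSet S) :
    chartMeasure I p ρ (S ∩ (extChartAt I p).source) = chartMeasure I p ρ S := by
  rw [chartMeasure_apply p ρ hS, chartMeasure_apply p ρ (hS.inter (measurableSet_source p))]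
  congr 2
  ext u
  simp only [mem_inter_iff, mem_preimage]
  exact ⟨fun h => ⟨h.1.1, h.2⟩, fun h => ⟨⟨h.1, (extChartAt I p).map_target h.2⟩, h.2⟩⟩

/-- Densities that transform like the coefficient of a volume form define the same measure on the
intersection of two chart domains. -/
lemma chartMeasure_transition {p q : M} {ρ σ : E → ℝ}
    (h : ∀ u ∈ (extChartAt I p).target, (extChartAt I p).symm u ∈ (extChartAt I q).source →
      ρ u = |(fderiv ℝ (transition I p q) u).det| * σ (transition I p q u))
    {S : Set M} (hS : MeasurableSet S) (hp : S ⊆ (extChartAt I p).source)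
    (hq : S ⊆ (extChartAt I q).source) : chartMeasure I q σ S = chartMeasure I p ρ S := by
  rw [chartMeasure_apply p ρ hS, chartMeasure_apply q σ hS]
  set D := (extChartAt I p).symm ⁻¹' S ∩ (extChartAt I p).target with hD
  have himage : (extChartAt I q).symm ⁻¹' S ∩ (extChartAt I q).target
      = transition I p q '' D := by
    ext y
    constructor
    · rintro ⟨h1, h2⟩
      have h3 := hp h1
      refine ⟨extChartAt I p ((extChartAt I q).symm y), ⟨?_, (extChartAt I p).map_source h3⟩, ?_⟩
      · rw [mem_preimage, (extChartAt I p).left_inv h3]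
        exact h1
      · rw [transition, (extChartAt I p).left_inv h3, (extChartAt I q).right_inv h2]
    · rintro ⟨u, ⟨h1, h2⟩, rfl⟩
      have h3 := hq h1
      refine ⟨?_, transition_mem h3⟩
      rw [mem_preimage, symm_transition h3]
      exact h1
  have hinj : InjOn (transition I p q) D := by
    intro u hu v hv huv
    have h1 := congrArg (extChartAt I q).symm huv
    rw [symm_transition (hq hu.1), symm_transition (hq hv.1)] at h1
    exact (extChartAt I p).symm.injOn hu.2 hv.2 h1
  have hderiv : ∀ u ∈ D, HasFDerivWithinAt (transition I p q) (fderiv ℝ (transition I p q) u) D u :=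
    fun u hu => (smoothNear_transition hu.2 (hq hu.1)).hasFDerivAt.hasFDerivWithinAt
  have hDm : MeasurableSet D := measurableSet_preimage_chart_symm p hS
  rw [himage, lintegral_image_eq_lintegral_abs_det_fderiv_mul (lebesgue E) hDm hderiv hinj]
  refine setLIntegral_congr_fun hDm fun u hu => ?_
  rw [h u hu.2 (hq hu.1), ENNReal.ofReal_mul (abs_nonneg _)]

lemma metricInChart_transition (g : ∀ x : M, TangentSpace I x →L[ℝ] TangentSpace I x →L[ℝ] ℝ)
    {p q : M} {u : E} (hu : u ∈ (extChartAt I p).target)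
    (hq : (extChartAt I p).symm u ∈ (extChartAt I q).source) :
    metricInChart I g p u = (metricInChart I g q (transition I p q u)).bilinearComp
      (fderiv ℝ (transition I p q) u) (fderiv ℝ (transition I p q) u) := by
  let g' : M → E →L[ℝ] E →L[ℝ] ℝ := g
  change (g' ((extChartAt I p).symm u)).bilinearComp (frame I p u) (frame I p u)
    = ((g' ((extChartAt I q).symm (transition I p q u))).bilinearComp
      (frame I q (transition I p q u)) (frame I q (transition I p q u))).bilinearComp _ _
  rw [symm_transition hq, frame_transition hu hq]
  rfl

/-- In the domain of a chart, the Riemannian volume is `√(det g_{ij}) dx`. -/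
lemma restrict_riemannianVolume (g : ∀ x : M, TangentSpace I x →L[ℝ] TangentSpace I x →L[ℝ] ℝ)
    (p : M) : (riemannianVolume I g).restrict (extChartAt I p).source
      = chartMeasure I p fun u => sqrtDet (metricInChart I g p u) := by
  set μ : M → Measure M := fun q => chartMeasure I q fun u => sqrtDet (metricInChart I g q u)
    with hμ
  set A := (extChartAt I p).source with hA
  have hAm : MeasurableSet A := measurableSet_source p
  -- A single measure dominating every chart measure bounds the supremum without computing it: on
  -- `A` all chart measures are at most the one at `p`, and off `A` the trivial bound `⊤` is
  -- harmless.
  have h1 : ∀ q, μ q ≤ (μ p).restrict A + (⊤ : Measure M).restrict Aᶜ := by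
    intro q
    rw [← Measure.restrict_add_restrict_compl (μ := μ q) hAm]
    refine add_le_add ?_ (Measure.restrict_mono le_rfl le_top)
    refine Measure.le_iff.2 fun S hS => ?_
    rw [Measure.restrict_apply hS, Measure.restrict_apply hS]
    have h2 : μ q (S ∩ A) = μ q (S ∩ A ∩ (extChartAt I q).source) :=
      (chartMeasure_inter_source q _ (hS.inter hAm)).symm
    rw [h2]
    have h3 : μ q (S ∩ A ∩ (extChartAt I q).source) = μ p (S ∩ A ∩ (extChartAt I q).source) := by
      refine chartMeasure_transition (fun u hu hq => ?_)
        ((hS.inter hAm).inter (measurableSet_source q))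
        (fun x hx => hx.1.2) (fun x hx => hx.2)
      rw [metricInChart_transition g hu hq, sqrtDet_bilinearComp]
    rw [h3]
    exact measure_mono inter_subset_left
  have h2 : riemannianVolume I g ≤ (μ p).restrict A + (⊤ : Measure M).restrict Aᶜ := iSup_le h1
  ext S hS
  rw [Measure.restrict_apply hS]
  refine le_antisymm ?_ ?_
  · refine (h2 _).trans ?_
    rw [Measure.add_apply, Measure.restrict_apply (hS.inter hAm),
      Measure.restrict_apply (hS.inter hAm), inter_assoc, inter_assoc, inter_compl_self]
    simp only [inter_empty, measure_empty, add_zero, inter_self]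
    exact measure_mono inter_subset_left
  · rw [← chartMeasure_inter_source p _ hS]
    exact (le_iSup μ p) _

lemma restrict_chartMeasure_source (p : M) (ρ : E → ℝ) :
    (chartMeasure I p ρ).restrict (extChartAt I p).source = chartMeasure I p ρ := by
  ext S hS
  rw [Measure.restrict_apply hS, chartMeasure_inter_source p ρ hS]

/-- The restriction of a measure with a density in the chart, computed in the chart. -/
lemma restrict_chartMeasure (p : M) (ρ : E → ℝ) {W : Set M} (hW : MeasurableSet W) :
    (chartMeasure I p ρ).restrict W = (((lebesgue E).restrict
      ((extChartAt I p).symm ⁻¹' W ∩ (extChartAt I p).target)).withDensity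
        fun u => ENNReal.ofReal (ρ u)).map (extChartAt I p).symm := by
  ext S hS
  have h0 : AEMeasurable (extChartAt I p).symm ((lebesgue E).restrict
      ((extChartAt I p).symm ⁻¹' W ∩ (extChartAt I p).target)) :=
    (aemeasurable_chart_symm p).mono_measure (Measure.restrict_mono inter_subset_right le_rfl)
  rw [Measure.restrict_apply hS, chartMeasure_apply p ρ (hS.inter hW),
    Measure.map_apply_of_aemeasurable
    (h0.mono_ac (withDensity_absolutelyContinuous _ _)) hS,
    withDensity_apply', Measure.restrict_restrict' (measurableSet_preimage_chart_symm p hW),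
    preimage_inter, inter_assoc]

lemma isOpen_preimage_chart_symm (p : M) {W : Set M} (hW : IsOpen W) :
    IsOpen ((extChartAt I p).symm ⁻¹' W ∩ (extChartAt I p).target) := by
  rw [inter_comm]
  exact (continuousOn_extChartAt_symm p).isOpen_inter_preimage (isOpen_extChartAt_target p) hW

lemma continuousOn_comp_chart_symm (p : M) {W : Set M} {h : M → ℝ} (hh : ContinuousOn h W) :
    ContinuousOn (fun u => h ((extChartAt I p).symm u))
      ((extChartAt I p).symm ⁻¹' W ∩ (extChartAt I p).target) :=
  hh.comp ((continuousOn_extChartAt_symm p).mono inter_subset_right) fun _ hu => hu.1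

/-- The densities are continuous only on open sets, and the inverse chart only on its target. Every
integral identity is therefore used in its almost everywhere measurable form. -/
lemma withDensity_restrict_chartMeasure (p : M) {ρ : E → ℝ} {W : Set M} (hW : IsOpen W)
    (hρ : ContinuousOn ρ ((extChartAt I p).symm ⁻¹' W ∩ (extChartAt I p).target))
    {h : M → ℝ} (hh : ContinuousOn h W) (h0 : ∀ x ∈ W, 0 ≤ h x) :
    ((chartMeasure I p ρ).restrict W).withDensity (fun x => ENNReal.ofReal (h x))
      = (chartMeasure I p fun u => h ((extChartAt I p).symm u) * ρ u).restrict W := by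
  set O := (extChartAt I p).symm ⁻¹' W ∩ (extChartAt I p).target with hO
  have hOm : MeasurableSet O := (isOpen_preimage_chart_symm p hW).measurableSet
  have hsymm : AEMeasurable (extChartAt I p).symm ((lebesgue E).restrict O) :=
    (aemeasurable_chart_symm p).mono_measure (Measure.restrict_mono inter_subset_right le_rfl)
  ext S hS
  rw [withDensity_apply _ hS, Measure.restrict_restrict hS, restrict_chartMeasure p ρ
    (hS.inter hW.measurableSet), Measure.restrict_apply hS, chartMeasure_apply _ _
    (hS.inter hW.measurableSet)]
  set O' := (extChartAt I p).symm ⁻¹' (S ∩ W) ∩ (extChartAt I p).target with hO'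
  have hO'm : MeasurableSet O' := measurableSet_preimage_chart_symm p (hS.inter hW.measurableSet)
  have hsub : O' ⊆ O := fun u hu => ⟨hu.1.2, hu.2⟩
  have hsymm' : AEMeasurable (extChartAt I p).symm ((lebesgue E).restrict O') :=
    hsymm.mono_measure (Measure.restrict_mono hsub le_rfl)
  have hhm : AEMeasurable (fun x => ENNReal.ofReal (h x))
      ((((lebesgue E).restrict O').withDensity fun u => ENNReal.ofReal (ρ u)).map
        (extChartAt I p).symm) := by
    rw [hO', ← restrict_chartMeasure p ρ (hS.inter hW.measurableSet)]
    exact ((hh.aemeasurable hW.measurableSet).mono_measure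
      (Measure.restrict_mono inter_subset_right le_rfl)).ennreal_ofReal
  have hρm : AEMeasurable (fun u => ENNReal.ofReal (ρ u)) ((lebesgue E).restrict O') :=
    ((hρ.mono hsub).aemeasurable hO'm).ennreal_ofReal
  rw [lintegral_map' hhm (hsymm'.mono_ac (withDensity_absolutelyContinuous _ _)),
    lintegral_withDensity_eq_lintegral_mul₀ hρm
      (((continuousOn_comp_chart_symm p hh).mono hsub).aemeasurable hO'm).ennreal_ofReal]
  refine setLIntegral_congr_fun hO'm fun u hu => ?_
  change ENNReal.ofReal _ * ENNReal.ofReal _ = ENNReal.ofReal _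
  rw [ENNReal.ofReal_mul (h0 _ hu.1.2), mul_comm]

lemma restrict_chartMeasure_congr (p : M) {ρ σ : E → ℝ} {W : Set M} (hW : MeasurableSet W)
    (h : EqOn ρ σ ((extChartAt I p).symm ⁻¹' W ∩ (extChartAt I p).target)) :
    (chartMeasure I p ρ).restrict W = (chartMeasure I p σ).restrict W := by
  ext S hS
  rw [Measure.restrict_apply hS, Measure.restrict_apply hS, chartMeasure_apply _ _ (hS.inter hW),
    chartMeasure_apply _ _ (hS.inter hW)]
  refine setLIntegral_congr_fun (measurableSet_preimage_chart_symm p (hS.inter hW)) fun u hu => ?_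
  rw [h ⟨hu.1.2, hu.2⟩]

/-- Continuous densities are determined by the measure. -/
lemma eqOn_of_restrict_chartMeasure (p : M) {ρ σ : E → ℝ} {W : Set M} (hW : IsOpen W)
    (hρ : ContinuousOn ρ ((extChartAt I p).symm ⁻¹' W ∩ (extChartAt I p).target))
    (hσ : ContinuousOn σ ((extChartAt I p).symm ⁻¹' W ∩ (extChartAt I p).target))
    (hρ0 : ∀ u ∈ (extChartAt I p).symm ⁻¹' W ∩ (extChartAt I p).target, 0 ≤ ρ u)
    (hσ0 : ∀ u ∈ (extChartAt I p).symm ⁻¹' W ∩ (extChartAt I p).target, 0 ≤ σ u)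
    (h : (chartMeasure I p ρ).restrict W = (chartMeasure I p σ).restrict W) :
    EqOn ρ σ ((extChartAt I p).symm ⁻¹' W ∩ (extChartAt I p).target) := by
  set O := (extChartAt I p).symm ⁻¹' W ∩ (extChartAt I p).target with hO
  have hOo : IsOpen O := isOpen_preimage_chart_symm p hW
  have h1 : ((lebesgue E).restrict O).withDensity (fun u => ENNReal.ofReal (ρ u))
      = ((lebesgue E).restrict O).withDensity fun u => ENNReal.ofReal (σ u) := by
    ext D hD
    rw [withDensity_apply _ hD, withDensity_apply _ hD, Measure.restrict_restrict hD]
    have hS : MeasurableSet ((extChartAt I p).source ∩ extChartAt I p ⁻¹' D) :=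
      measurableSet_inter_preimage_of_continuousOn (continuousOn_extChartAt p) (measurableSet_source p) hD
    have h2 : (extChartAt I p).symm ⁻¹' (((extChartAt I p).source ∩ extChartAt I p ⁻¹' D) ∩ W) ∩
        (extChartAt I p).target = D ∩ O := by
      ext u
      constructor
      · rintro ⟨⟨⟨_, h4⟩, h5⟩, h6⟩
        rw [mem_preimage, (extChartAt I p).right_inv h6] at h4
        exact ⟨h4, h5, h6⟩
      · rintro ⟨h4, h5, h6⟩
        refine ⟨⟨⟨(extChartAt I p).map_target h6, ?_⟩, h5⟩, h6⟩
        rw [mem_preimage, (extChartAt I p).right_inv h6]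
        exact h4
    have h3 := congrArg (fun μ : Measure M => μ ((extChartAt I p).source ∩ extChartAt I p ⁻¹' D)) h
    simp only [Measure.restrict_apply hS] at h3
    rwa [chartMeasure_apply _ _ (hS.inter hW.measurableSet),
      chartMeasure_apply _ _ (hS.inter hW.measurableSet), h2] at h3
  have hρm := (hρ.aemeasurable (μ := lebesgue E) hOo.measurableSet).ennreal_ofReal
  have hσm := (hσ.aemeasurable (μ := lebesgue E) hOo.measurableSet).ennreal_ofReal
  have h2 := (withDensity_eq_iff_of_sigmaFinite hρm hσm).1 h1
  -- Lebesgue measure charges every nonempty open set, so continuous densities that agree almost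
  -- everywhere agree everywhere on `O`.
  have h3 : EqOn (fun u => ENNReal.ofReal (ρ u)) (fun u => ENNReal.ofReal (σ u)) O :=
    Measure.eqOn_open_of_ae_eq h2 hOo (ENNReal.continuous_ofReal.comp_continuousOn hρ)
      (ENNReal.continuous_ofReal.comp_continuousOn hσ)
  intro u hu
  exact (ENNReal.ofReal_eq_ofReal_iff (hρ0 u hu) (hσ0 u hu)).1 (h3 hu)

/-- A measure on a second countable manifold is s-finite if it is so on chart domains. -/
lemma sFinite_of_restrict_source [SecondCountableTopology M] {m : Measure M}
    (h : ∀ p, SFinite (m.restrict (extChartAt I p).source)) : SFinite m := by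
  obtain ⟨s, hs, hcover⟩ := TopologicalSpace.countable_cover_nhds
    fun p : M => extChartAt_source_mem_nhds (I := I) p
  rcases s.eq_empty_or_nonempty with rfl | hne
  · simp only [mem_empty_iff_false, iUnion_of_empty, iUnion_empty] at hcover
    have : m = 0 := by
      rw [← Measure.measure_univ_eq_zero, ← hcover, measure_empty]
    rw [this]
    infer_instance
  obtain ⟨e, rfl⟩ := hs.exists_eq_range hne
  set A : ℕ → Set M := fun i => (extChartAt I (e i)).source with hA
  have hAm : ∀ i, MeasurableSet (A i) := fun i => measurableSet_source _
  have h1 : m = Measure.sum fun i => m.restrict (disjointed A i) := by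
    rw [← Measure.restrict_iUnion (disjoint_disjointed A) (MeasurableSet.disjointed hAm),
      iUnion_disjointed]
    have : ⋃ i, A i = univ := by rw [← hcover, biUnion_range]
    rw [this, Measure.restrict_univ]
  have h2 : ∀ i, SFinite (m.restrict (disjointed A i)) := by
    intro i
    have := h (e i)
    have h3 : m.restrict (disjointed A i) = (m.restrict (A i)).restrict (disjointed A i) := by
      rw [Measure.restrict_restrict (MeasurableSet.disjointed hAm i),
        inter_eq_left.2 (disjointed_subset A i)]
    rw [h3]
    infer_instance
  rw [h1]
  infer_instance

end ChartMeasure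

/-! ### The `N`-Ricci curvature in terms of the spray -/

section LocalCongr

variable {E : Type*} [NormedAddCommGroup E] [NormedSpace ℝ E] {G G' : E → E →L[ℝ] E →L[ℝ] ℝ} {u : E}

lemma christoffel_congr (h : G =ᶠ[𝓝 u] G') : christoffel G u = christoffel G' u := by
  have h1 : christoffelFirst G u = christoffelFirst G' u := by
    ext X Y Z
    rw [christoffelFirst_apply, christoffelFirst_apply, h.fderiv_eq]
  ext X Y
  rw [christoffel_apply, christoffel_apply, h1, h.self_of_nhds]

lemma eventually_christoffel_congr (h : G =ᶠ[𝓝 u] G') : christoffel G =ᶠ[𝓝 u] christoffel G' := by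
  filter_upwards [eventually_eventually_nhds.2 h] with y hy
  exact christoffel_congr hy

lemma localRicci_congr (h : G =ᶠ[𝓝 u] G') (Y Z : E) : localRicci G u Y Z = localRicci G' u Y Z := by
  have h1 : curvatureEndo G u Y Z = curvatureEndo G' u Y Z := by
    ext X
    rw [curvatureEndo_apply, curvatureEndo_apply, (eventually_christoffel_congr h).fderiv_eq,
      christoffel_congr h]
  rw [localRicci, localRicci, h1]

lemma localHessian_congr {h h' : E → ℝ} (hG : G =ᶠ[𝓝 u] G') (hh : h =ᶠ[𝓝 u] h') :
    localHessian G h u = localHessian G' h' u := by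
  ext X Y
  rw [localHessian_apply, localHessian_apply, hh.fderiv.fderiv_eq, hh.fderiv_eq,
    christoffel_congr hG]

lemma IsEulerField.congr {Λ : E × E → ℝ} {V V' : E → E} (h : IsEulerField Λ V u)
    (hV : V' =ᶠ[𝓝 u] V) : IsEulerField Λ V' u := by
  have h1 : (fun y => fiberDeriv Λ (y, V' y)) =ᶠ[𝓝 u] fun y => fiberDeriv Λ (y, V y) :=
    hV.mono fun y hy => by simp only [hy]
  rw [IsEulerField, h1.fderiv_eq, hV.self_of_nhds]
  exact h

variable [FiniteDimensional ℝ E]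

/-- The logarithm of the density of the metric volume along a direction with respect to the measure
with density `ρ`. -/
def distortion (Λ : E × E → ℝ) (ρ : E → ℝ) (z : E × E) : ℝ :=
  Real.log (sqrtDet (fiberHessian Λ z)) - Real.log (ρ z.1)

open Classical in
/-- The `N`-Ricci curvature in a nonzero direction, in terms of the spray and the distortion. -/
def sprayNRicci (S : E × E → E) (τ : E × E → ℝ) (N : ℝ) (z : E × E) : EReal :=
  let n : ℝ := finrank ℝ E
  if n < N then
    ((sprayRicci S z + sprayDeriv S (sprayDeriv S τ) z - sprayDeriv S τ z ^ 2 / (N - n) : ℝ) : EReal)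
  else if N = n then
    if sprayDeriv S τ z = 0 then
      ((sprayRicci S z + sprayDeriv S (sprayDeriv S τ) z : ℝ) : EReal) else ⊥
  else ⊥

lemma IsFiberHomogeneous.distortion {Λ : E × E → ℝ} (h : IsFiberHomogeneous 2 Λ) (ρ : E → ℝ) :
    IsFiberHomogeneous 0 (distortion Λ ρ) := by
  intro u y t ht
  have h1 : fiberHessian Λ (u, t • y) = fiberHessian Λ (u, y) := by
    have := h.fiberDeriv.fiberDeriv u y t ht
    rw [pow_zero, one_smul] at this
    exact this
  rw [pow_zero, one_smul, WarpedFinsler.distortion, WarpedFinsler.distortion, h1]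

lemma SmoothNear.distortion {Λ : E × E → ℝ} {ρ : E → ℝ} {z : E × E} (h : SmoothNear Λ z)
    (hp : ∀ X, X ≠ 0 → 0 < WarpedFinsler.fiberHessian Λ z X X) (hρ : SmoothNear ρ z.1) (hρ0 : 0 < ρ z.1) :
    SmoothNear (WarpedFinsler.distortion Λ ρ) z :=
  ((h.fiberHessian.sqrtDet (fiberHessian_symm h) hp).log (sqrtDet_pos (fiberHessian_symm h) hp).ne').sub
    ((SmoothNear.comp (g := ρ) (f := Prod.fst) hρ SmoothNear.fst).log hρ0.ne')

end LocalCongr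

section Characterization

variable {E : Type u} [NormedAddCommGroup E] [NormedSpace ℝ E] [FiniteDimensional ℝ E]
  {H : Type*} [TopologicalSpace H] {I : ModelWithCorners ℝ E H} [I.Boundaryless]
  {M : Type*} [TopologicalSpace M] [ChartedSpace H M] [IsManifold I ∞ M]

variable (I) in
/-- `𝓕` is homogeneous, and near the nonzero vector `w` it is smooth with positive definite
fundamental tensor. -/
structure IsRegularAt (𝓕 : ∀ x : M, TangentSpace I x → ℝ) (p : M) (w : E) : Prop where
  homogeneous : ∀ (x : M) (v : TangentSpace I x) (t : ℝ), 0 < t → 𝓕 x (t • v) = t * 𝓕 x v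
  ne_zero : w ≠ 0
  regular : IsRegularNear 𝓕 (tangentVector I p w)
  pos : ∀ X, X ≠ 0 → 0 < fiberHessian (chartEnergy I 𝓕 p) (extChartAt I p p, w) X X

variable {𝓕 : ∀ x : M, TangentSpace I x → ℝ} {p : M} {w : E}

lemma IsRegularAt.smoothNear (h : IsRegularAt I 𝓕 p w) :
    SmoothNear (chartEnergy I 𝓕 p) (extChartAt I p p, w) := by
  refine smoothNear_chartEnergy (mem_extChartAt_target p) ?_
  rw [frame_center, extChartAt_to_inv]
  exact h.regular

lemma IsRegularAt.isInvertible (h : IsRegularAt I 𝓕 p w) :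
    (fiberHessian (chartEnergy I 𝓕 p) (extChartAt I p p, w)).IsInvertible :=
  isInvertible_of_pos h.pos

lemma mfderiv_eq_fderiv_chart {Ψ : M → ℝ} (h : MDifferentiableAt I 𝓘(ℝ, ℝ) Ψ p) (X : E) :
    (mfderiv I 𝓘(ℝ, ℝ) Ψ p X : ℝ)
      = fderiv ℝ (Ψ ∘ (extChartAt I p).symm) (extChartAt I p p) X := by
  have h1 : fderivWithin ℝ (writtenInExtChartAt I 𝓘(ℝ, ℝ) p Ψ) (range I) (extChartAt I p p)
      = fderiv ℝ (Ψ ∘ (extChartAt I p).symm) (extChartAt I p p) := by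
    rw [I.range_eq_univ, fderivWithin_univ]
    rfl
  exact congrArg (fun A : E →L[ℝ] ℝ => A X) (h.mfderiv.trans h1)

variable [MeasurableSpace E] [BorelSpace E] [MeasurableSpace M] [BorelSpace M]

variable (I) in
/-- `m` has the smooth positive density `ρ` in the chart at `p`. -/
structure HasSmoothDensity (m : Measure M) (p : M) (ρ : E → ℝ) : Prop where
  smooth : ContDiffOn ℝ ∞ ρ (extChartAt I p).target
  pos : ∀ u ∈ (extChartAt I p).target, 0 < ρ u
  restrict_eq : m.restrict (extChartAt I p).source = chartMeasure I p ρ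

lemma HasSmoothDensity.smoothNear {m : Measure M} {p : M} {ρ : E → ℝ}
    (h : HasSmoothDensity I m p ρ) {u : E} (hu : u ∈ (extChartAt I p).target) : SmoothNear ρ u := by
  filter_upwards [eventually_mem_target hu] with u' hu'
  exact h.smooth.contDiffAt (extChartAt_target_mem_nhds' hu')

lemma HasSmoothDensity.restrict_eq_of_subset {m : Measure M} {p : M} {ρ : E → ℝ}
    (h : m.restrict (extChartAt I p).source = chartMeasure I p ρ) {W : Set M}
    (hW : MeasurableSet W) (hWs : W ⊆ (extChartAt I p).source) :
    m.restrict W = (chartMeasure I p ρ).restrict W := by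
  rw [← h, Measure.restrict_restrict hW, inter_eq_left.2 hWs]

variable {m : Measure M} {ρ : E → ℝ}

/-- The right-hand side mentions neither `V` nor `Ψ`, so this is the independence of the choice.
Near `p` the field solves the spray equation and `Ψ` is the distortion along it, so the curvature,
the Hessian and the differential of `Ψ` are all given by the spray at `w`. -/
lemma IsRegularAt.weightedRicci_eq (h : IsRegularAt I 𝓕 p w) (hm : HasSmoothDensity I m p ρ)
    {U : Set M} {V : ∀ x : M, TangentSpace I x} {Ψ : M → ℝ} (hpU : p ∈ U)
    (hV : IsGeodesicField I 𝓕 U V) (hVp : V p = w) (hΨ : ContMDiffOn I 𝓘(ℝ, ℝ) ∞ Ψ U)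
    (hvol : m.restrict U = ((riemannianVolume I fun x => fundamentalTensor I 𝓕 x (V x)).restrict
      U).withDensity (fun x => ENNReal.ofReal (Real.exp (-Ψ x)))) (N : ℝ) :
    weightedRicci I (fun x => fundamentalTensor I 𝓕 x (V x)) Ψ N p w
      = sprayNRicci (spray (chartEnergy I 𝓕 p)) (distortion (chartEnergy I 𝓕 p) ρ) N
        (extChartAt I p p, w) := by
  have hu₀ : extChartAt I p p ∈ (extChartAt I p).target := mem_extChartAt_target p
  have hsymm₀ : (extChartAt I p).symm (extChartAt I p p) = p := extChartAt_to_inv p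
  set u₀ := extChartAt I p p with hu₀d
  set Λ := chartEnergy I 𝓕 p with hΛd
  set W := coordField I p V with hWd
  have hW₀ : W u₀ = w := (coordField_center p V).trans hVp
  have hWs : SmoothNear W u₀ := smoothNear_coordField hV.isOpen hV.smooth hu₀ (by rwa [hsymm₀])
  have hΛs : SmoothNear Λ (u₀, W u₀) := by rw [hW₀]; exact h.smoothNear
  have hpos : ∀ X, X ≠ 0 → 0 < fiberHessian Λ (u₀, W u₀) X X := by rw [hW₀]; exact h.pos
  have hcont : ContinuousAt (fun u => tangentVector I ((extChartAt I p).symm u)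
      (V ((extChartAt I p).symm u))) u₀ := by
    have h1 : ContinuousAt (fun x => tangentVector I x (V x)) ((extChartAt I p).symm u₀) := by
      rw [hsymm₀]
      exact (hV.smooth.contMDiffAt (hV.isOpen.mem_nhds hpU)).continuousAt
    exact h1.comp (continuousAt_chart_symm hu₀)
  have hreg : ∀ᶠ u in 𝓝 u₀, IsRegularNear 𝓕 (tangentVector I ((extChartAt I p).symm u)
      (V ((extChartAt I p).symm u))) := by
    refine hcont.eventually (p := IsRegularNear 𝓕) ?_
    have h1 : tangentVector I ((extChartAt I p).symm u₀) (V ((extChartAt I p).symm u₀))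
        = tangentVector I p w :=
      (congrArg (fun x => tangentVector I x (V x)) hsymm₀).trans (congrArg (tangentVector I p) hVp)
    change ∀ᶠ z in 𝓝 (tangentVector I ((extChartAt I p).symm u₀) (V ((extChartAt I p).symm u₀))), _
    rw [h1]
    exact eventually_eventually_nhds.2 h.regular
  have hU : ∀ᶠ u in 𝓝 u₀, (extChartAt I p).symm u ∈ U :=
    (continuousAt_chart_symm hu₀).eventually (hV.isOpen.mem_nhds (by rwa [hsymm₀]))
  have hsm : ∀ᶠ u in 𝓝 u₀, SmoothNear Λ (u, W u) := eventually_field hWs hΛs.eventually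
  have hpos' : ∀ᶠ u in 𝓝 u₀, ∀ X, X ≠ 0 → 0 < fiberHessian Λ (u, W u) X X :=
    eventually_pos (smoothNear_fiberHessian_field hΛs hWs).continuousAt hpos
  have hgeo : ∀ᶠ u in 𝓝 u₀, fderiv ℝ W u (W u) = spray Λ (u, W u) := by
    filter_upwards [hreg, hU, eventually_mem_target hu₀, hsm, hWs.eventually, hpos']
      with u a1 a2 a3 a4 a5 a6
    exact (isEulerField_iff a4 a5 (isInvertible_of_pos a6)).1 (hV.isEulerField a3 a2 a1)
  have hG : ∀ᶠ u in 𝓝 u₀, metricInChart I (fun x => fundamentalTensor I 𝓕 x (V x)) p u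
      = fiberHessian Λ (u, W u) := by
    filter_upwards [eventually_mem_target hu₀, hsm] with u a1 a2
    exact metricInChart_fundamentalTensor a1 a2
  have hτs : SmoothNear (distortion Λ ρ) (u₀, W u₀) :=
    hΛs.distortion hpos (hm.smoothNear hu₀) (hm.pos u₀ hu₀)
  -- On a small open set both sides of the volume identity are chart measures with continuous
  -- densities. The densities thus agree pointwise, and taking logarithms solves for `Ψ`.
  have hΨτ : Ψ ∘ (extChartAt I p).symm =ᶠ[𝓝 u₀] fun u => distortion Λ ρ (u, W u) := by
    obtain ⟨O, hO, hOo, hO₀⟩ := eventually_nhds_iff.1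
      (hG.and (hpos'.and (hsm.and (hU.and
        ((smoothNear_fiberHessian_field hΛs hWs).sqrtDet (fiberHessian_symm hΛs) hpos)))))
    set A : Set M := (extChartAt I p).source ∩ extChartAt I p ⁻¹' O ∩ U with hA
    have hAo : IsOpen A :=
      ((continuousOn_extChartAt p).isOpen_inter_preimage (isOpen_extChartAt_source p) hOo).inter
        hV.isOpen
    have hsub : ∀ u ∈ (extChartAt I p).symm ⁻¹' A ∩ (extChartAt I p).target, u ∈ O := by
      rintro u ⟨⟨⟨_, h1⟩, _⟩, h2⟩
      rwa [mem_preimage, (extChartAt I p).right_inv h2] at h1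
    have hAs : A ⊆ (extChartAt I p).source := fun x hx => hx.1.1
    have hAU : A ⊆ U := fun x hx => hx.2
    have hΨc : ContinuousOn (fun x => Real.exp (-Ψ x)) A :=
      Real.continuous_exp.comp_continuousOn (hΨ.continuousOn.mono hAU).neg
    have hGc : ContinuousOn (fun u => sqrtDet (metricInChart I
        (fun x => fundamentalTensor I 𝓕 x (V x)) p u))
        ((extChartAt I p).symm ⁻¹' A ∩ (extChartAt I p).target) := by
      have h1 : ContinuousOn (fun u => sqrtDet (fiberHessian Λ (u, W u)))
          ((extChartAt I p).symm ⁻¹' A ∩ (extChartAt I p).target) := fun u hu =>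
        (hO u (hsub u hu)).2.2.2.2.continuousAt.continuousWithinAt
      exact h1.congr fun u hu => by simp only [(hO u (hsub u hu)).1]
    have h1 : (chartMeasure I p ρ).restrict A = (chartMeasure I p fun u =>
        Real.exp (-Ψ ((extChartAt I p).symm u)) * sqrtDet (metricInChart I
          (fun x => fundamentalTensor I 𝓕 x (V x)) p u)).restrict A := by
      rw [← withDensity_restrict_chartMeasure p hAo hGc hΨc fun x _ => (Real.exp_pos _).le,
        ← HasSmoothDensity.restrict_eq_of_subset hm.restrict_eq hAo.measurableSet hAs,
        ← HasSmoothDensity.restrict_eq_of_subset (restrict_riemannianVolume _ p)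
          hAo.measurableSet hAs]
      have h2 := congrArg (fun μ : Measure M => μ.restrict A) hvol
      simp only [Measure.restrict_restrict hAo.measurableSet, inter_eq_left.2 hAU] at h2
      rw [h2, restrict_withDensity hAo.measurableSet, Measure.restrict_restrict hAo.measurableSet,
        inter_eq_left.2 hAU]
    have h3 := eqOn_of_restrict_chartMeasure p hAo (hm.smooth.continuousOn.mono inter_subset_right)
      ((continuousOn_comp_chart_symm p hΨc).mul hGc) (fun u hu => (hm.pos u hu.2).le)
      (fun u _ => mul_nonneg (Real.exp_pos _).le (sqrtDet_nonneg _)) h1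
    have h4 : (extChartAt I p).symm ⁻¹' A ∩ (extChartAt I p).target ∈ 𝓝 u₀ := by
      refine (isOpen_preimage_chart_symm p hAo).mem_nhds ⟨?_, hu₀⟩
      rw [mem_preimage, hsymm₀]
      exact ⟨⟨mem_extChartAt_source p, hO₀⟩, hpU⟩
    filter_upwards [h4] with u hu
    obtain ⟨b1, b2, b3, _⟩ := hO u (hsub u hu)
    have h5 : ρ u = Real.exp (-Ψ ((extChartAt I p).symm u)) * sqrtDet (fiberHessian Λ (u, W u)) :=
      (h3 hu).trans (congrArg (fun b => Real.exp (-Ψ ((extChartAt I p).symm u)) * sqrtDet b) b1)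
    rw [Function.comp_apply, distortion, h5, Real.log_mul (Real.exp_pos _).ne'
      (sqrtDet_pos (fiberHessian_symm b3) b2).ne', Real.log_exp]
    ring
  have hΨd : MDifferentiableAt I 𝓘(ℝ, ℝ) Ψ p :=
    (hΨ.contMDiffAt (hV.isOpen.mem_nhds hpU)).mdifferentiableAt (by simp)
  have e1 : ∀ X : E, ricci I (fun x => fundamentalTensor I 𝓕 x (V x)) p X X
      = localRicci (fun u => fiberHessian Λ (u, W u)) u₀ X X :=
    fun X => localRicci_congr hG X X
  have e2 : ∀ X : E, hessian I (fun x => fundamentalTensor I 𝓕 x (V x)) Ψ p X X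
      = localHessian (fun u => fiberHessian Λ (u, W u)) (fun u => distortion Λ ρ (u, W u)) u₀ X X :=
    fun X => congrArg (fun b : E →L[ℝ] E →L[ℝ] ℝ => b X X) (localHessian_congr hG hΨτ)
  have e3 : (mfderiv I 𝓘(ℝ, ℝ) Ψ p w : ℝ) = sprayDeriv (spray Λ) (distortion Λ ρ) (u₀, w) := by
    rw [mfderiv_eq_fderiv_chart hΨd, hΨτ.fderiv_eq, ← hW₀]
    exact fderiv_geodesicField hτs hWs hgeo.self_of_nhds
  have hi := isInvertible_of_pos hpos
  have hh : IsFiberHomogeneous 2 Λ := chartEnergy_homogeneous h.homogeneous p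
  have e4 : ricci I (fun x => fundamentalTensor I 𝓕 x (V x)) p w w
      = sprayRicci (spray Λ) (u₀, w) := by
    rw [e1, ← hW₀, localRicci, curvatureEndo_geodesicField hh hΛs hWs hi hgeo]
    rfl
  have e5 : hessian I (fun x => fundamentalTensor I 𝓕 x (V x)) Ψ p w w
      = sprayDeriv (spray Λ) (sprayDeriv (spray Λ) (distortion Λ ρ)) (u₀, w) := by
    rw [e2, ← hW₀, localHessian_geodesicField hh hΛs hWs hi hgeo hτs]
  -- This discards the value `0` at the zero vector, a case that `sprayNRicci` omits.
  have e6 : ¬((w : TangentSpace I p) = 0) := h.ne_zero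
  unfold weightedRicci sprayNRicci
  simp only [e4, e5, e3]
  split_ifs <;> first | rfl | exact absurd ‹_› e6

/-- The field is built in the chart at `p` by solving the spray equation and transported to the
manifold by the frame. Taking `Ψ` to be the distortion along it makes the volume identity hold by
construction; all other requirements are open conditions that hold after shrinking. -/
lemma IsRegularAt.exists_geodesicField (h : IsRegularAt I 𝓕 p w) (hm : HasSmoothDensity I m p ρ) :
    ∃ (U : Set M) (V : ∀ x : M, TangentSpace I x) (Ψ : M → ℝ),
      p ∈ U ∧ IsGeodesicField I 𝓕 U V ∧ V p = w ∧ ContMDiffOn I 𝓘(ℝ, ℝ) ∞ Ψ U ∧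
      m.restrict U = ((riemannianVolume I fun x => fundamentalTensor I 𝓕 x (V x)).restrict
        U).withDensity (fun x => ENNReal.ofReal (Real.exp (-Ψ x))) := by
  have hu₀ : extChartAt I p p ∈ (extChartAt I p).target := mem_extChartAt_target p
  have hsymm₀ : (extChartAt I p).symm (extChartAt I p p) = p := extChartAt_to_inv p
  have hsm := h.smoothNear
  have hi := h.isInvertible
  have hpos := h.pos
  set u₀ := extChartAt I p p with hu₀d
  set Λ := chartEnergy I 𝓕 p with hΛd
  obtain ⟨V₀, hV₀, hVs, hgeo⟩ := exists_smooth_velocity_field h.ne_zero (hsm.spray hi)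
  have hVs : SmoothNear V₀ u₀ := hVs
  rw [← hV₀] at hsm hi hpos
  have hreg : ∀ᶠ u in 𝓝 u₀, IsRegularNear 𝓕 (tangentVector I ((extChartAt I p).symm u)
      (frame I p u (V₀ u))) := by
    have h1 := (contMDiffAt_frame (y := V₀ u₀) hu₀).continuousAt
    have h2 : ContinuousAt (fun u => (u, V₀ u)) u₀ := continuousAt_id.prodMk hVs.continuousAt
    have h3 := ContinuousAt.comp (f := fun u => (u, V₀ u)) (x := u₀) h1 h2
    refine h3.eventually (p := IsRegularNear 𝓕) ?_
    change ∀ᶠ z in 𝓝 (tangentVector I ((extChartAt I p).symm u₀) (frame I p u₀ (V₀ u₀))), _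
    rw [hsymm₀, frame_center, hV₀]
    exact eventually_eventually_nhds.2 h.regular
  have hτs : SmoothNear (fun u => distortion Λ ρ (u, V₀ u)) u₀ :=
    SmoothNear.comp (g := distortion Λ ρ)
      (hsm.distortion hpos (hm.smoothNear hu₀) (hm.pos u₀ hu₀)) (SmoothNear.id.prodMk hVs)
  obtain ⟨O, hO, hOo, hO₀⟩ := eventually_nhds_iff.1 (hreg.and (hgeo.and (hVs.eventually.and
    ((eventually_field hVs hsm.eventually).and ((eventually_pos
      (smoothNear_fiberHessian_field hsm hVs).continuousAt hpos).and (hτs.and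
      ((smoothNear_fiberHessian_field hsm hVs).sqrtDet (fiberHessian_symm hsm) hpos)))))))
  set U : Set M := (extChartAt I p).source ∩ extChartAt I p ⁻¹' O with hU
  have hUo : IsOpen U :=
    (continuousOn_extChartAt p).isOpen_inter_preimage (isOpen_extChartAt_source p) hOo
  have hUs : U ⊆ (extChartAt I p).source := inter_subset_left
  set V := fieldOfCoord I p V₀ with hV
  have hVtan : ∀ x ∈ U, tangentVector I ((extChartAt I p).symm (extChartAt I p x))
      (frame I p (extChartAt I p x) (V₀ (extChartAt I p x))) = tangentVector I x (V x) :=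
    fun x hx => tangentVector_fieldOfCoord V₀ hx.1
  have hVr : ∀ x ∈ U, IsRegularNear 𝓕 (tangentVector I x (V x)) := by
    intro x hx
    rw [← hVtan x hx]
    exact (hO _ hx.2).1
  have hVsm : ContMDiffOn I I.tangent ∞ (fun x => (⟨x, V x⟩ : TangentBundle I M)) U :=
    fun x hx => (contMDiffAt_fieldOfCoord hx.1 (hO _ hx.2).2.2.1.contDiffAt).contMDiffWithinAt
  have hcoord : ∀ u ∈ (extChartAt I p).target, coordField I p V u = V₀ u :=
    fun u hu => coordField_fieldOfCoord hu
  have hmetric : ∀ u ∈ (extChartAt I p).target, u ∈ O →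
      metricInChart I (fun x => fundamentalTensor I 𝓕 x (V x)) p u
        = fiberHessian Λ (u, V₀ u) := by
    intro u hu huO
    have h1 := metricInChart_fundamentalTensor (𝓕 := 𝓕) (V := V) hu
      (by rw [hcoord u hu]; exact (hO u huO).2.2.2.1)
    rwa [hcoord u hu] at h1
  refine ⟨U, V, fun x => distortion Λ ρ (extChartAt I p x, V₀ (extChartAt I p x)),
    ⟨mem_extChartAt_source p, hO₀⟩, ⟨hUo, hVsm, fun x hx => (hVr x hx).self_of_nhds, ?_, ?_⟩,
    ?_, ?_, ?_⟩
  · intro x hx X hX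
    have hx' := (extChartAt I p).map_source hx.1
    have hinv := frame_isInvertible hx'
    let g : M → E →L[ℝ] E →L[ℝ] ℝ := fun x => fundamentalTensor I 𝓕 x (V x)
    have h1 : (g ((extChartAt I p).symm (extChartAt I p x))).bilinearComp
        (frame I p (extChartAt I p x)) (frame I p (extChartAt I p x))
        = fiberHessian Λ (extChartAt I p x, V₀ (extChartAt I p x)) := hmetric _ hx' hx.2
    rw [(extChartAt I p).left_inv hx.1] at h1
    let Y : E := (frame I p (extChartAt I p x)).inverse (X : E)
    have hY : frame I p (extChartAt I p x) Y = X := hinv.self_apply_inverse _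
    have hY0 : Y ≠ 0 := by
      intro h0
      rw [h0, map_zero] at hY
      exact hX hY.symm
    have h2 := (hO _ hx.2).2.2.2.2.1 Y hY0
    rw [← h1, ContinuousLinearMap.bilinearComp_apply, hY] at h2
    exact h2
  · intro γ t hγU hγ
    refine IsMIntegralCurveAt.isGeodesicAt hUo hVsm hγ hγU hγU.1 (hVr _ hγU) ?_
    have hx' := (extChartAt I p).map_source hγU.1
    obtain ⟨_, b1, b2, b3, b4, _⟩ := hO _ hγU.2
    refine IsEulerField.congr ((isEulerField_iff b3 b2 (isInvertible_of_pos b4)).2 b1) ?_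
    filter_upwards [eventually_mem_target hx'] with u hu
    exact hcoord u hu
  · have h1 : coordField I p V u₀ = V p := coordField_center p V
    exact h1.symm.trans ((hcoord u₀ hu₀).trans hV₀)
  · intro x hx
    have h1 : ContMDiffAt I 𝓘(ℝ, E) ∞ (extChartAt I p) x :=
      contMDiffAt_extChartAt' (by rw [← extChartAt_source I]; exact hx.1)
    have h2 : ContDiffAt ℝ ∞ (fun u => distortion Λ ρ (u, V₀ u)) (extChartAt I p x) :=
      (hO _ hx.2).2.2.2.2.2.1
    exact (h2.contMDiffAt.comp x h1).contMDiffWithinAt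
  · have hsub : ∀ u ∈ (extChartAt I p).symm ⁻¹' U ∩ (extChartAt I p).target, u ∈ O := by
      rintro u ⟨⟨_, h1⟩, h2⟩
      rwa [mem_preimage, (extChartAt I p).right_inv h2] at h1
    have hΨc : ContinuousOn (fun x => Real.exp (-distortion Λ ρ
        (extChartAt I p x, V₀ (extChartAt I p x)))) U := by
      refine Real.continuous_exp.comp_continuousOn (ContinuousOn.neg ?_)
      intro x hx
      have h2 : ContinuousAt (fun u => distortion Λ ρ (u, V₀ u)) (extChartAt I p x) :=
        (hO _ hx.2).2.2.2.2.2.1.continuousAt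
      exact (h2.comp (continuousAt_extChartAt' hx.1)).continuousWithinAt
    have hGc : ContinuousOn (fun u => sqrtDet (metricInChart I
        (fun x => fundamentalTensor I 𝓕 x (V x)) p u))
        ((extChartAt I p).symm ⁻¹' U ∩ (extChartAt I p).target) := by
      have h1 : ContinuousOn (fun u => sqrtDet (fiberHessian Λ (u, V₀ u)))
          ((extChartAt I p).symm ⁻¹' U ∩ (extChartAt I p).target) := fun u hu =>
        (hO u (hsub u hu)).2.2.2.2.2.2.continuousAt.continuousWithinAt
      exact h1.congr fun u hu => by simp only [hmetric u hu.2 (hsub u hu)]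
    rw [HasSmoothDensity.restrict_eq_of_subset hm.restrict_eq hUo.measurableSet hUs,
      HasSmoothDensity.restrict_eq_of_subset (restrict_riemannianVolume _ p) hUo.measurableSet hUs,
      withDensity_restrict_chartMeasure p hUo hGc hΨc fun x _ => (Real.exp_pos _).le]
    refine restrict_chartMeasure_congr p hUo.measurableSet fun u hu => ?_
    obtain ⟨_, _, _, b3, b4, _⟩ := hO u (hsub u hu)
    have h0 := sqrtDet_pos (fiberHessian_symm b3) b4
    simp only [hmetric u hu.2 (hsub u hu), (extChartAt I p).right_inv hu.2, distortion]
    rw [neg_sub, Real.exp_sub, Real.exp_log (hm.pos u hu.2), Real.exp_log h0,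
      div_mul_cancel₀ _ h0.ne']

/-- The `N`-Ricci curvature is well defined, and is computed from the spray. -/
theorem IsRegularAt.hasNRicci_iff (h : IsRegularAt I 𝓕 p w) (hm : HasSmoothDensity I m p ρ)
    (N : ℝ) (r : EReal) :
    HasNRicci I 𝓕 m N p w r ↔ r = sprayNRicci (spray (chartEnergy I 𝓕 p))
      (distortion (chartEnergy I 𝓕 p) ρ) N (extChartAt I p p, w) := by
  constructor
  · rintro ⟨U, V, Ψ, h1, h2, h3, h4, h5, rfl⟩
    exact h.weightedRicci_eq hm h1 h2 h3 h4 h5 N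
  · rintro rfl
    obtain ⟨U, V, Ψ, h1, h2, h3, h4, h5⟩ := h.exists_geodesicField hm
    exact ⟨U, V, Ψ, h1, h2, h3, h4, h5, (h.weightedRicci_eq hm h1 h2 h3 h4 h5 N).symm⟩

theorem IsRegularAt.nRicci_eq (h : IsRegularAt I 𝓕 p w) (hm : HasSmoothDensity I m p ρ) (N : ℝ) :
    nRicci I 𝓕 m N p w = sprayNRicci (spray (chartEnergy I 𝓕 p))
      (distortion (chartEnergy I 𝓕 p) ρ) N (extChartAt I p p, w) := by
  have h1 : ∃ r, HasNRicci I 𝓕 m N p w r := ⟨_, (h.hasNRicci_iff hm N _).2 rfl⟩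
  unfold nRicci
  rw [dif_pos h1]
  exact (h.hasNRicci_iff hm N _).1 h1.choose_spec

end Characterization

/-! ### Regularity of Riemannian metrics and Finsler structures in charts -/

section Regularity

variable {E : Type*} [NormedAddCommGroup E] [NormedSpace ℝ E]
  {H : Type*} [TopologicalSpace H] {I : ModelWithCorners ℝ E H} [I.Boundaryless]
  {M : Type*} [TopologicalSpace M] [ChartedSpace H M] [IsManifold I ∞ M]

/-- In finite dimension it is enough to test on constant vectors, and there the coefficient is the
bundle metric evaluated on two smooth frame fields. -/
lemma smoothNear_metricInChart [FiniteDimensional ℝ E]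
    (g : Bundle.ContMDiffRiemannianMetric I ∞ E (fun p : M => TangentSpace I p)) {p : M} {u : E}
    (hu : u ∈ (extChartAt I p).target) : SmoothNear (metricInChart I g.inner p) u := by
  have hframe : ∀ X : E, ∀ u ∈ (extChartAt I p).target, ContMDiffAt 𝓘(ℝ, E) I.tangent ∞
      (fun u => tangentVector I ((extChartAt I p).symm u) (frame I p u X)) u := by
    intro X u hu
    have h1 : ContMDiffAt 𝓘(ℝ, E) 𝓘(ℝ, E × E) ∞ (fun u : E => (u, X)) u :=
      (contDiffAt_id.prodMk contDiffAt_const).contMDiffAt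
    exact ContMDiffAt.comp (f := fun u : E => (u, X)) u (contMDiffAt_frame (y := X) hu) h1
  have h1 : ContDiffOn ℝ ∞ (metricInChart I g.inner p) (extChartAt I p).target := by
    refine contDiffOn_clm_apply.2 fun X => contDiffOn_clm_apply.2 fun Y u hu => ?_
    refine ContDiffAt.contDiffWithinAt (contMDiffAt_iff_contDiffAt.1 ?_)
    have h2 : ContMDiffAt 𝓘(ℝ, E) (I.prod 𝓘(ℝ, ℝ)) ∞ (fun u => Bundle.TotalSpace.mk' ℝ
        (E := Bundle.Trivial M ℝ) ((extChartAt I p).symm u)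
        (g.inner ((extChartAt I p).symm u) (frame I p u X) (frame I p u Y))) u := by
      apply ContMDiffAt.clm_bundle_apply₂ (F₁ := E) (F₂ := E) (E₁ := TangentSpace I)
        (E₂ := TangentSpace I)
      · exact ContMDiffAt.comp u g.contMDiff.contMDiffAt (contMDiffAt_chart_symm hu)
      · exact hframe X u hu
      · exact hframe Y u hu
    simp only [Bundle.contMDiffAt_totalSpace] at h2
    exact h2.2
  filter_upwards [eventually_mem_target hu] with u' hu'
  exact h1.contDiffAt (extChartAt_target_mem_nhds' hu')

lemma metricInChart_symm
    (g : Bundle.ContMDiffRiemannianMetric I ∞ E (fun p : M => TangentSpace I p)) (p : M) (u X Y : E) :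
    metricInChart I g.inner p u X Y = metricInChart I g.inner p u Y X :=
  g.symm ((extChartAt I p).symm u) (frame I p u X) (frame I p u Y)

lemma metricInChart_pos
    (g : Bundle.ContMDiffRiemannianMetric I ∞ E (fun p : M => TangentSpace I p)) {p : M} {u : E}
    (hu : u ∈ (extChartAt I p).target) (X : E) (hX : X ≠ 0) :
    0 < metricInChart I g.inner p u X X := by
  refine g.pos ((extChartAt I p).symm u) (frame I p u X) fun h => hX ?_
  have h1 : frame I p u X = frame I p u 0 := by rw [map_zero]; exact h
  exact (frame_isInvertible hu).injective h1

lemma smoothNear_comp_chart_symm {f : M → ℝ} (hf : ContMDiff I 𝓘(ℝ, ℝ) ∞ f) {p : M} {u : E}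
    (hu : u ∈ (extChartAt I p).target) : SmoothNear (f ∘ (extChartAt I p).symm) u := by
  filter_upwards [eventually_mem_target hu] with u' hu'
  exact contMDiffAt_iff_contDiffAt.1
    (ContMDiffAt.comp u' hf.contMDiffAt (contMDiffAt_chart_symm hu'))

variable (I) in
/-- The tangent bundle in the chart at `p`. -/
def tangentChart (p : M) (z : TangentBundle I M) : E × E :=
  (extChartAt I p z.1, (trivializationAt E (TangentSpace I) p z).2)

lemma contMDiffAt_tangentChart {p : M} {z : TangentBundle I M} (hz : z.1 ∈ (extChartAt I p).source) :
    ContMDiffAt I.tangent 𝓘(ℝ, E × E) ∞ (tangentChart I p) z := by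
  have h1 : ContMDiffAt I.tangent I.tangent ∞ (fun z : TangentBundle I M => z) z := contMDiffAt_id
  obtain ⟨h2, h3⟩ := (contMDiffAt_tangentBundle_iff (p := p) (f := fun z : TangentBundle I M => z)
    (tangentVector_mem_source hz z.2)).1 h1
  have h4 : ContMDiffAt I 𝓘(ℝ, E) ∞ (extChartAt I p) z.1 :=
    contMDiffAt_extChartAt' (by rwa [← extChartAt_source I])
  exact (h4.comp z h2).prodMk_space h3

lemma tangentChart_tangentVector {p x : M} (hx : x ∈ (extChartAt I p).source) (w : E) :
    tangentChart I p (tangentVector I x w)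
      = (extChartAt I p x, (frame I p (extChartAt I p x)).inverse w) := by
  have h1 := trivializationAt_snd_frame ((extChartAt I p).map_source hx) w
  rw [(extChartAt I p).left_inv hx] at h1
  exact Prod.ext rfl h1

lemma tangentChart_center (p : M) (w : E) :
    tangentChart I p (tangentVector I p w) = (extChartAt I p p, w) := by
  rw [tangentChart_tangentVector (mem_extChartAt_source p), frame_center,
    ContinuousLinearMap.inverse_id]
  rfl

lemma eventually_proj_mem_source (p : M) (w : E) :
    ∀ᶠ z in 𝓝 (tangentVector I p w), z.1 ∈ (extChartAt I p).source := by
  have h1 : ContinuousAt (fun z : TangentBundle I M => z.1) (tangentVector I p w) :=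
    (FiberBundle.continuous_proj E (TangentSpace I)).continuousAt
  exact h1.eventually (extChartAt_source_mem_nhds (I := I) p)

lemma eventually_ne_zero {p : M} {w : E} (hw : w ≠ 0) :
    ∀ᶠ z in 𝓝 (tangentVector I p w), z.2 ≠ 0 := by
  have h1 := (contMDiffAt_tangentChart (z := tangentVector I p w)
    (mem_extChartAt_source (I := I) p)).continuousAt.snd
  have h2 : (tangentChart I p (tangentVector I p w)).2 ≠ 0 := by rwa [tangentChart_center]
  filter_upwards [h1.eventually_ne h2, eventually_proj_mem_source p w] with z h3 h4 h5
  refine h3 ?_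
  have h6 : z = tangentVector I z.1 0 := Bundle.TotalSpace.ext rfl (heq_of_eq h5)
  rw [h6, tangentChart_tangentVector h4]
  exact map_zero _

lemma FinslerStructure.isRegularNear (𝓕 : FinslerStructure I M) {p : M} {w : E} (hw : w ≠ 0) :
    IsRegularNear 𝓕.toFun (tangentVector I p w) := by
  filter_upwards [eventually_eventually_nhds.2 (eventually_ne_zero (I := I) (p := p) hw)] with z hz
  exact 𝓕.smooth.contMDiffAt hz

lemma chartEnergy_tangentChart (𝓕 : ∀ x : M, TangentSpace I x → ℝ) {p : M} {z : TangentBundle I M}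
    (hz : z.1 ∈ (extChartAt I p).source) :
    chartEnergy I 𝓕 p (tangentChart I p z) = totalFun 𝓕 z ^ 2 / 2 := by
  have h1 := tangentChart_tangentVector hz z.2
  have h2 : tangentVector I z.1 z.2 = z := rfl
  rw [h2] at h1
  rw [h1]
  have h3 := frame_isInvertible ((extChartAt I p).map_source hz)
  change totalFun 𝓕 (tangentVector I ((extChartAt I p).symm (extChartAt I p z.1))
    (frame I p (extChartAt I p z.1) ((frame I p (extChartAt I p z.1)).inverse z.2))) ^ 2 / 2 = _
  have h4 : frame I p (extChartAt I p z.1) ((frame I p (extChartAt I p z.1)).inverse z.2) = z.2 :=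
    h3.self_apply_inverse _
  rw [(extChartAt I p).left_inv hz, h4]
  rfl

lemma chartEnergy_center (𝓕 : ∀ x : M, TangentSpace I x → ℝ) (p : M) (w : E) :
    chartEnergy I 𝓕 p (extChartAt I p p, w) = 𝓕 p w ^ 2 / 2 := by
  have h := chartEnergy_tangentChart 𝓕 (z := tangentVector I p w)
    (mem_extChartAt_source (I := I) p)
  rw [tangentChart_center] at h
  exact h

/-- A nonnegative function is smooth where its energy is smooth and positive. -/
lemma isRegularNear_of_smoothNear {𝓕 : ∀ x : M, TangentSpace I x → ℝ} {p : M} {w : E}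
    (h0 : ∀ x v, 0 ≤ 𝓕 x v) (h : SmoothNear (chartEnergy I 𝓕 p) (extChartAt I p p, w))
    (hpos : 0 < chartEnergy I 𝓕 p (extChartAt I p p, w)) :
    IsRegularNear 𝓕 (tangentVector I p w) := by
  have hc := (contMDiffAt_tangentChart (z := tangentVector I p w)
    (mem_extChartAt_source (I := I) p)).continuousAt
  have h1 : ∀ᶠ z in 𝓝 (tangentVector I p w), ContDiffAt ℝ ∞ (chartEnergy I 𝓕 p)
      (tangentChart I p z) ∧ 0 < chartEnergy I 𝓕 p (tangentChart I p z) := by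
    refine hc.eventually (p := fun z' => ContDiffAt ℝ ∞ (chartEnergy I 𝓕 p) z' ∧
      0 < chartEnergy I 𝓕 p z') ?_
    rw [tangentChart_center]
    exact h.and (h.continuousAt.eventually (lt_mem_nhds hpos))
  filter_upwards [h1, eventually_eventually_nhds.2 (eventually_proj_mem_source p w)] with z h2 h3
  -- `𝓕` is recovered from its energy by a square root, which is smooth away from zero.
  have h4 : ContDiffAt ℝ ∞ (fun z' => √(2 * chartEnergy I 𝓕 p z')) (tangentChart I p z) :=
    (contDiffAt_const.mul h2.1).sqrt (mul_pos two_pos h2.2).ne'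
  have h5 := h4.contMDiffAt.comp z (contMDiffAt_tangentChart h3.self_of_nhds)
  refine h5.congr_of_eventuallyEq ?_
  filter_upwards [h3] with z' hz'
  change totalFun 𝓕 z' = √(2 * chartEnergy I 𝓕 p (tangentChart I p z'))
  rw [chartEnergy_tangentChart 𝓕 hz', mul_div_cancel₀ _ two_ne_zero]
  exact (Real.sqrt_sq (h0 _ _)).symm

/-- Euler's identity for the fundamental tensor. -/
lemma IsFiberHomogeneous.fiberHessian_self {Λ : E × E → ℝ} (hh : IsFiberHomogeneous 2 Λ) {z : E × E}
    (h : SmoothNear Λ z) : fiberHessian Λ z z.2 z.2 = 2 * Λ z := by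
  have h1 := hh.fiberDeriv.euler h.fiberDeriv.differentiableAt
  have h2 := hh.euler h.differentiableAt
  have h3 : fiberHessian Λ z z.2 = WarpedFinsler.fiberDeriv Λ z := by
    simpa [fiberHessian, fiberDeriv_apply] using h1
  rw [h3, fiberDeriv_apply, h2]
  simp

lemma FinslerStructure.isRegularAt [FiniteDimensional ℝ E] (𝓕 : FinslerStructure I M) {p : M} {w : E}
    (hw : w ≠ 0) : IsRegularAt I 𝓕.toFun p w := by
  refine ⟨𝓕.homogeneous, hw, 𝓕.isRegularNear hw, fun X hX => ?_⟩
  have hu := mem_extChartAt_target (I := I) p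
  -- The field `fun _ => w` need not be smooth; only its value at `p` enters.
  have h0 : coordField I p (fun _ => w) (extChartAt I p p) = w := coordField_center p _
  have h1 : SmoothNear (chartEnergy I 𝓕.toFun p) (extChartAt I p p, w) := by
    refine smoothNear_chartEnergy hu ?_
    rw [frame_center, extChartAt_to_inv]
    exact 𝓕.isRegularNear hw
  have h2 := metricInChart_fundamentalTensor (𝓕 := 𝓕.toFun) (V := fun _ => w) hu (by rwa [h0])
  rw [h0] at h2
  rw [← h2]
  have hX' : frame I p (extChartAt I p p) X ≠ 0 := by rwa [frame_center]
  exact 𝓕.convex _ _ _ hw hX'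

end Regularity

/-! ### Congruence of sprays -/

section SprayCongr

variable {E : Type*} [NormedAddCommGroup E] [NormedSpace ℝ E]
  {F : Type*} [NormedAddCommGroup F] [NormedSpace ℝ F] {z : E × E}

lemma fiberDeriv_congr {Q Q' : E × E → F} (h : Q =ᶠ[𝓝 z] Q') :
    fiberDeriv Q =ᶠ[𝓝 z] fiberDeriv Q' :=
  h.fderiv.mono fun z' hz => by rw [fiberDeriv, fiberDeriv, hz]

lemma baseDeriv_congr {Q Q' : E × E → F} (h : Q =ᶠ[𝓝 z] Q') :
    baseDeriv Q =ᶠ[𝓝 z] baseDeriv Q' :=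
  h.fderiv.mono fun z' hz => by rw [baseDeriv, baseDeriv, hz]

lemma fiberHessian_congr {Λ Λ' : E × E → ℝ} (h : Λ =ᶠ[𝓝 z] Λ') :
    fiberHessian Λ =ᶠ[𝓝 z] fiberHessian Λ' := fiberDeriv_congr (fiberDeriv_congr h)

lemma spray_congr {Λ Λ' : E × E → ℝ} (h : Λ =ᶠ[𝓝 z] Λ') : spray Λ =ᶠ[𝓝 z] spray Λ' := by
  filter_upwards [fiberHessian_congr h, baseDeriv_congr h,
    baseDeriv_congr (fiberDeriv_congr h)] with z' h1 h2 h3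
  rw [spray, spray, h1, h2, h3]

lemma sprayDeriv_congr {S S' : E × E → E} {Q Q' : E × E → F} (hS : S =ᶠ[𝓝 z] S')
    (h : Q =ᶠ[𝓝 z] Q') : sprayDeriv S Q =ᶠ[𝓝 z] sprayDeriv S' Q' := by
  filter_upwards [hS, h.fderiv (𝕜 := ℝ)] with z' h1 h2
  rw [sprayDeriv, sprayDeriv, h1, h2]

lemma sprayRicci_congr {S S' : E × E → E} (h : S =ᶠ[𝓝 z] S') :
    sprayRicci S z = sprayRicci S' z := by
  rw [sprayRicci, sprayRicci, sprayCurvature, sprayCurvature, (baseDeriv_congr h).self_of_nhds,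
    (fiberDeriv_congr h).self_of_nhds, (sprayDeriv_congr h (fiberDeriv_congr h)).self_of_nhds]

lemma sprayNRicci_congr [FiniteDimensional ℝ E] {S S' : E × E → E} {τ τ' : E × E → ℝ}
    (hS : S =ᶠ[𝓝 z] S') (hτ : τ =ᶠ[𝓝 z] τ') (N : ℝ) :
    sprayNRicci S τ N z = sprayNRicci S' τ' N z := by
  rw [sprayNRicci, sprayNRicci, sprayRicci_congr hS, (sprayDeriv_congr hS hτ).self_of_nhds,
    (sprayDeriv_congr hS (sprayDeriv_congr hS hτ)).self_of_nhds]

end SprayCongr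

/-! ### Warped products in charts -/

section WarpedCharts

variable {EB : Type*} [NormedAddCommGroup EB] [NormedSpace ℝ EB]
  {HB : Type*} [TopologicalSpace HB] {IB : ModelWithCorners ℝ EB HB} [IB.Boundaryless]
  {B : Type*} [TopologicalSpace B] [ChartedSpace HB B] [IsManifold IB ∞ B]
  {EF : Type*} [NormedAddCommGroup EF] [NormedSpace ℝ EF]
  {HF : Type*} [TopologicalSpace HF] {IF : ModelWithCorners ℝ EF HF} [IF.Boundaryless]
  {F : Type*} [TopologicalSpace F] [ChartedSpace HF F] [IsManifold IF ∞ F]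

lemma chart_prod_symm (p : B) (x : F) (u : EB × EF) :
    (extChartAt (IB.prod IF) (p, x)).symm u
      = ((extChartAt IB p).symm u.1, (extChartAt IF x).symm u.2) := by
  rw [extChartAt_prod]; rfl

lemma chart_prod_target (p : B) (x : F) :
    (extChartAt (IB.prod IF) (p, x)).target
      = (extChartAt IB p).target ×ˢ (extChartAt IF x).target := by
  rw [extChartAt_prod]; rfl

lemma chart_prod_source (p : B) (x : F) :
    (extChartAt (IB.prod IF) (p, x)).source
      = (extChartAt IB p).source ×ˢ (extChartAt IF x).source := by
  rw [extChartAt_prod]; rfl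

lemma chart_prod_apply (p : B) (x : F) (q : B × F) :
    extChartAt (IB.prod IF) (p, x) q = (extChartAt IB p q.1, extChartAt IF x q.2) := by
  rw [extChartAt_prod]; rfl

lemma frame_prod {p : B} {x : F} {u : EB × EF} (h1 : u.1 ∈ (extChartAt IB p).target)
    (h2 : u.2 ∈ (extChartAt IF x).target) :
    frame (IB.prod IF) (p, x) u = (frame IB p u.1).prodMap (frame IF x u.2) := by
  have h3 : ⇑(extChartAt (IB.prod IF) (p, x)).symm
      = Prod.map (extChartAt IB p).symm (extChartAt IF x).symm :=
    funext fun u => chart_prod_symm p x u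
  have h4 := mfderiv_prodMap (p := u) (mdifferentiableAt_chart_symm (I := IB) h1)
    (mdifferentiableAt_chart_symm (I := IF) h2)
  rw [← modelWithCornersSelf_prod, chartedSpaceSelf_prod] at h4
  unfold frame
  rw [h3]
  exact h4

variable {g : Bundle.ContMDiffRiemannianMetric IB ∞ EB (fun p : B => TangentSpace IB p)} {f : B → ℝ}
  {𝓕 : ∀ x : F, TangentSpace IF x → ℝ}

lemma metric_nonneg (p : B) (ξ : TangentSpace IB p) : 0 ≤ g.inner p ξ ξ := by
  by_cases h : ξ = 0
  · rw [h, map_zero]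
  · exact (g.pos p ξ h).le

lemma warpedFinsler_sq (z : B × F) (ξ : TangentSpace IB z.1) (v : TangentSpace IF z.2) :
    warpedFinsler IB IF g.inner f 𝓕 z (tangentSum IB IF z.1 z.2 ξ v) ^ 2
      = g.inner z.1 ξ ξ + f z.1 ^ 2 * 𝓕 z.2 v ^ 2 :=
  Real.sq_sqrt (add_nonneg (metric_nonneg z.1 ξ) (mul_nonneg (sq_nonneg _) (sq_nonneg _)))

lemma chartEnergy_warpedFinsler {p : B} {x : F} {z : (EB × EF) × (EB × EF)}
    (h1 : z.1.1 ∈ (extChartAt IB p).target) (h2 : z.1.2 ∈ (extChartAt IF x).target) :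
    chartEnergy (IB.prod IF) (warpedFinsler IB IF g.inner f 𝓕) (p, x) z
      = warpedEnergy (metricInChart IB g.inner p) (f ∘ (extChartAt IB p).symm)
        (chartEnergy IF 𝓕 x) z := by
  have h3 : chartEnergy (IB.prod IF) (warpedFinsler IB IF g.inner f 𝓕) (p, x) z
      = totalFun (I := IB.prod IF) (warpedFinsler IB IF g.inner f 𝓕)
        (tangentVector (IB.prod IF) ((extChartAt (IB.prod IF) (p, x)).symm z.1)
          (frame (IB.prod IF) (p, x) z.1 z.2)) ^ 2 / 2 := rfl
  rw [h3, chart_prod_symm, frame_prod h1 h2]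
  have h4 := warpedFinsler_sq (g := g) (f := f) (𝓕 := 𝓕)
    ((extChartAt IB p).symm z.1.1, (extChartAt IF x).symm z.1.2)
    (frame IB p z.1.1 z.2.1) (frame IF x z.1.2 z.2.2)
  refine (congrArg (· / 2) h4).trans ?_
  have h5 : metricInChart IB g.inner p z.1.1 z.2.1 z.2.1 = g.inner ((extChartAt IB p).symm z.1.1)
    (frame IB p z.1.1 z.2.1) (frame IB p z.1.1 z.2.1) := rfl
  simp only [warpedEnergy, h5, chartEnergy, energyInChart, Function.comp_apply]
  ring

lemma warpedFinsler_homogeneous (h : ∀ (x : F) (v : TangentSpace IF x) (t : ℝ), 0 < t →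
    𝓕 x (t • v) = t * 𝓕 x v) (z : B × F) (w : TangentSpace (IB.prod IF) z) (t : ℝ) (ht : 0 < t) :
    warpedFinsler IB IF g.inner f 𝓕 z (t • w) = t * warpedFinsler IB IF g.inner f 𝓕 z w := by
  have h1 : ∀ (ξ : TangentSpace IB z.1) (v : TangentSpace IF z.2),
      √(g.inner z.1 (t • ξ) (t • ξ) + f z.1 ^ 2 * 𝓕 z.2 (t • v) ^ 2)
        = t * √(g.inner z.1 ξ ξ + f z.1 ^ 2 * 𝓕 z.2 v ^ 2) := by
    intro ξ v
    rw [h _ _ _ ht, map_smul, map_smul, _root_.smul_apply, smul_eq_mul, smul_eq_mul]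
    have h2 : t * (t * g.inner z.1 ξ ξ) + f z.1 ^ 2 * (t * 𝓕 z.2 v) ^ 2
        = t ^ 2 * (g.inner z.1 ξ ξ + f z.1 ^ 2 * 𝓕 z.2 v ^ 2) := by ring
    rw [h2, Real.sqrt_mul (sq_nonneg t), Real.sqrt_sq ht.le]
  exact h1 (w : EB × EF).1 (w : EB × EF).2

variable [FiniteDimensional ℝ EB] [FiniteDimensional ℝ EF]

lemma warpedRegular_charts (hf : ContMDiff IB 𝓘(ℝ, ℝ) ∞ f) (hfpos : ∀ p, 0 < f p) {p : B} {x : F}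
    {v : EF} (hv : IsRegularAt IF 𝓕 x v) (ξ : EB) :
    WarpedRegular (metricInChart IB g.inner p) (f ∘ (extChartAt IB p).symm) (chartEnergy IF 𝓕 x)
      ((extChartAt IB p p, extChartAt IF x x), (ξ, v)) where
  smooth_metric := smoothNear_metricInChart g (mem_extChartAt_target p)
  symm_metric := Eventually.of_forall fun u X Y => metricInChart_symm g p u X Y
  pos_metric := metricInChart_pos g (mem_extChartAt_target p)
  smooth_fun := smoothNear_comp_chart_symm hf (mem_extChartAt_target p)
  pos_fun := hfpos _
  smooth_energy := hv.smoothNear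
  pos_energy := hv.pos

lemma eventually_chartEnergy_warpedFinsler (p : B) (x : F) (w : EB × EF) :
    chartEnergy (IB.prod IF) (warpedFinsler IB IF g.inner f 𝓕) (p, x)
      =ᶠ[𝓝 ((extChartAt IB p p, extChartAt IF x x), w)]
      warpedEnergy (metricInChart IB g.inner p) (f ∘ (extChartAt IB p).symm)
        (chartEnergy IF 𝓕 x) := by
  have c1 : ContinuousAt (fun z : (EB × EF) × (EB × EF) => z.1.1)
    ((extChartAt IB p p, extChartAt IF x x), w) := (continuous_fst.comp continuous_fst).continuousAt
  have c2 : ContinuousAt (fun z : (EB × EF) × (EB × EF) => z.1.2)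
    ((extChartAt IB p p, extChartAt IF x x), w) := (continuous_snd.comp continuous_fst).continuousAt
  filter_upwards [c1.eventually (eventually_mem_target (I := IB) (mem_extChartAt_target p)),
    c2.eventually (eventually_mem_target (I := IF) (mem_extChartAt_target x))] with z h1 h2
  exact chartEnergy_warpedFinsler h1 h2

/-- The energy at `(ξ, v)` is smooth because that of the fibre is smooth near `v`. It is positive,
since its fibre part is `f²` times `½ g_v(v, v)` with `v ≠ 0`, so its square root is smooth as well
even when `ξ = 0`. -/
lemma IsRegularAt.warpedFinsler (hf : ContMDiff IB 𝓘(ℝ, ℝ) ∞ f) (hfpos : ∀ p, 0 < f p) {p : B}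
    {x : F} {v : EF} (hv : IsRegularAt IF 𝓕 x v) (ξ : EB) :
    IsRegularAt (IB.prod IF) (warpedFinsler IB IF g.inner f 𝓕) (p, x) (ξ, v) := by
  have hreg := warpedRegular_charts (g := g) (p := p) hf hfpos hv ξ
  have hcongr := eventually_chartEnergy_warpedFinsler (g := g) (f := f) (𝓕 := 𝓕) p x (ξ, v)
  have hu : extChartAt (IB.prod IF) (p, x) (p, x) = (extChartAt IB p p, extChartAt IF x x) :=
    chart_prod_apply p x (p, x)
  have hh := chartEnergy_homogeneous hv.homogeneous x
  refine ⟨warpedFinsler_homogeneous hv.homogeneous, ?_, ?_, ?_⟩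
  · intro h0
    exact hv.ne_zero (congrArg Prod.snd h0)
  · refine isRegularNear_of_smoothNear (fun _ _ => Real.sqrt_nonneg _) ?_ ?_
    · rw [hu]
      exact hreg.smoothNear_warpedEnergy.congr hcongr
    · rw [hu, hcongr.self_of_nhds]
      have h1 : 0 < chartEnergy IF 𝓕 x (extChartAt IF x x, v) := by
        have h2 := hv.pos v hv.ne_zero
        have h3 := hh.fiberHessian_self hv.smoothNear
        simp only at h3
        rw [h3] at h2
        linarith
      have h4 : 0 ≤ metricInChart IB g.inner p (extChartAt IB p p) ξ ξ := metric_nonneg (g := g) _ _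
      have h5 := hreg.pos_fun
      unfold warpedEnergy
      positivity
  · rw [hu, (fiberHessian_congr hcongr).self_of_nhds]
    exact hreg.pos_warpedEnergy

end WarpedCharts

/-! ### The measure of a warped product -/

/-- Measurable representatives reduce this to the measurable case. Inverse charts are controlled
only on their targets, so almost everywhere measurability is what is available for them. -/
lemma map_prod_map_of_aemeasurable {α β γ δ : Type*} [MeasurableSpace α] [MeasurableSpace β]
    [MeasurableSpace γ] [MeasurableSpace δ] {μ : Measure α} {ν : Measure γ} [SFinite μ] [SFinite ν]
    {f : α → β} {g : γ → δ} (hf : AEMeasurable f μ) (hg : AEMeasurable g ν) :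
    (μ.map f).prod (ν.map g) = (μ.prod ν).map (Prod.map f g) := by
  rw [Measure.map_congr hf.ae_eq_mk, Measure.map_congr hg.ae_eq_mk,
    Measure.map_prod_map _ _ hf.measurable_mk hg.measurable_mk]
  refine Measure.map_congr ?_
  filter_upwards [Measure.quasiMeasurePreserving_fst.ae hf.ae_eq_mk,
    Measure.quasiMeasurePreserving_snd.ae hg.ae_eq_mk] with z h1 h2
  exact Prod.ext h1.symm h2.symm

variable (EB EF : Type*) [NormedAddCommGroup EB] [NormedSpace ℝ EB] [FiniteDimensional ℝ EB]
  [MeasurableSpace EB] [BorelSpace EB] [NormedAddCommGroup EF] [NormedSpace ℝ EF]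
  [FiniteDimensional ℝ EF] [MeasurableSpace EF] [BorelSpace EF] in
-- Both sides are Haar measures. The constant stays unspecified because the chosen basis of the
-- product is unrelated to those of the factors; it contributes only an additive constant to the
-- distortion.
lemma exists_lebesgue_prod : ∃ c : ℝ, 0 < c ∧
    (lebesgue EB).prod (lebesgue EF) = ENNReal.ofReal c • lebesgue (EB × EF) := by
  have h1 := Measure.isAddLeftInvariant_eq_smul ((lebesgue EB).prod (lebesgue EF))
    (lebesgue (EB × EF))
  have h2 := Measure.addHaarScalarFactor_pos_of_isAddHaarMeasure
    ((lebesgue EB).prod (lebesgue EF)) (lebesgue (EB × EF))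
  refine ⟨_, NNReal.coe_pos.2 h2, ?_⟩
  rw [ENNReal.ofReal_coe_nnreal]
  exact h1

section WarpedMeasure

variable {EB : Type*} [NormedAddCommGroup EB] [NormedSpace ℝ EB] [FiniteDimensional ℝ EB]
  [MeasurableSpace EB] [BorelSpace EB]
  {HB : Type*} [TopologicalSpace HB] {IB : ModelWithCorners ℝ EB HB} [IB.Boundaryless]
  {B : Type*} [TopologicalSpace B] [SecondCountableTopology B] [MeasurableSpace B] [BorelSpace B]
  [ChartedSpace HB B] [IsManifold IB ∞ B]
  {EF : Type*} [NormedAddCommGroup EF] [NormedSpace ℝ EF] [FiniteDimensional ℝ EF]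
  [MeasurableSpace EF] [BorelSpace EF]
  {HF : Type*} [TopologicalSpace HF] {IF : ModelWithCorners ℝ EF HF} [IF.Boundaryless]
  {F : Type*} [TopologicalSpace F] [SecondCountableTopology F] [MeasurableSpace F] [BorelSpace F]
  [ChartedSpace HF F] [IsManifold IF ∞ F]

lemma chartMeasure_prod {p : B} {x : F} {ρ : EB → ℝ} {σ : EF → ℝ} {c : ℝ} (hc : 0 < c)
    (hleb : (lebesgue EB).prod (lebesgue EF) = ENNReal.ofReal c • lebesgue (EB × EF))
    (hρ : ContinuousOn ρ (extChartAt IB p).target) (hσ : ContinuousOn σ (extChartAt IF x).target)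
    (hρ0 : ∀ u ∈ (extChartAt IB p).target, 0 ≤ ρ u) :
    (chartMeasure IB p ρ).prod (chartMeasure IF x σ)
      = chartMeasure (IB.prod IF) (p, x) fun u => c * (ρ u.1 * σ u.2) := by
  have hs : ⇑(extChartAt (IB.prod IF) (p, x)).symm
      = Prod.map (extChartAt IB p).symm (extChartAt IF x).symm :=
    funext fun u => chart_prod_symm p x u
  unfold chartMeasure
  rw [map_prod_map_of_aemeasurable
    ((aemeasurable_chart_symm p).mono_ac (withDensity_absolutelyContinuous _ _))
    ((aemeasurable_chart_symm x).mono_ac (withDensity_absolutelyContinuous _ _)), hs,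
    prod_withDensity₀ (hρ.aemeasurable (measurableSet_target p)).ennreal_ofReal
      (hσ.aemeasurable (measurableSet_target x)).ennreal_ofReal, Measure.prod_restrict, hleb,
    Measure.restrict_smul, withDensity_smul_measure, chart_prod_target,
    ← withDensity_smul' _ _ ENNReal.ofReal_ne_top]
  congr 1
  refine withDensity_congr_ae ?_
  filter_upwards [ae_restrict_mem ((measurableSet_target p).prod (measurableSet_target x))] with u hu
  rw [Pi.smul_apply, smul_eq_mul, ENNReal.ofReal_mul hc.le, ENNReal.ofReal_mul (hρ0 _ hu.1)]

variable {g : Bundle.ContMDiffRiemannianMetric IB ∞ EB (fun p : B => TangentSpace IB p)} {f : B → ℝ}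
  {mF : Measure F} {N : ℝ}

lemma sqrtDet_metricInChart_pos {p : B} {u : EB} (hu : u ∈ (extChartAt IB p).target) :
    0 < sqrtDet (metricInChart IB g.inner p u) :=
  sqrtDet_pos (metricInChart_symm g p u) (metricInChart_pos g hu)

lemma contDiffAt_sqrtDet_metricInChart {p : B} {u : EB} (hu : u ∈ (extChartAt IB p).target) :
    ContDiffAt ℝ ∞ (fun u => sqrtDet (metricInChart IB g.inner p u)) u :=
  ((smoothNear_metricInChart g hu).sqrtDet (metricInChart_symm g p u)
    (metricInChart_pos g hu)).contDiffAt

lemma restrict_withDensity_riemannianVolume (hf : ContMDiff IB 𝓘(ℝ, ℝ) ∞ f) (hfpos : ∀ p, 0 < f p)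
    (p : B) :
    ((riemannianVolume IB g.inner).withDensity fun p => ENNReal.ofReal (f p ^ N)).restrict
      (extChartAt IB p).source = chartMeasure IB p fun u => f ((extChartAt IB p).symm u) ^ N *
        sqrtDet (metricInChart IB g.inner p u) := by
  rw [restrict_withDensity (measurableSet_source p), restrict_riemannianVolume,
    ← restrict_chartMeasure_source, withDensity_restrict_chartMeasure p
      (isOpen_extChartAt_source p) (h := fun p => f p ^ N),
    restrict_chartMeasure_source]
  · exact fun u hu => (contDiffAt_sqrtDet_metricInChart hu.2).continuousAt.continuousWithinAt
  · exact (hf.continuous.rpow_const fun p => Or.inl (hfpos p).ne').continuousOn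
  · exact fun x _ => (Real.rpow_pos_of_pos (hfpos x) N).le

lemma HasSmoothDensity.warpedMeasure (hf : ContMDiff IB 𝓘(ℝ, ℝ) ∞ f) (hfpos : ∀ p, 0 < f p)
    (hm : IsSmoothMeasure IF mF) {c : ℝ} (hc : 0 < c)
    (hleb : (lebesgue EB).prod (lebesgue EF) = ENNReal.ofReal c • lebesgue (EB × EF))
    (p : B) {x : F} {ρ : EF → ℝ} (hρ : HasSmoothDensity IF mF x ρ) :
    HasSmoothDensity (IB.prod IF) (warpedMeasure IB g.inner f mF N) (p, x) fun u =>
      c * (f ((extChartAt IB p).symm u.1) ^ N * sqrtDet (metricInChart IB g.inner p u.1) * ρ u.2) := by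
  have hfs : ∀ u ∈ (extChartAt IB p).target,
      ContDiffAt ℝ ∞ (fun u => f ((extChartAt IB p).symm u) ^ N *
        sqrtDet (metricInChart IB g.inner p u)) u := fun u hu =>
    ((smoothNear_comp_chart_symm hf hu).contDiffAt.rpow_const_of_ne (hfpos _).ne').mul
      (contDiffAt_sqrtDet_metricInChart hu)
  have hfs0 : ∀ u ∈ (extChartAt IB p).target, 0 < f ((extChartAt IB p).symm u) ^ N *
      sqrtDet (metricInChart IB g.inner p u) := fun u hu =>
    mul_pos (Real.rpow_pos_of_pos (hfpos _) N) (sqrtDet_metricInChart_pos hu)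
  -- Restricting a product measure to a product of chart domains uses s-finite factors; second
  -- countability provides this.
  have : SFinite mF := by
    refine sFinite_of_restrict_source (I := IF) fun y => ?_
    obtain ⟨σ, _, _, h⟩ := hm y
    rw [h]
    infer_instance
  have : SFinite ((riemannianVolume IB g.inner).withDensity fun p => ENNReal.ofReal (f p ^ N)) := by
    refine sFinite_of_restrict_source (I := IB) fun y => ?_
    rw [restrict_withDensity_riemannianVolume hf hfpos]
    infer_instance
  refine ⟨?_, ?_, ?_⟩
  · rw [chart_prod_target]
    intro u hu
    have h1 : ContDiffAt ℝ ∞ ρ u.2 := (hρ.smoothNear hu.2).contDiffAt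
    exact (contDiffAt_const.mul (((hfs _ hu.1).comp u contDiffAt_fst).mul
      (h1.comp u contDiffAt_snd))).contDiffWithinAt
  · rw [chart_prod_target]
    exact fun u hu => mul_pos hc (mul_pos (hfs0 _ hu.1) (hρ.pos _ hu.2))
  · rw [chart_prod_source, WarpedFinsler.warpedMeasure, ← Measure.prod_restrict,
      restrict_withDensity_riemannianVolume hf hfpos, hρ.restrict_eq]
    exact chartMeasure_prod hc hleb
      (fun u hu => (hfs u hu).continuousAt.continuousWithinAt) hρ.smooth.continuousOn
      (fun u hu => (hfs0 u hu).le)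

end WarpedMeasure

/-! ### The `N`-Ricci curvature of a warped product -/

section WarpedRicci

variable {EB : Type*} [NormedAddCommGroup EB] [NormedSpace ℝ EB] [FiniteDimensional ℝ EB]
  {EF : Type*} [NormedAddCommGroup EF] [NormedSpace ℝ EF] [FiniteDimensional ℝ EF]
  {G : EB → EB →L[ℝ] EB →L[ℝ] ℝ} {f : EB → ℝ} {Λ : EF × EF → ℝ} {z : (EB × EF) × (EB × EF)}

/-- Both excesses, `(N + d) - (d + n)` and `N - n`, coincide, so the same case of the definition
applies to the product and to the fibre. For `N > n` the mixed terms and the squares of `df(ξ)/f`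
cancel, and the weight `(n - N) log f` changes the coefficients `n` and `n - 1` into `N` and `N -
1`. -/
theorem WarpedRegular.sprayNRicci_warpedSpray (h : WarpedRegular G f Λ z)
    (hh : IsFiberHomogeneous 2 Λ) {τ : EF × EF → ℝ} (hτh : IsFiberHomogeneous 0 τ)
    (hτ : SmoothNear τ (z.1.2, z.2.2)) (N c : ℝ) :
    sprayNRicci (warpedSpray G f Λ) (fun z' : (EB × EF) × (EB × EF) =>
        τ (z'.1.2, z'.2.2) + (finrank ℝ EF - N) * Real.log (f z'.1.1) + c) (N + finrank ℝ EB) z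
      = ((localRicci G z.1.1 z.2.1 z.2.1
            - N * localHessian G f z.1.1 z.2.1 z.2.1 / f z.1.1 : ℝ) : EReal)
        + sprayNRicci (spray Λ) τ N (z.1.2, z.2.2)
        - (((localLaplacian G f z.1.1 / f z.1.1 + (N - 1) * localGradSq G f z.1.1 / f z.1.1 ^ 2)
            * (f z.1.1 ^ 2 * (2 * Λ (z.1.2, z.2.2))) : ℝ) : EReal) := by
  have hf0 := h.pos_fun.ne'
  have hd : ((finrank ℝ (EB × EF) : ℕ) : ℝ) = finrank ℝ EB + finrank ℝ EF := by
    rw [finrank_prod, Nat.cast_add]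
  have hD : ((f z.1.1)⁻¹ • fderiv ℝ f z.1.1) z.2.1 = fderiv ℝ f z.1.1 z.2.1 / f z.1.1 := by
    rw [_root_.smul_apply, smul_eq_mul, div_eq_inv_mul]
  unfold sprayNRicci
  simp only [h.sprayRicci_warpedSpray hh, h.sprayDeriv_warpedSpray hτh hτ,
    h.sprayDeriv_sprayDeriv_warpedSpray hh hτh hτ, hd, hD]
  rcases lt_trichotomy ((finrank ℝ EF : ℕ) : ℝ) N with hN | hN | hN
  · have hN' : (finrank ℝ EB : ℝ) + finrank ℝ EF < N + finrank ℝ EB := by linarith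
    rw [if_pos hN, if_pos hN', ← EReal.coe_add, ← EReal.coe_sub]
    congr 1
    have hN0 : N - finrank ℝ EF ≠ 0 := by linarith
    have hsub : N + (finrank ℝ EB : ℝ) - (finrank ℝ EB + finrank ℝ EF) = N - finrank ℝ EF := by ring
    rw [hsub]
    field_simp
    ring
  · have h1 : ¬((finrank ℝ EF : ℕ) : ℝ) < N := hN.not_lt
    have h2 : ¬((finrank ℝ EB : ℝ) + finrank ℝ EF < N + finrank ℝ EB) := by linarith
    have h3 : N + (finrank ℝ EB : ℝ) = finrank ℝ EB + finrank ℝ EF := by linarith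
    rw [if_neg h1, if_neg h2, if_pos h3, if_pos hN.symm]
    -- For `N = n` the factor in front of `log f` vanishes, so the weights of product and fibre have
    -- the same derivative along the spray and fall into the same subcase.
    have hk : (finrank ℝ EF : ℝ) - N = 0 := by linarith
    simp only [hk, zero_mul, add_zero]
    by_cases hσ : sprayDeriv (spray Λ) τ (z.1.2, z.2.2) = 0
    · rw [if_pos hσ, if_pos hσ, ← EReal.coe_add, ← EReal.coe_sub]
      congr 1
      rw [hσ, ← hN]
      field_simp
      ring
    · rw [if_neg hσ, if_neg hσ]
      simp
  · have h1 : ¬((finrank ℝ EF : ℕ) : ℝ) < N := by linarith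
    have h2 : ¬((finrank ℝ EB : ℝ) + finrank ℝ EF < N + finrank ℝ EB) := by linarith
    have h3 : ¬(N + (finrank ℝ EB : ℝ) = finrank ℝ EB + finrank ℝ EF) := by
      intro h; linarith
    have h4 : ¬(N = finrank ℝ EF) := by
      intro h; linarith
    -- Both curvatures are `⊥`, which absorbs the finite terms. The branch is right also for the
    -- product vector, which is nonzero because `v` is.
    rw [if_neg h1, if_neg h2, if_neg h3, if_neg h4]
    simp

/-- The distortion of a warped product. -/
lemma WarpedRegular.distortion_warpedEnergy (h : WarpedRegular G f Λ z) {ρ : EF → ℝ}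
    (hρ : 0 < ρ z.1.2) {c c' : ℝ} (hc : 0 < c) (hc' : 0 < c')
    (hblock : ∀ (b : (EB × EF) →L[ℝ] (EB × EF) →L[ℝ] ℝ)
      (g : EB →L[ℝ] EB →L[ℝ] ℝ) (h : EF →L[ℝ] EF →L[ℝ] ℝ),
      (∀ X Y, b X Y = g X.1 Y.1 + h X.2 Y.2) → 0 < (gram g (finBasis ℝ EB)).det →
        sqrtDet b = c' * (sqrtDet g * sqrtDet h)) (N : ℝ) :
    distortion (warpedEnergy G f Λ) (fun u => c * (f u.1 ^ N * sqrtDet (G u.1) * ρ u.2)) z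
      = distortion Λ ρ (z.1.2, z.2.2) + (finrank ℝ EF - N) * Real.log (f z.1.1)
        + (Real.log c' - Real.log c) := by
  have hG := sqrtDet_pos h.symm_metric.self_of_nhds h.pos_metric
  have hΛ := sqrtDet_pos (fiberHessian_symm h.smooth_energy) h.pos_energy
  have hf := h.pos_fun
  have h1 := hblock (fiberHessian (warpedEnergy G f Λ) z) (G z.1.1)
    (f z.1.1 ^ 2 • fiberHessian Λ (z.1.2, z.2.2))
    (fun X Y => h.fiberHessian_warpedEnergy X.1 Y.1 X.2 Y.2)
    (det_gram_pos h.symm_metric.self_of_nhds h.pos_metric _)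
  have hfN := Real.rpow_pos_of_pos hf N
  have hfn := pow_pos hf (finrank ℝ EF)
  rw [distortion, distortion, h1, sqrtDet_smul hf, Real.log_mul hc'.ne' (by positivity),
    Real.log_mul hG.ne' (by positivity), Real.log_mul hfn.ne' hΛ.ne', Real.log_pow,
    Real.log_mul hc.ne' (by positivity), Real.log_mul (by positivity) hρ.ne',
    Real.log_mul hfN.ne' hG.ne', Real.log_rpow hf]
  ring

end WarpedRicci

end WarpedFinsler

end

/-! ### Assembly of the theorem. -/

open WarpedFinsler in
theorem mainTheorem3
    {EB : Type*} [NormedAddCommGroup EB] [NormedSpace ℝ EB] [FiniteDimensional ℝ EB]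
    [MeasurableSpace EB] [BorelSpace EB]
    {HB : Type*} [TopologicalSpace HB] (IB : ModelWithCorners ℝ EB HB) [IB.Boundaryless]
    {B : Type*} [TopologicalSpace B] [T2Space B] [SecondCountableTopology B]
    [MeasurableSpace B] [BorelSpace B] [ChartedSpace HB B] [IsManifold IB ∞ B]
    {EF : Type*} [NormedAddCommGroup EF] [NormedSpace ℝ EF] [FiniteDimensional ℝ EF]
    [MeasurableSpace EF] [BorelSpace EF]
    {HF : Type*} [TopologicalSpace HF] (IF : ModelWithCorners ℝ EF HF) [IF.Boundaryless]
    {F : Type*} [TopologicalSpace F] [T2Space F] [SecondCountableTopology F]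
    [MeasurableSpace F] [BorelSpace F] [ChartedSpace HF F] [IsManifold IF ∞ F]
    (gB : Bundle.ContMDiffRiemannianMetric IB ∞ EB (fun p : B => TangentSpace IB p))
    (f : B → ℝ) (hf : ContMDiff IB 𝓘(ℝ, ℝ) ∞ f) (hfpos : ∀ p, 0 < f p)
    (𝓕 : FinslerStructure IF F) (mF : Measure F) (hmF : IsSmoothMeasure IF mF)
    (N : ℝ) (hN : 1 ≤ N)
    (p : B) (x : F) (ξ : TangentSpace IB p) (v : TangentSpace IF x) (hv : v ≠ 0) :
    (∃! r, HasNRicci (IB.prod IF) (warpedFinsler IB IF gB.inner f 𝓕.toFun)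
      (warpedMeasure IB gB.inner f mF N) (N + finrank ℝ EB) (p, x) (tangentSum IB IF p x ξ v) r) ∧
    (∃! r, HasNRicci IF 𝓕.toFun mF N x v r) ∧
    nRicci (IB.prod IF) (warpedFinsler IB IF gB.inner f 𝓕.toFun)
        (warpedMeasure IB gB.inner f mF N) (N + finrank ℝ EB) (p, x) (tangentSum IB IF p x ξ v) =
      ((ricci IB gB.inner p ξ ξ - N * hessian IB gB.inner f p ξ ξ / f p : ℝ) : EReal)
        + nRicci IF 𝓕.toFun mF N x v
        - (((laplacian IB gB.inner f p / f p + (N - 1) * gradSq IB gB.inner f p / f p ^ 2)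
            * warpedFinsler IB IF gB.inner f 𝓕.toFun (p, x) (tangentSum IB IF p x 0 v) ^ 2 : ℝ) :
              EReal) := by
  have hvne : (v : EF) ≠ 0 := hv
  have hvF : IsRegularAt IF 𝓕.toFun x (v : EF) := 𝓕.isRegularAt hvne
  obtain ⟨ρ, hρs, hρp, hρr⟩ := hmF x
  have hρ : HasSmoothDensity IF mF x ρ := ⟨hρs, hρp, hρr⟩
  -- `c` and `c'` compare the chosen basis of `EB × EF` with the product basis, for volumes and for
  -- Gram determinants. They survive only as `log c' - log c`, which differentiation along the spray
  -- removes.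
  obtain ⟨c, hc, hleb⟩ := exists_lebesgue_prod EB EF
  obtain ⟨c', hc', hblock⟩ := exists_sqrtDet_block EB EF
  have hC : IsRegularAt (IB.prod IF) (warpedFinsler IB IF gB.inner f 𝓕.toFun) (p, x)
      ((ξ, v) : EB × EF) := hvF.warpedFinsler hf hfpos ξ
  have hρC := HasSmoothDensity.warpedMeasure (g := gB) (N := N) hf hfpos hmF hc hleb p hρ
  have hu : extChartAt (IB.prod IF) (p, x) (p, x) = (extChartAt IB p p, extChartAt IF x x) :=
    chart_prod_apply p x (p, x)
  have hreg := warpedRegular_charts (g := gB) (p := p) hf hfpos hvF ξ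
  have hcongr := eventually_chartEnergy_warpedFinsler (g := gB) (f := f) (𝓕 := 𝓕.toFun) p x
    ((ξ, v) : EB × EF)
  have hh := chartEnergy_homogeneous (I := IF) 𝓕.homogeneous x
  have hx := mem_extChartAt_target (I := IF) x
  -- The spray is differentiated again in the curvature, so agreement is needed on a neighbourhood
  -- and not only at the given vector.
  have hspray := (spray_congr hcongr).trans
    (hreg.eventually.mono fun z hz => hz.spray_warpedEnergy hh)
  have hdist : distortion (chartEnergy (IB.prod IF) (warpedFinsler IB IF gB.inner f 𝓕.toFun) (p, x))
      (fun u => c * (f ((extChartAt IB p).symm u.1) ^ N *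
        sqrtDet (metricInChart IB gB.inner p u.1) * ρ u.2))
      =ᶠ[𝓝 ((extChartAt IB p p, extChartAt IF x x), ((ξ, v) : EB × EF))]
      fun z => distortion (chartEnergy IF 𝓕.toFun x) ρ (z.1.2, z.2.2)
        + (finrank ℝ EF - N) * Real.log ((f ∘ (extChartAt IB p).symm) z.1.1)
        + (Real.log c' - Real.log c) := by
    have hcont : ContinuousAt (fun z : (EB × EF) × (EB × EF) => z.1.2)
        ((extChartAt IB p p, extChartAt IF x x), ((ξ, v) : EB × EF)) :=
      (continuous_snd.comp continuous_fst).continuousAt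
    filter_upwards [fiberHessian_congr hcongr, hreg.eventually,
      hcont.eventually (eventually_mem_target hx)] with z h1 h2 h3
    refine Eq.trans ?_ (h2.distortion_warpedEnergy (hρp _ h3) hc hc' hblock N)
    rw [distortion, distortion, h1]
    rfl
  have hτ := hvF.smoothNear.distortion hvF.pos (hρ.smoothNear hx) (hρp _ hx)
  have hF := hvF.nRicci_eq hρ N
  have hCr := hC.nRicci_eq hρC (N + finrank ℝ EB)
  have hmain := (sprayNRicci_congr hspray hdist (N + finrank ℝ EB)).trans
    (hreg.sprayNRicci_warpedSpray hh (hh.distortion ρ) hτ N (Real.log c' - Real.log c))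
  -- Existence and uniqueness are the two directions of the characterization by the spray.
  refine ⟨⟨_, (hC.hasNRicci_iff hρC _ _).2 rfl, fun r hr => (hC.hasNRicci_iff hρC _ _).1 hr⟩,
    ⟨_, (hvF.hasNRicci_iff hρ _ _).2 rfl, fun r hr => (hvF.hasNRicci_iff hρ _ _).1 hr⟩, ?_⟩
  have hnorm : warpedFinsler IB IF gB.inner f 𝓕.toFun (p, x) (tangentSum IB IF p x 0 v) ^ 2
      = (f ∘ (extChartAt IB p).symm) (extChartAt IB p p) ^ 2
        * (2 * chartEnergy IF 𝓕.toFun x (extChartAt IF x x, v)) := by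
    have h1 : chartEnergy IF 𝓕.toFun x (extChartAt IF x x, v) = 𝓕.toFun x v ^ 2 / 2 :=
      chartEnergy_center 𝓕.toFun x v
    have h3 := warpedFinsler_sq (g := gB) (f := f) (𝓕 := 𝓕.toFun) (p, x) 0 v
    rw [map_zero, zero_add] at h3
    rw [h1, mul_div_cancel₀ _ two_ne_zero, Function.comp_apply, extChartAt_to_inv]
    exact h3
  have hfp : (f ∘ (extChartAt IB p).symm) (extChartAt IB p p) = f p := by
    rw [Function.comp_apply, extChartAt_to_inv]
  rw [hu] at hCr
  refine hCr.trans (hmain.trans ?_)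
  rw [hnorm, hF]
  simp only [hfp]
  rfl
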